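/- A smooth Kähler metric $g=(g_{i\bar j})$ on $\mathbb C^n$ is a (steady) gradient Kähler-Ricci soliton if there is a smooth real-valued function $f$ on $\mathbb C^n$ with $R_{i\bar j}=f_{,i\bar j}$ and $f_{,ij}=0$ (covariant derivatives of $g$), where $R_{i\bar j}=-\partial_i\partial_{\bar j}\log\det g$. It is rotationally symmetric if it is invariant under $U(n)$. Completeness and sectional curvature refer to the Riemannian metric $ds^2=g_{i\bar j}\,dz^i\,d\bar z^j$. Theorem. For every $n\ge 1$ there is on $\mathbb C^n$ a complete, rotationally symmetric, gradient Kähler-Ricci soliton $g$ of positive sectional curvature. Such a soliton is unique up to scaling and dilation: every complete rotationally symmetric gradient Kähler-Ricci soliton $g'$ of positive sectional curvature on $\mathbb C^n$ is of the form $g'=c\,\delta_a^*g$ with constants $c,a>0$, where $\delta_a(z)=az$. More generally, every complete rotationally symmetric gradient Kähler-Ricci soliton on $\mathbb C^n$ is either a constant positive multiple of the Euclidean metric or of this form. The soliton $g$ can be taken as follows. There is a smooth function $\varphi:\mathbb R\to\mathbb R$ with $\varphi>0$, $\varphi'>0$, $\lim_{t\to-\infty}\varphi(t)=0$ and $$\varphi^{n-1}\varphi'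 e^{\varphi}=e^{nt},$$ which is given implicitly by $$\sum_{k=0}^{n-1}(-1)^{n-k-1}\frac{n!}{k!}\,\varphi^k e^{\varphi}=e^{nt}+(-1)^{n-1}n!,$$ and $g_{i\bar j}=\partial_i\partial_{\bar j}\Phi$ for a smooth function $\Phi$ on $\mathbb C^n$ with $\Phi(z)=u(t)$, $t=\log|z|^2$, for $z\neq0$, where $u'=\varphi$. For all $t\in\mathbb R$ one has $\varphi-\varphi'>0$, $(\varphi')^2-\varphi\varphi''>0$ and $(\varphi'')^2-\varphi'\varphi'''>0$. For $n=1$, $g$ is Hamilton's cigar soliton $ds^2=|dz|^2/(1+|z|^2)$. -/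

import Mathlib

open scoped ContDiff Manifold ENNReal Topology ComplexOrder

noncomputable section

namespace KRSoliton

/-- `ℂⁿ` with its standard Hermitian norm. -/
abbrev Cn (n : ℕ) : Type := EuclideanSpace ℂ (Fin n)

variable {n : ℕ}

/-- The Wirtinger derivative `∂F/∂zⁱ = ½ (∂F/∂xⁱ - √-1 ∂F/∂yⁱ)`. -/
def dz (i : Fin n) (F : Cn n → ℂ) (z : Cn n) : ℂ :=
  (1 / 2) * (fderiv ℝ F z (EuclideanSpace.single i 1)
    - Complex.I * fderiv ℝ F z (EuclideanSpace.single i Complex.I))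

/-- The Wirtinger derivative `∂F/∂z̄ⁱ = ½ (∂F/∂xⁱ + √-1 ∂F/∂yⁱ)`. -/
def dzbar (i : Fin n) (F : Cn n → ℂ) (z : Cn n) : ℂ :=
  (1 / 2) * (fderiv ℝ F z (EuclideanSpace.single i 1)
    + Complex.I * fderiv ℝ F z (EuclideanSpace.single i Complex.I))

/-- The complex Hessian `∂ᵢ∂_j̄ f` of a real-valued function. -/
def ddbar (f : Cn n → ℝ) (z : Cn n) (i j : Fin n) : ℂ :=
  dz i (dzbar j (fun w => (f w : ℂ))) z

/-- A field of `n × n` complex matrices on `ℂⁿ`; the entry `g z i j` stands for `g_{i j̄}(z)`. -/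
abbrev MetricField (n : ℕ) : Type := Cn n → Matrix (Fin n) (Fin n) ℂ

/-- The sesquilinear form `g_{i j̄}(z) vⁱ w̄ʲ`. -/
def herm (g : MetricField n) (z v w : Cn n) : ℂ :=
  ∑ i, ∑ j, g z i j * v i * (starRingEnd ℂ) (w j)

/-- The Riemannian metric `ds² = g_{i j̄} dzⁱ dz̄ʲ`, as a real inner product on the tangent space
`ℂⁿ` at `z`. -/
def realInner (g : MetricField n) (z v w : Cn n) : ℝ := (herm g z v w).re

/-- A smooth Kähler metric `g_{i j̄}` on `ℂⁿ`: smooth, Hermitian, positive definite,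
with closed Kähler form. -/
structure IsKahlerMetric (g : MetricField n) : Prop where
  smooth : ∀ i j, ContDiff ℝ ∞ (fun z => g z i j)
  posDef : ∀ z, (g z).PosDef
  closed : ∀ z i j k, dz k (fun w => g w i j) z = dz i (fun w => g w k j) z

/-- The inverse metric `g^{k l̄}`, normalised by `∑_l g^{k l̄} g_{j l̄} = δ^k_j`. -/
def gInv (g : MetricField n) (z : Cn n) (k l : Fin n) : ℂ := (g z)⁻¹ l k

/-- The Ricci tensor `R_{i j̄} = -∂ᵢ∂_j̄ log det g`. -/
def ricci (g : MetricField n) (z : Cn n) (i j : Fin n) : ℂ :=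
  ddbar (fun w => -Real.log (g w).det.re) z i j

/-- The Christoffel symbols `Γ^k_{ij} = g^{k l̄} ∂ᵢ g_{j l̄}`. -/
def christoffel (g : MetricField n) (z : Cn n) (i j k : Fin n) : ℂ :=
  ∑ l, gInv g z k l * dz i (fun w => g w j l) z

/-- The second covariant derivative `f_{,ij} = ∂ᵢ∂ⱼ f - Γ^k_{ij} ∂ₖ f` of type `(2,0)`. -/
def covHess (g : MetricField n) (f : Cn n → ℝ) (z : Cn n) (i j : Fin n) : ℂ :=
  dz i (dz j (fun w => (f w : ℂ))) z
    - ∑ k, christoffel g z i j k * dz k (fun w => (f w : ℂ)) z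

/-- A steady gradient Kähler-Ricci soliton: `R_{i j̄} = f_{,i j̄}` and `f_{,ij} = 0` for some
smooth real-valued function `f`. -/
structure IsGradientSoliton (g : MetricField n) : Prop where
  kahler : IsKahlerMetric g
  soliton : ∃ f : Cn n → ℝ, ContDiff ℝ ∞ f ∧
    (∀ z i j, ricci g z i j = ddbar f z i j) ∧ (∀ z i j, covHess g f z i j = 0)

/-- Rotational symmetry: every unitary transformation of `ℂⁿ` is an isometry of `g`. -/
def IsUnitaryInvariant (g : MetricField n) : Prop :=
  ∀ (U : Cn n ≃ₗᵢ[ℂ] Cn n) (z v w : Cn n), herm g (U z) (U v) (U w) = herm g z v w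

/-- The length of the tangent vector `v ∈ ℂⁿ = T_z ℂⁿ` for the Riemannian metric of `g`. -/
def tangentLength (g : MetricField n) (z v : Cn n) : ℝ≥0∞ :=
  ENNReal.ofReal (Real.sqrt (realInner g z v v))

/-- The length of tangent vectors as an extended norm on the tangent spaces. -/
abbrev tangentENorm (g : MetricField n) (z : Cn n) : ENorm (TangentSpace 𝓘(ℝ, Cn n) z) :=
  ⟨tangentLength g z⟩

/-- The Riemannian distance of `g`: the infimum of the `g`-lengths of `C¹` paths. -/
def gDist (g : MetricField n) (x y : Cn n) : ℝ≥0∞ :=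
  @Manifold.riemannianEDist (Cn n) _ _ (Cn n) _ 𝓘(ℝ, Cn n) (Cn n) _ _ (tangentENorm g) x y

/-- Completeness: every Cauchy sequence for the Riemannian distance of `g` converges. -/
def IsCompleteMetric (g : MetricField n) : Prop :=
  ∀ x : ℕ → Cn n,
    (∀ ε : ℝ≥0∞, 0 < ε → ∃ N, ∀ k, N ≤ k → ∀ m, N ≤ m → gDist g (x k) (x m) < ε) →
    ∃ p : Cn n, Filter.Tendsto (fun k => gDist g (x k) p) Filter.atTop (𝓝 0)

/-- The curvature tensor
`R_{i j̄ k l̄} = -∂ₖ∂_l̄ g_{i j̄} + g^{p q̄} ∂ₖ g_{i q̄} ∂_l̄ g_{p j̄}`. -/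
def curv (g : MetricField n) (z : Cn n) (i j k l : Fin n) : ℂ :=
  -dz k (dzbar l (fun w => g w i j)) z
    + ∑ p, ∑ q, gInv g z p q * dz k (fun w => g w i q) z * dzbar l (fun w => g w p j) z

/-- The sectional curvature of the real 2-plane spanned by `v, w ∈ ℂⁿ = T_z ℂⁿ`, for the
Riemannian metric `ds² = g_{i j̄} dzⁱ dz̄ʲ`. The factor `1/2` is the one that belongs to this
normalisation of the Riemannian metric. -/
def sectionalCurvature (g : MetricField n) (z v w : Cn n) : ℝ :=
  (1 / 2) * (∑ i, ∑ j, ∑ k, ∑ l, curv g z i j k l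
      * (v i * (starRingEnd ℂ) (w j) - w i * (starRingEnd ℂ) (v j))
      * (w k * (starRingEnd ℂ) (v l) - v k * (starRingEnd ℂ) (w l))).re
    / (realInner g z v v * realInner g z w w - realInner g z v w ^ 2)

/-- All sectional curvatures (of real tangent 2-planes) are positive. -/
def HasPositiveSectionalCurvature (g : MetricField n) : Prop :=
  ∀ z v w : Cn n, LinearIndependent ℝ ![v, w] → 0 < sectionalCurvature g z v w

/-- `g'` arises from `g` by a dilation `z ↦ a z` of the variable (pull-back) and a scaling of the
metric by `c`. -/
def IsScalingDilationOf (g' g : MetricField n) : Prop :=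
  ∃ c a : ℝ, 0 < c ∧ 0 < a ∧ ∀ z i j, g' z i j = (c * a ^ 2 : ℝ) * g (a • z) i j

/-- A constant positive multiple of the Euclidean metric. -/
def IsEuclidean (g : MetricField n) : Prop :=
  ∃ c : ℝ, 0 < c ∧ ∀ z i j, g z i j = if i = j then (c : ℂ) else 0

/-- The profile of the soliton: a smooth function `φ` on `ℝ` with `φ, φ' > 0`, `φ → 0` at `-∞`,
solving `φⁿ⁻¹ φ' e^φ = e^{nt}`. -/
structure IsProfile (n : ℕ) (φ : ℝ → ℝ) : Prop where
  smooth : ContDiff ℝ ∞ φ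
  pos : ∀ t, 0 < φ t
  deriv_pos : ∀ t, 0 < deriv φ t
  tendsto_zero : Filter.Tendsto φ Filter.atBot (𝓝 0)
  ode : ∀ t, φ t ^ (n - 1) * deriv φ t * Real.exp (φ t) = Real.exp (n * t)

end KRSoliton

end

open KRSoliton

/-! Away from the origin a `U(n)`-invariant Kähler metric is `h δ_ij + h' z̄ⁱ zʲ` with `h` a
function of `s = |z|²` (`IsKahlerMetric.exists_radial`). Its eigenvalues are `h` on the complement
of `z` and `(sh)'` along `z`, so `det g = hⁿ⁻¹ (sh)'`. The condition `f_{,ij} = 0` says that the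
gradient field of `f` is holomorphic; for radial `f` this field is a multiple of the Euler field, so
`f = c·sh` up to a constant. The soliton equation then reads `log det g + c·sh = const`, that is,
`xⁿ⁻¹ x' e^{cx} = K sⁿ⁻¹` for `x = sh`. With `s = e^t` and `c = K = 1` this is the equation for `φ`.

Existence: the equation integrates to `φⁿ H(φ) = e^{nt}` with `H(x) = n ∫₀¹ uⁿ⁻¹ e^{xu} du`. Since
`H` is smooth and positive, `s = x H(x)^{1/n}` has a nonvanishing derivative even at `x = 0`. Hence
`x`, and also `h = x/s = H(x)^{-1/n}`, are smooth functions of `s` up to `s = 0`, and the metric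
extends smoothly over the origin.

Curvature: with respect to the splitting into the direction of `z` and its complement, the curvature
form has three coefficients `A` (radial), `B` (mixed), `C` (orthogonal). They are positive multiples
of `(φ'')² - φ'φ'''`, `(φ')² - φφ''`, `φ - φ'`. For real planes the argument needs their positivity
and, if `n ≥ 2`, also `B² < 2AC` (`curvature_positivity`). With `x = φ` and `P = φ - φ'` one has
`xⁿ⁻¹ e^x P = ∫₀ˣ yⁿ e^y dy`, and everything becomes a two-sided estimate of this integral: `B > 0`
is `(x + n) P < x²`, and `B² < 2AC` is `x² < (2 + W) P` with `W² = (x+n-2)² + 2n`. Both follow by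
comparison with barriers for a linear first-order equation (`powExpIntegral_upper`,
`powExpIntegral_lower`).

Completeness: `log (1 + |z|²)` is proper and Lipschitz for `g`, because the radial eigenvalue is at
least a constant over `1 + s`.

Uniqueness: the potential `f` of a given soliton need not be invariant. On a complex coordinate axis
the two soliton conditions say that two functions are entire, and the mean value property on circles
extracts the radial equation with some constant `c` (`exists_deriv_log_det`). If `c = 0` the metric
is Euclidean; if `c < 0` there is no global solution, since `∫ xⁿ⁻¹ e^{cx} dx` converges; if `c > 0`
rescaling leads to `φ`. Positive curvature excludes the flat case. -/

namespace KRSoliton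

noncomputable section

/-! ### Exponential moments of the unit interval -/

/-- The function `x ↦ ∫₀¹ uᵐ e^{xu} du`. -/
def expMoment (m : ℕ) (x : ℝ) : ℝ := ∫ u in (0 : ℝ)..1, u ^ m * Real.exp (x * u)

theorem expMoment_hasDerivAt (m : ℕ) (x : ℝ) :
    HasDerivAt (expMoment m) (expMoment (m + 1) x) x := by
  have := intervalIntegral.hasDerivAt_integral_of_dominated_loc_of_deriv_le
    (μ := MeasureTheory.volume) (a := 0) (b := 1) (s := Metric.ball x 1)
    (F := fun y u : ℝ => u ^ m * Real.exp (y * u))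
    (F' := fun y u : ℝ => u ^ (m + 1) * Real.exp (y * u)) (x₀ := x)
    -- For `|y - x| < 1` and `u ∈ (0, 1]` one has `yu ≤ |x| + 1` and `u^{m+1} ≤ 1`.
    (bound := fun _ => Real.exp (|x| + 1)) (Metric.ball_mem_nhds x one_pos)
    (Filter.Eventually.of_forall fun y => by
      apply Continuous.aestronglyMeasurable; fun_prop)
    (by apply Continuous.intervalIntegrable; fun_prop)
    (by apply Continuous.aestronglyMeasurable; fun_prop)
    (Filter.Eventually.of_forall fun u hu y hy => ?_)
    (by simp)
    (Filter.Eventually.of_forall fun u hu y hy => ?_)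
  · exact this.2
  · rw [Set.uIoc_of_le zero_le_one] at hu
    have h1 : |u ^ (m + 1)| ≤ 1 := by
      rw [abs_of_nonneg (by have := hu.1; positivity)]; exact pow_le_one₀ hu.1.le hu.2
    have h2 : y * u ≤ |x| + 1 := by
      have h3 : |y| ≤ |x| + 1 := by
        rw [Metric.mem_ball, Real.dist_eq] at hy
        have := abs_sub_abs_le_abs_sub y x
        linarith
      have : y * u ≤ |y| * 1 :=
        (le_abs_self _).trans (by
          rw [abs_mul, abs_of_pos hu.1]
          exact mul_le_mul_of_nonneg_left hu.2 (abs_nonneg y))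
      linarith
    rw [Real.norm_eq_abs, abs_mul, Real.abs_exp]
    calc _ ≤ 1 * Real.exp (|x| + 1) :=
          mul_le_mul h1 (Real.exp_le_exp.2 h2) (Real.exp_pos _).le zero_le_one
      _ = _ := one_mul _
  · have := (((hasDerivAt_id y).mul_const u).exp).const_mul (u ^ m)
    refine this.congr_deriv ?_
    simp only [id, one_mul]
    ring

theorem expMoment_contDiff (m : ℕ) : ContDiff ℝ ∞ (expMoment m) := by
  rw [contDiff_infty]
  intro k
  induction k generalizing m with
  | zero =>
    rw [Nat.cast_zero, contDiff_zero]
    exact continuous_iff_continuousAt.2 fun x => (expMoment_hasDerivAt m x).continuousAt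
  | succ k ih =>
    rw [Nat.cast_add, Nat.cast_one, contDiff_succ_iff_deriv]
    refine ⟨fun x => (expMoment_hasDerivAt m x).differentiableAt, by simp, ?_⟩
    have : deriv (expMoment m) = expMoment (m + 1) :=
      funext fun x => (expMoment_hasDerivAt m x).deriv
    rw [this]
    exact ih _

theorem expMoment_pos (m : ℕ) (x : ℝ) : 0 < expMoment m x := by
  apply intervalIntegral.intervalIntegral_pos_of_pos_on
  · apply Continuous.intervalIntegrable; fun_prop
  · intro u hu
    have := hu.1
    positivity
  · exact one_pos

/-- Integration by parts: both sides come from integrating the `u`-derivative of `u^{m+1} e^{xu}`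
over `[0, 1]`. -/
theorem mul_expMoment_succ (m : ℕ) (x : ℝ) :
    x * expMoment (m + 1) x = Real.exp x - (m + 1) * expMoment m x := by
  have key : ∫ u in (0 : ℝ)..1, ((m + 1) * (u ^ m * Real.exp (x * u))
      + x * (u ^ (m + 1) * Real.exp (x * u))) = Real.exp x := by
    rw [intervalIntegral.integral_eq_sub_of_hasDerivAt
      (f := fun u => u ^ (m + 1) * Real.exp (x * u))]
    · simp
    · intro u _
      have := (hasDerivAt_pow (m + 1) u).mul (((hasDerivAt_id u).const_mul x).exp)
      refine this.congr_deriv ?_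
      simp only [id, mul_one, add_tsub_cancel_right, Nat.cast_add, Nat.cast_one]
      ring
    · apply Continuous.intervalIntegrable; fun_prop
  rw [intervalIntegral.integral_add, intervalIntegral.integral_const_mul,
    intervalIntegral.integral_const_mul] at key
  · simp only [expMoment]; linarith
  · apply Continuous.intervalIntegrable; fun_prop
  · apply Continuous.intervalIntegrable; fun_prop

theorem expMoment_zero_right (m : ℕ) : expMoment m 0 = 1 / (m + 1) := by
  have := mul_expMoment_succ m 0
  have h : (m : ℝ) + 1 ≠ 0 := by positivity
  simp at this
  field_simp
  linarith

theorem expMoment_mono (m : ℕ) : Monotone (expMoment m) :=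
  monotone_of_deriv_nonneg (fun x => (expMoment_hasDerivAt m x).differentiableAt)
    fun x => by rw [(expMoment_hasDerivAt m x).deriv]; exact (expMoment_pos _ _).le

/-- The incomplete Gamma-type integral `∫₀ˣ yᵐ e^y dy`, written as `x^{m+1} ∫₀¹ uᵐ e^{xu} du`. -/
def powExpIntegral (m : ℕ) (x : ℝ) : ℝ := x ^ (m + 1) * expMoment m x

theorem powExpIntegral_hasDerivAt (m : ℕ) (x : ℝ) :
    HasDerivAt (powExpIntegral m) (x ^ m * Real.exp x) x := by
  have := (hasDerivAt_pow (m + 1) x).mul (expMoment_hasDerivAt m x)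
  refine this.congr_deriv ?_
  simp only [add_tsub_cancel_right, Nat.cast_add, Nat.cast_one]
  have h := mul_expMoment_succ m x
  linear_combination (x ^ m) * h

@[simp] theorem powExpIntegral_zero_right (m : ℕ) : powExpIntegral m 0 = 0 := by
  simp [powExpIntegral]

theorem powExpIntegral_succ (m : ℕ) (x : ℝ) :
    powExpIntegral (m + 1) x = x ^ (m + 1) * Real.exp x - (m + 1) * powExpIntegral m x := by
  simp only [powExpIntegral]
  linear_combination (x ^ (m + 1)) * mul_expMoment_succ m x

theorem powExpIntegral_zero (x : ℝ) : powExpIntegral 0 x = Real.exp x - 1 := by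
  have h : ∀ y, HasDerivAt (fun y => powExpIntegral 0 y - Real.exp y) 0 y := fun y => by
    exact ((powExpIntegral_hasDerivAt 0 y).sub (Real.hasDerivAt_exp y)).congr_deriv (by simp)
  have := is_const_of_deriv_eq_zero (fun y => (h y).differentiableAt) (fun y => (h y).deriv) x 0
  simp at this
  linarith

/-- The closed form of `(m+1) ∫₀ˣ yᵐ e^y dy`. -/
theorem sum_eq_powExpIntegral (m : ℕ) (x : ℝ) :
    ∑ k ∈ Finset.range (m + 1), (-1 : ℝ) ^ (m + 1 - 1 - k)
        * (((m + 1).factorial : ℝ) / (k.factorial : ℝ)) * x ^ k * Real.exp x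
      = (m + 1) * powExpIntegral m x + (-1 : ℝ) ^ m * ((m + 1).factorial : ℝ) := by
  induction m with
  | zero => simp [powExpIntegral_zero]
  | succ m ih =>
    rw [Finset.sum_range_succ, powExpIntegral_succ]
    have h1 : ∑ k ∈ Finset.range (m + 1), (-1 : ℝ) ^ (m + 1 + 1 - 1 - k)
        * (((m + 1 + 1).factorial : ℝ) / (k.factorial : ℝ)) * x ^ k * Real.exp x
        = -(m + 2) * ∑ k ∈ Finset.range (m + 1), (-1 : ℝ) ^ (m + 1 - 1 - k)
        * (((m + 1).factorial : ℝ) / (k.factorial : ℝ)) * x ^ k * Real.exp x := by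
      rw [Finset.mul_sum]
      refine Finset.sum_congr rfl fun k hk => ?_
      have hk' : k ≤ m := Nat.lt_succ_iff.1 (Finset.mem_range.1 hk)
      have e1 : m + 1 + 1 - 1 - k = (m - k) + 1 := by omega
      have e2 : m + 1 - 1 - k = m - k := by omega
      rw [e1, e2, Nat.factorial_succ (m + 1), pow_succ]
      push_cast
      ring
    rw [h1, ih]
    have e3 : m + 1 + 1 - 1 - (m + 1) = 0 := by omega
    have h2 : ((m + 1 + 1).factorial : ℝ) / ((m + 1).factorial : ℝ) = m + 2 := by
      rw [Nat.factorial_succ (m + 1)]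
      have : ((m + 1).factorial : ℝ) ≠ 0 := by positivity
      push_cast
      field_simp
      ring
    rw [e3, h2, Nat.factorial_succ (m + 1), pow_succ (-1 : ℝ) m]
    push_cast
    ring

/-- Comparison for the linear equation `R' = 1 - (1 + m/x) R`: lower barrier. -/
theorem lt_powExpIntegral_of_subsolution {m : ℕ} {S S' : ℝ → ℝ} (hm : 1 ≤ m)
    (hc : ContinuousOn S (Set.Ici 0)) (hd : ∀ x, 0 < x → HasDerivAt S (S' x) x)
    (h : ∀ x, 0 < x → x * S' x + (x + m) * S x < x) {x : ℝ} (hx : 0 < x) :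
    x ^ m * Real.exp x * S x < powExpIntegral m x := by
  -- After multiplication by the integrating factor `y^m e^y`, the difference has derivative
  -- `y^{m-1} e^y (y - y S' - (y + m) S)` and vanishes at `0`.
  have mono : StrictMonoOn (fun y => powExpIntegral m y - y ^ m * Real.exp y * S y)
      (Set.Ici 0) := by
    apply strictMonoOn_of_deriv_pos (convex_Ici 0)
    · refine ContinuousOn.sub
        (fun y _ => (powExpIntegral_hasDerivAt m y).continuousAt.continuousWithinAt) ?_
      exact ContinuousOn.mul (by fun_prop) hc
    · intro y hy
      rw [interior_Ici] at hy
      have hy : 0 < y := hy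
      have := (powExpIntegral_hasDerivAt m y).sub
        (((hasDerivAt_pow m y).mul (Real.hasDerivAt_exp y)).mul (hd y hy))
      have e := this.deriv
      simp only [Pi.mul_def, Pi.sub_def] at e
      rw [e]
      obtain ⟨k, rfl⟩ : ∃ k, m = k + 1 := ⟨m - 1, by omega⟩
      have h1 := h y hy
      have : 0 < y ^ k * Real.exp y := by positivity
      simp only [add_tsub_cancel_right]
      have h2 := mul_pos this (sub_pos.2 h1)
      refine h2.trans_eq ?_
      ring
  have := mono (Set.mem_Ici.2 le_rfl) (Set.mem_Ici.2 hx.le) hx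
  have h0 : (0 : ℝ) ^ m = 0 := zero_pow (by omega)
  simp [h0] at this
  exact this

/-- Comparison for the linear equation `R' = 1 - (1 + m/x) R`: upper barrier. -/
theorem powExpIntegral_lt_of_supersolution {m : ℕ} {S S' : ℝ → ℝ} (hm : 1 ≤ m)
    (hc : ContinuousOn S (Set.Ici 0)) (hd : ∀ x, 0 < x → HasDerivAt S (S' x) x)
    (h : ∀ x, 0 < x → x < x * S' x + (x + m) * S x) {x : ℝ} (hx : 0 < x) :
    powExpIntegral m x < x ^ m * Real.exp x * S x := by
  have mono : StrictMonoOn (fun y => y ^ m * Real.exp y * S y - powExpIntegral m y)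
      (Set.Ici 0) := by
    apply strictMonoOn_of_deriv_pos (convex_Ici 0)
    · refine ContinuousOn.sub ?_
        (fun y _ => (powExpIntegral_hasDerivAt m y).continuousAt.continuousWithinAt)
      exact ContinuousOn.mul (by fun_prop) hc
    · intro y hy
      rw [interior_Ici] at hy
      have hy : 0 < y := hy
      have := (((hasDerivAt_pow m y).mul (Real.hasDerivAt_exp y)).mul (hd y hy)).sub
        (powExpIntegral_hasDerivAt m y)
      have e := this.deriv
      simp only [Pi.mul_def, Pi.sub_def] at e
      rw [e]
      obtain ⟨k, rfl⟩ : ∃ k, m = k + 1 := ⟨m - 1, by omega⟩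
      have h1 := h y hy
      have : 0 < y ^ k * Real.exp y := by positivity
      simp only [add_tsub_cancel_right]
      have h2 := mul_pos this (sub_pos.2 h1)
      refine h2.trans_eq ?_
      ring
  have := mono (Set.mem_Ici.2 le_rfl) (Set.mem_Ici.2 hx.le) hx
  have h0 : (0 : ℝ) ^ m = 0 := zero_pow (by omega)
  simp [h0] at this
  exact this

/-- `R(x) < x / (x + m)` for `R(x) = x E_m(x) / e^x`. -/
theorem powExpIntegral_upper {m : ℕ} (hm : 1 ≤ m) {x : ℝ} (hx : 0 < x) :
    (x + m) * powExpIntegral m x < x ^ (m + 1) * Real.exp x := by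
  have hm' : (0 : ℝ) < m := by exact_mod_cast hm
  have := powExpIntegral_lt_of_supersolution (m := m) (S := fun y => y / (y + m))
    (S' := fun y => (1 * (y + m) - y * 1) / (y + m) ^ 2) hm
    (by
      apply ContinuousOn.div (by fun_prop) (by fun_prop)
      intro y hy
      have : 0 ≤ y := hy
      positivity)
    (fun y hy => (hasDerivAt_id y).div ((hasDerivAt_id y).add_const (m : ℝ)) (by simp; positivity))
    (fun y hy => by
      have : y + m ≠ 0 := by positivity
      have h : 0 < y * ((1 * (y + m) - y * 1) / (y + m) ^ 2) := by
        have : 1 * (y + m) - y * 1 = (m : ℝ) := by ring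
        rw [this]; positivity
      have h2 : (y + m) * (y / (y + m)) = y := by field_simp
      linarith) hx
  have hp : 0 < x + m := by positivity
  calc _ < (x + m) * (x ^ m * Real.exp x * (x / (x + m))) := mul_lt_mul_of_pos_left this hp
    _ = _ := by field_simp; ring

/-- The barrier inequality behind the convexity of `x ↦ √(x² - x F(x))`. -/
theorem barrier_inequality {m x W : ℝ} (hm : 2 ≤ m) (hx : 0 < x) (hW : 0 < W)
    (hW2 : W ^ 2 = (x + m - 2) ^ 2 + 2 * m) :
    W ^ 2 * (x + m - 3) - x * (x + m - 2) < W * ((x + m) ^ 2 - 6 * (x + m) + 6 + 2 * m) := by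
  have hK : 0 < (x + m) ^ 2 - 6 * (x + m) + 6 + 2 * m := by nlinarith [sq_nonneg (x + m - 3)]
  -- Only the right side is known to be positive, which suffices for comparing squares. Squaring
  -- also turns `W` into the polynomial `W²`.
  apply lt_of_pow_lt_pow_left₀ 2 (by positivity)
  rw [mul_pow, hW2, ← sub_pos]
  -- In the variable `k = m - 2 ≥ 0` the difference of the squares has only nonnegative
  -- coefficients.
  obtain ⟨k, rfl⟩ : ∃ k, m = k + 2 := ⟨m - 2, by ring⟩
  have hk : 0 ≤ k := by linarith
  have : 0 < 3 * x ^ 2 * k ^ 2 + 4 * x ^ 2 + 8 * x ^ 2 * k + 6 * x * k ^ 3 + 12 * x * k ^ 2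
      + 3 * k ^ 4 + 24 * k ^ 2 + 12 * k ^ 3 + 24 * k := by positivity
  refine this.trans_eq ?_
  ring

/-- `x / (2 + √((x + m - 2)² + 2m)) < R(x)` for `m ≥ 2`. -/
theorem powExpIntegral_lower {m : ℕ} (hm : 2 ≤ m) {x : ℝ} (hx : 0 < x) :
    x ^ (m + 1) * Real.exp x
      < (2 + Real.sqrt ((x + m - 2) ^ 2 + 2 * m)) * powExpIntegral m x := by
  have hm' : (2 : ℝ) ≤ m := by exact_mod_cast hm
  have hp : ∀ y : ℝ, 0 < (y + m - 2) ^ 2 + 2 * m := fun y => by positivity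
  have hWp : ∀ y : ℝ, 0 < Real.sqrt ((y + m - 2) ^ 2 + 2 * m) := fun y => Real.sqrt_pos.2 (hp y)
  have hWd : ∀ y : ℝ, HasDerivAt (fun y : ℝ => 2 + Real.sqrt ((y + m - 2) ^ 2 + 2 * m))
      ((y + m - 2) / Real.sqrt ((y + m - 2) ^ 2 + 2 * m)) y := fun y => by
    have h1 : HasDerivAt (fun y : ℝ => (y + m - 2) ^ 2 + 2 * m) (2 * (y + m - 2)) y := by
      have := ((((hasDerivAt_id y).add_const (m : ℝ)).sub_const 2).pow 2).add_const (2 * (m : ℝ))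
      simpa using this
    refine ((h1.sqrt (hp y).ne').const_add 2).congr_deriv ?_
    have := (hWp y).ne'
    field_simp
  have := lt_powExpIntegral_of_subsolution (m := m)
    (S := fun y => y / (2 + Real.sqrt ((y + m - 2) ^ 2 + 2 * m)))
    (S' := fun y => (1 * (2 + Real.sqrt ((y + m - 2) ^ 2 + 2 * m)) - y * ((y + m - 2)
      / Real.sqrt ((y + m - 2) ^ 2 + 2 * m))) / (2 + Real.sqrt ((y + m - 2) ^ 2 + 2 * m)) ^ 2)
    (by omega)
    (by
      apply ContinuousOn.div (by fun_prop) (by fun_prop)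
      intro y _
      have := hWp y
      positivity)
    (fun y hy => (hasDerivAt_id y).div (hWd y) (by have := hWp y; positivity))
    (fun y hy => by
      have hW2 := Real.sq_sqrt (hp y).le
      have hW := hWp y
      set W := Real.sqrt ((y + m - 2) ^ 2 + 2 * m)
      have key := barrier_inequality hm' hy hW hW2
      -- This quotient is exactly the deficit `y - (y S' + (y + m) S)` of the barrier.
      have : 0 < y * (W * ((y + m) ^ 2 - 6 * (y + m) + 6 + 2 * m)
        - (W ^ 2 * (y + m - 3) - y * (y + m - 2))) / (W * (2 + W) ^ 2) := by
        have := sub_pos.2 key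
        positivity
      rw [← sub_pos]
      refine this.trans_eq ?_
      field_simp
      have hW3 : W ^ 3 = W * ((y + m - 2) ^ 2 + 2 * m) := by rw [← hW2]; ring
      ring_nf
      ring_nf at hW2 hW3
      rw [hW3, hW2]
      ring) hx
  have hT : 0 < 2 + Real.sqrt ((x + m - 2) ^ 2 + 2 * m) := by have := hWp x; positivity
  calc _ = (2 + Real.sqrt ((x + m - 2) ^ 2 + 2 * m)) * (x ^ m * Real.exp x *
        (x / (2 + Real.sqrt ((x + m - 2) ^ 2 + 2 * m)))) := by field_simp; ring
    _ < _ := mul_lt_mul_of_pos_left this hT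

end

noncomputable section

/-! ### The profile -/

/-- `H(x) = n ∫₀¹ uⁿ⁻¹ e^{xu} du`, so that `n ∫₀ˣ yⁿ⁻¹ e^y dy = xⁿ H(x)`. -/
def weight (n : ℕ) (x : ℝ) : ℝ := n * expMoment (n - 1) x

/-- The `n`-th root of `H`. -/
def weightRoot (n : ℕ) (x : ℝ) : ℝ := Real.exp (Real.log (weight n x) / n)

/-- The function `x H(x)^{1/n}`, which takes the profile `φ(t)` to `e^t`. -/
def radius (n : ℕ) (x : ℝ) : ℝ := x * weightRoot n x

/-- The inverse function of `radius`. -/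
def radiusInv (n : ℕ) : ℝ → ℝ := Function.invFun (radius n)

/-- The profile `φ`. -/
def profile (n : ℕ) (t : ℝ) : ℝ := radiusInv n (Real.exp t)

variable {n : ℕ}

theorem weight_pos (hn : 1 ≤ n) (x : ℝ) : 0 < weight n x :=
  mul_pos (by exact_mod_cast hn) (expMoment_pos _ _)

theorem weight_contDiff (n : ℕ) : ContDiff ℝ ∞ (weight n) :=
  contDiff_const.mul (expMoment_contDiff _)

theorem weight_hasDerivAt (n : ℕ) (x : ℝ) :
    HasDerivAt (weight n) (n * expMoment (n - 1 + 1) x) x :=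
  (expMoment_hasDerivAt _ x).const_mul _

theorem weight_zero (hn : 1 ≤ n) : weight n 0 = 1 := by
  have h : (n : ℝ) ≠ 0 := by exact_mod_cast (by omega : n ≠ 0)
  rw [weight, expMoment_zero_right, Nat.cast_sub hn]
  simp [h]

theorem mul_deriv_weight (hn : 1 ≤ n) (x : ℝ) :
    x * (n * expMoment (n - 1 + 1) x) = n * (Real.exp x - weight n x) := by
  have := mul_expMoment_succ (n - 1) x
  rw [Nat.cast_sub hn] at this
  rw [weight]
  push_cast at this
  linear_combination (n : ℝ) * this

theorem weightRoot_pos (n : ℕ) (x : ℝ) : 0 < weightRoot n x := Real.exp_pos _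

theorem weightRoot_pow (hn : 1 ≤ n) (x : ℝ) : weightRoot n x ^ n = weight n x := by
  have h : (n : ℝ) ≠ 0 := by exact_mod_cast (by omega : n ≠ 0)
  rw [weightRoot, ← Real.exp_nat_mul, mul_div_cancel₀ _ h, Real.exp_log (weight_pos hn x)]

theorem weightRoot_contDiff (hn : 1 ≤ n) : ContDiff ℝ ∞ (weightRoot n) :=
  (((weight_contDiff n).log fun x => (weight_pos hn x).ne').div_const _).exp

theorem weightRoot_hasDerivAt (hn : 1 ≤ n) (x : ℝ) :
    HasDerivAt (weightRoot n)
      (weightRoot n x * (n * expMoment (n - 1 + 1) x / weight n x / n)) x :=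
  (((weight_hasDerivAt n x).log (weight_pos hn x).ne').div_const (n : ℝ)).exp

theorem radius_pow (hn : 1 ≤ n) (x : ℝ) : radius n x ^ n = n * powExpIntegral (n - 1) x := by
  rw [radius, mul_pow, weightRoot_pow hn, powExpIntegral, weight, Nat.sub_add_cancel hn]
  ring

theorem radius_contDiff (hn : 1 ≤ n) : ContDiff ℝ ∞ (radius n) :=
  contDiff_id.mul (weightRoot_contDiff hn)

theorem radius_hasDerivAt (hn : 1 ≤ n) (x : ℝ) :
    HasDerivAt (radius n) (weightRoot n x * (Real.exp x / weight n x)) x := by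
  have h : (n : ℝ) ≠ 0 := by exact_mod_cast (by omega : n ≠ 0)
  have hw := (weight_pos hn x).ne'
  refine ((hasDerivAt_id x).mul (weightRoot_hasDerivAt hn x)).congr_deriv ?_
  have : x * expMoment (n - 1 + 1) x = Real.exp x - weight n x :=
    mul_left_cancel₀ h (by linear_combination mul_deriv_weight hn x)
  simp only [id]
  field_simp
  linear_combination weightRoot n x * this

theorem radius_strictMono (hn : 1 ≤ n) : StrictMono (radius n) :=
  strictMono_of_deriv_pos fun x => by
    rw [(radius_hasDerivAt hn x).deriv]
    have := weight_pos hn x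
    have := weightRoot_pos n x
    positivity

@[simp] theorem radius_zero (n : ℕ) : radius n 0 = 0 := by simp [radius]

/-- The weight increases from its value `1` at `0`. The bound supplies the upper endpoint for the
intermediate value theorem below. -/
theorem le_radius (hn : 1 ≤ n) {x : ℝ} (hx : 0 ≤ x) : x ≤ radius n x := by
  have h1 : 1 ≤ weight n x := by
    rw [← weight_zero hn]
    exact mul_le_mul_of_nonneg_left (expMoment_mono _ hx) (Nat.cast_nonneg _)
  have h2 : 1 ≤ weightRoot n x := Real.one_le_exp (div_nonneg (Real.log_nonneg h1) (by positivity))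
  exact le_mul_of_one_le_right hx h2

theorem exists_radius_eq (hn : 1 ≤ n) {s : ℝ} (hs : 0 ≤ s) : ∃ x, 0 ≤ x ∧ radius n x = s := by
  have := intermediate_value_Icc hs (radius_contDiff hn).continuous.continuousOn
  obtain ⟨x, hx, h⟩ := this ⟨by simpa using hs, le_radius hn hs⟩
  exact ⟨x, hx.1, h⟩

theorem radiusInv_radius (hn : 1 ≤ n) (x : ℝ) : radiusInv n (radius n x) = x :=
  Function.leftInverse_invFun (radius_strictMono hn).injective x

theorem radius_radiusInv (hn : 1 ≤ n) {s : ℝ} (hs : 0 ≤ s) : radius n (radiusInv n s) = s := by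
  obtain ⟨x, _, rfl⟩ := exists_radius_eq hn hs
  rw [radiusInv_radius hn]

theorem radiusInv_nonneg (hn : 1 ≤ n) {s : ℝ} (hs : 0 ≤ s) : 0 ≤ radiusInv n s := by
  obtain ⟨x, hx, rfl⟩ := exists_radius_eq hn hs
  rwa [radiusInv_radius hn]

theorem radiusInv_pos (hn : 1 ≤ n) {s : ℝ} (hs : 0 < s) : 0 < radiusInv n s := by
  refine (radiusInv_nonneg hn hs.le).lt_of_ne fun h => ?_
  have := radius_radiusInv hn hs.le
  rw [← h, radius_zero] at this
  exact hs.ne this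

@[simp] theorem radiusInv_zero (hn : 1 ≤ n) : radiusInv n 0 = 0 := by
  simpa using radiusInv_radius hn 0

/-- The inverse function theorem applies at `s = 0` as well, because `radius` is defined on both
sides of `0` with positive derivative. This is the source of smoothness of the metric at the origin.
-/
theorem radiusInv_contDiffAt (hn : 1 ≤ n) {s : ℝ} (hs : 0 ≤ s) :
    ContDiffAt ℝ ∞ (radiusInv n) s := by
  obtain ⟨x, _, rfl⟩ := exists_radius_eq hn hs
  have hd := radius_hasDerivAt hn x
  have hne : weightRoot n x * (Real.exp x / weight n x) ≠ 0 := by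
    have := weight_pos hn x
    have := weightRoot_pos n x
    positivity
  have hf : HasFDerivAt (radius n)
      ((ContinuousLinearEquiv.unitsEquivAut ℝ (Units.mk0 _ hne) : ℝ ≃L[ℝ] ℝ) : ℝ →L[ℝ] ℝ) x := by
    refine hd.hasFDerivAt.congr_fderiv ?_
    ext
    simp
  have hcd := (radius_contDiff hn).contDiffAt (x := x)
  have := hcd.to_localInverse hf (by simp)
  refine this.congr_of_eventuallyEq ?_
  -- The local inverse is a right inverse near the point and `radiusInv` is a global left inverse,
  -- so the two agree there.
  have h := (hcd.hasStrictFDerivAt' hf (by simp)).eventually_right_inverse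
  filter_upwards [h] with y hy
  have h2 := radiusInv_radius hn ((hcd.localInverse hf (by simp)) y)
  rw [← h2]
  congr 1
  exact hy.symm

theorem radiusInv_hasDerivAt (hn : 1 ≤ n) {s : ℝ} (hs : 0 ≤ s) :
    HasDerivAt (radiusInv n) (weight n (radiusInv n s)
      / (weightRoot n (radiusInv n s) * Real.exp (radiusInv n s))) s := by
  have hd := ((radiusInv_contDiffAt hn hs).differentiableAt (by simp)).hasDerivAt
  refine hd.congr_deriv ?_
  have h1 := radius_hasDerivAt hn (radiusInv n s)
  rw [← radius_radiusInv hn hs] at hd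
  have h2 := hd.comp _ h1
  have h3 : radiusInv n ∘ radius n = id := funext fun x => radiusInv_radius hn x
  rw [h3] at h2
  have h4 := h2.unique (hasDerivAt_id _)
  rw [radius_radiusInv hn hs] at h4
  have := weight_pos hn (radiusInv n s)
  have := weightRoot_pos n (radiusInv n s)
  rw [eq_div_iff (by positivity)]
  field_simp at h4
  linear_combination h4

/-- The function `h(s) = ψ(s)/s`, the derivative of the Kähler potential in `s = |z|²`. -/
def potentialDeriv (n : ℕ) (s : ℝ) : ℝ := (weightRoot n (radiusInv n s))⁻¹

/-- The Kähler potential as a function of `s = |z|²`. -/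
def potential (n : ℕ) (s : ℝ) : ℝ :=
  ∫ y in (0 : ℝ)..radiusInv n s, Real.exp y / weight n y

theorem potentialDeriv_pos (n : ℕ) (s : ℝ) : 0 < potentialDeriv n s :=
  inv_pos.2 (weightRoot_pos _ _)

theorem mul_potentialDeriv (hn : 1 ≤ n) {s : ℝ} (hs : 0 ≤ s) :
    s * potentialDeriv n s = radiusInv n s := by
  have h := weightRoot_pos n (radiusInv n s)
  rw [potentialDeriv]
  nth_rewrite 1 [← radius_radiusInv hn hs]
  rw [radius, mul_assoc, mul_inv_cancel₀ h.ne', mul_one]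

theorem potentialDeriv_contDiffAt (hn : 1 ≤ n) {s : ℝ} (hs : 0 ≤ s) :
    ContDiffAt ℝ ∞ (potentialDeriv n) s :=
  (((weightRoot_contDiff hn).contDiffAt).comp s (radiusInv_contDiffAt hn hs)).inv
    (weightRoot_pos _ _).ne'

theorem potential_contDiffAt (hn : 1 ≤ n) {s : ℝ} (hs : 0 ≤ s) :
    ContDiffAt ℝ ∞ (potential n) s := by
  have hc : ContDiff ℝ ∞ fun y => Real.exp y / weight n y :=
    Real.contDiff_exp.div (weight_contDiff n) fun y => (weight_pos hn y).ne'
  have hd : ∀ x, HasDerivAt (fun x => ∫ y in (0 : ℝ)..x, Real.exp y / weight n y)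
      (Real.exp x / weight n x) x := fun x =>
    hc.continuous.integral_hasStrictDerivAt 0 x |>.hasDerivAt
  have : ContDiff ℝ ∞ (fun x => ∫ y in (0 : ℝ)..x, Real.exp y / weight n y) := by
    rw [contDiff_infty_iff_deriv]
    refine ⟨fun x => (hd x).differentiableAt, ?_⟩
    rwa [show deriv (fun x => ∫ y in (0 : ℝ)..x, Real.exp y / weight n y)
      = fun y => Real.exp y / weight n y from funext fun x => (hd x).deriv]
  exact this.contDiffAt.comp s (radiusInv_contDiffAt hn hs)

theorem potential_hasDerivAt (hn : 1 ≤ n) {s : ℝ} (hs : 0 ≤ s) :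
    HasDerivAt (potential n) (potentialDeriv n s) s := by
  have hc : Continuous fun y => Real.exp y / weight n y :=
    Real.continuous_exp.div (weight_contDiff n).continuous fun y => (weight_pos hn y).ne'
  -- In the variable `x = radiusInv n s` one has `h ds = (1 / H^{1/n}) (H^{1/n} e^x / H) dx`, hence
  -- the integrand `e^x / H`.
  have h1 := (hc.integral_hasStrictDerivAt 0 (radiusInv n s)).hasDerivAt
  refine (h1.comp s (radiusInv_hasDerivAt hn hs)).congr_deriv ?_
  have := weight_pos hn (radiusInv n s)
  have := weightRoot_pos n (radiusInv n s)
  rw [potentialDeriv]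
  field_simp

/-- `h = H^{-1/n}` with `H` and `radiusInv` both of positive derivative. Including `s = 0` gives the
orthogonal curvature coefficient `-h'` at the origin, where the variable `t` is not available. -/
theorem deriv_potentialDeriv_neg (hn : 1 ≤ n) {s : ℝ} (hs : 0 ≤ s) :
    deriv (potentialDeriv n) s < 0 := by
  have h1 := (weightRoot_hasDerivAt hn (radiusInv n s)).comp s (radiusInv_hasDerivAt hn hs)
  have h2 : HasDerivAt (potentialDeriv n) _ s := h1.inv (weightRoot_pos _ _).ne'
  rw [h2.deriv, neg_div, neg_lt_zero]
  have := weight_pos hn (radiusInv n s)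
  have := weightRoot_pos n (radiusInv n s)
  have := expMoment_pos (n - 1 + 1) (radiusInv n s)
  have : (0 : ℝ) < n := by exact_mod_cast hn
  simp only [Function.comp]
  positivity

theorem radius_profile (hn : 1 ≤ n) (t : ℝ) : radius n (profile n t) = Real.exp t :=
  radius_radiusInv hn (Real.exp_pos t).le

theorem profile_pos (hn : 1 ≤ n) (t : ℝ) : 0 < profile n t := radiusInv_pos hn (Real.exp_pos t)

theorem profile_contDiff (hn : 1 ≤ n) : ContDiff ℝ ∞ (profile n) :=
  contDiff_iff_contDiffAt.2 fun t =>
    (radiusInv_contDiffAt hn (Real.exp_pos t).le).comp t Real.contDiff_exp.contDiffAt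

theorem profile_hasDerivAt (hn : 1 ≤ n) (t : ℝ) :
    HasDerivAt (profile n) (profile n t * weight n (profile n t) / Real.exp (profile n t)) t := by
  have := (radiusInv_hasDerivAt hn (Real.exp_pos t).le).comp t (Real.hasDerivAt_exp t)
  refine this.congr_deriv ?_
  have h := radius_profile hn t
  have h0 := weightRoot_pos n (profile n t)
  change weight n (profile n t) / (weightRoot n (profile n t) * Real.exp (profile n t))
    * Real.exp t = _
  rw [← h, radius]
  field_simp

theorem powExpIntegral_profile (hn : 1 ≤ n) (t : ℝ) :
    n * powExpIntegral (n - 1) (profile n t) = Real.exp (n * t) := by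
  rw [← radius_pow hn, radius_profile hn, ← Real.exp_nat_mul]

theorem isProfile_profile (hn : 1 ≤ n) : IsProfile n (profile n) where
  smooth := profile_contDiff hn
  pos := profile_pos hn
  deriv_pos t := by
    rw [(profile_hasDerivAt hn t).deriv]
    have := profile_pos hn t
    have := weight_pos hn (profile n t)
    positivity
  tendsto_zero := by
    have h := (radiusInv_contDiffAt hn le_rfl).continuousAt.tendsto.comp
      Real.tendsto_exp_atBot
    rwa [radiusInv_zero hn] at h
  ode t := by
    rw [(profile_hasDerivAt hn t).deriv, ← powExpIntegral_profile hn, powExpIntegral, weight]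
    obtain ⟨k, rfl⟩ : ∃ k, n = k + 1 := ⟨n - 1, by omega⟩
    simp only [add_tsub_cancel_right]
    field_simp
    ring

end

noncomputable section

/-! ### Curvature inequalities for the profile -/

variable {n : ℕ}

/-- By parts, `n ∫₀ˣ yⁿ⁻¹ e^y dy = xⁿ e^x - ∫₀ˣ yⁿ e^y dy`; the left side at `x = φ` is `e^{nt} =
φⁿ⁻¹ φ' e^φ`. -/
theorem profile_sub_deriv_eq (hn : 1 ≤ n) (t : ℝ) :
    profile n t ^ (n - 1) * Real.exp (profile n t) * (profile n t - deriv (profile n) t)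
      = powExpIntegral n (profile n t) := by
  have h1 := (isProfile_profile hn).ode t
  have h2 := powExpIntegral_profile hn t
  obtain ⟨k, rfl⟩ : ∃ k, n = k + 1 := ⟨n - 1, by omega⟩
  rw [powExpIntegral_succ]
  simp only [add_tsub_cancel_right] at h1 h2 ⊢
  push_cast at h1 h2
  linear_combination h2 - h1

/-- This is the logarithmic derivative of the profile equation, `φ''/φ' + (n-1) φ'/φ + φ' = n`. -/
theorem deriv_profile_hasDerivAt (hn : 1 ≤ n) (t : ℝ) :
    HasDerivAt (deriv (profile n)) (deriv (profile n) t * (n - deriv (profile n) t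
      - (n - 1) * deriv (profile n) t / profile n t)) t := by
  have e : deriv (profile n)
      = fun t => profile n t * weight n (profile n t) / Real.exp (profile n t) :=
    funext fun t => (profile_hasDerivAt hn t).deriv
  have h1 := profile_hasDerivAt hn t
  have hx := profile_pos hn t
  have h2 : HasDerivAt (fun x => x * weight n x / Real.exp x)
      (n - (n - 1) * weight n (profile n t) / Real.exp (profile n t)
        - profile n t * weight n (profile n t) / Real.exp (profile n t)) (profile n t) := by
    refine (((hasDerivAt_id _).mul (weight_hasDerivAt n (profile n t))).div
      (Real.hasDerivAt_exp _) (Real.exp_pos _).ne').congr_deriv ?_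
    have := mul_deriv_weight hn (profile n t)
    simp only [Pi.mul_apply]
    field_simp
    linear_combination this
  rw [h1.deriv]
  nth_rewrite 1 [e]
  refine (h2.comp t h1).congr_deriv ?_
  field_simp
  ring

theorem iteratedDeriv_two_profile (hn : 1 ≤ n) (t : ℝ) :
    iteratedDeriv 2 (profile n) t = deriv (profile n) t * (n - deriv (profile n) t
      - (n - 1) * deriv (profile n) t / profile n t) := by
  rw [iteratedDeriv_succ, iteratedDeriv_one, (deriv_profile_hasDerivAt hn t).deriv]

theorem iteratedDeriv_three_profile (hn : 1 ≤ n) (t : ℝ) :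
    iteratedDeriv 3 (profile n) t = iteratedDeriv 2 (profile n) t * (n - deriv (profile n) t
      - (n - 1) * deriv (profile n) t / profile n t)
      + deriv (profile n) t * (-iteratedDeriv 2 (profile n) t
        - (n - 1) * (iteratedDeriv 2 (profile n) t * profile n t - deriv (profile n) t ^ 2)
          / profile n t ^ 2) := by
  have hx := profile_pos hn t
  have e : iteratedDeriv 2 (profile n) = fun t => deriv (profile n) t * (n - deriv (profile n) t
      - (n - 1) * deriv (profile n) t / profile n t) :=
    funext (iteratedDeriv_two_profile hn)
  have h1 : HasDerivAt (profile n) (deriv (profile n) t) t :=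
    (profile_hasDerivAt hn t).differentiableAt.hasDerivAt
  have h2 := deriv_profile_hasDerivAt hn t
  rw [← iteratedDeriv_two_profile hn t] at h2
  have h3 := h2.mul ((h2.const_sub (n : ℝ)).sub ((h2.const_mul ((n : ℝ) - 1)).div h1 hx.ne'))
  have h4 := h3.congr_deriv (g' := iteratedDeriv 2 (profile n) t * (n - deriv (profile n) t
      - (n - 1) * deriv (profile n) t / profile n t)
      + deriv (profile n) t * (-iteratedDeriv 2 (profile n) t
        - (n - 1) * (iteratedDeriv 2 (profile n) t * profile n t - deriv (profile n) t ^ 2)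
          / profile n t ^ 2)) (by
    simp only [Pi.sub_apply, Pi.div_apply]
    ring)
  rw [iteratedDeriv_succ, ← h4.deriv]
  congr 1

theorem profile_sub_deriv_bounds (hn : 1 ≤ n) (t : ℝ) :
    0 < profile n t - deriv (profile n) t ∧
      (profile n t + n) * (profile n t - deriv (profile n) t) < profile n t ^ 2 := by
  have hx := profile_pos hn t
  have h := profile_sub_deriv_eq hn t
  have hp : 0 < profile n t ^ (n - 1) * Real.exp (profile n t) := by positivity
  have hJ : 0 < powExpIntegral n (profile n t) := mul_pos (pow_pos hx _) (expMoment_pos _ _)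
  constructor
  · rw [← h] at hJ
    exact pos_of_mul_pos_right hJ hp.le
  · refine lt_of_mul_lt_mul_left ?_ hp.le
    have := powExpIntegral_upper hn hx
    rw [← h] at this
    obtain ⟨k, rfl⟩ : ∃ k, n = k + 1 := ⟨n - 1, by omega⟩
    simp only [add_tsub_cancel_right] at this ⊢
    refine lt_of_eq_of_lt ?_ (this.trans_eq ?_) <;> ring

/-- The lower barrier translated to `P = φ - φ'`; it is the input for the discriminant inequality
`B² < 2AC`. -/
theorem sq_profile_lt (hn : 2 ≤ n) (t : ℝ) :
    profile n t ^ 2 < (2 + Real.sqrt ((profile n t + n - 2) ^ 2 + 2 * n))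
      * (profile n t - deriv (profile n) t) := by
  have hn1 : 1 ≤ n := by omega
  have hx := profile_pos hn1 t
  have h := profile_sub_deriv_eq hn1 t
  have hp : 0 < profile n t ^ (n - 1) * Real.exp (profile n t) := by positivity
  refine lt_of_mul_lt_mul_left ?_ hp.le
  have := powExpIntegral_lower hn hx
  rw [← h] at this
  obtain ⟨k, rfl⟩ : ∃ k, n = k + 1 := ⟨n - 1, by omega⟩
  simp only [add_tsub_cancel_right] at this ⊢
  refine lt_of_eq_of_lt ?_ (this.trans_eq ?_) <;> ring

/-- For `n = 1` the integrated equation is `e^φ - 1 = e^t`, whence `φ' = 1 - e^{-φ} < 1`. -/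
theorem profile_sub_deriv_one (t : ℝ) : profile 1 t - 1 < profile 1 t - deriv (profile 1) t := by
  have h1 := (isProfile_profile le_rfl).ode (n := 1) t
  have h2 := powExpIntegral_profile (n := 1) le_rfl t
  rw [tsub_self, powExpIntegral_zero] at h2
  rw [tsub_self, pow_zero, one_mul, ← h2] at h1
  have := Real.exp_pos (profile 1 t)
  simp only [Nat.cast_one, one_mul] at h1
  nlinarith

/-- With `x = φ`, `P = φ - φ'` the curvature quantities of the profile. -/
theorem profile_sq_sub_eq (hn : 1 ≤ n) (t : ℝ) :
    deriv (profile n) t ^ 2 - profile n t * iteratedDeriv 2 (profile n) t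
      = deriv (profile n) t * (profile n t ^ 2
        - (profile n t + n) * (profile n t - deriv (profile n) t)) := by
  have hx := profile_pos hn t
  rw [iteratedDeriv_two_profile hn]
  field_simp
  ring

theorem profile_sq_sub_eq' (hn : 1 ≤ n) (t : ℝ) :
    profile n t ^ 2 * (iteratedDeriv 2 (profile n) t ^ 2
      - deriv (profile n) t * iteratedDeriv 3 (profile n) t)
      = deriv (profile n) t ^ 3 * (profile n t * (profile n t - profile n t ^ 2
          + (profile n t + n - 1) * (profile n t - deriv (profile n) t))
        - (n - 1) * (profile n t ^ 2
          - (profile n t + n) * (profile n t - deriv (profile n) t))) := by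
  have hx := profile_pos hn t
  rw [iteratedDeriv_three_profile hn, iteratedDeriv_two_profile hn]
  field_simp
  ring

/-- The last inequality is `B² < 2AC` in terms of the profile. For `n ≥ 2` it also gives the third
one, since `AC > 0` and `C > 0`. -/
theorem profile_curvature_inequalities (hn : 1 ≤ n) (t : ℝ) :
    0 < profile n t - deriv (profile n) t ∧
    0 < deriv (profile n) t ^ 2 - profile n t * iteratedDeriv 2 (profile n) t ∧
    0 < iteratedDeriv 2 (profile n) t ^ 2
      - deriv (profile n) t * iteratedDeriv 3 (profile n) t ∧
    (2 ≤ n → deriv (profile n) t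
        * (deriv (profile n) t ^ 2 - profile n t * iteratedDeriv 2 (profile n) t) ^ 2
      < 2 * profile n t ^ 2 * (profile n t - deriv (profile n) t)
        * (iteratedDeriv 2 (profile n) t ^ 2
          - deriv (profile n) t * iteratedDeriv 3 (profile n) t)) := by
  have hx := profile_pos hn t
  have hp := (isProfile_profile hn).deriv_pos t
  obtain ⟨hP, hU⟩ := profile_sub_deriv_bounds hn t
  have e2 := profile_sq_sub_eq hn t
  have e3 := profile_sq_sub_eq' hn t
  have hB := sub_pos.2 hU
  have hn' : (1 : ℝ) ≤ n := by exact_mod_cast hn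
  have hD : 2 ≤ n → (profile n t ^ 2
        - (profile n t + n) * (profile n t - deriv (profile n) t)) ^ 2
      < 2 * (profile n t * (profile n t - profile n t ^ 2
          + (profile n t + n - 1) * (profile n t - deriv (profile n) t))
        - (n - 1) * (profile n t ^ 2
          - (profile n t + n) * (profile n t - deriv (profile n) t)))
        * (profile n t - deriv (profile n) t) := fun h2 => by
    have hl := sq_profile_lt h2 t
    have hW0 : 0 ≤ Real.sqrt ((profile n t + n - 2) ^ 2 + 2 * n) := Real.sqrt_nonneg _
    have hW2 := Real.sq_sqrt (show 0 ≤ (profile n t + n - 2) ^ 2 + 2 * (n : ℝ) by positivity)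
    have h2' : (2 : ℝ) ≤ n := by exact_mod_cast h2
    generalize Real.sqrt ((profile n t + n - 2) ^ 2 + 2 * n) = W at *
    generalize profile n t - deriv (profile n) t = P at *
    generalize profile n t = x at *
    -- The difference of the two sides is a quadratic in `x²` and `P` that factors as `((2 + W) P -
    -- x²)((W - 2) P + x²)`. The barrier was chosen as the root given by the first factor.
    have f1 : 0 < (2 + W) * P - x ^ 2 := sub_pos.2 hl
    have f2 : 0 < (W - 2) * P + x ^ 2 := by nlinarith [mul_nonneg hW0 hP.le, mul_pos hx hP]
    rw [← sub_pos]
    refine (mul_pos f1 f2).trans_eq ?_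
    linear_combination P ^ 2 * hW2
  have hA : 0 < profile n t * (profile n t - profile n t ^ 2
          + (profile n t + n - 1) * (profile n t - deriv (profile n) t))
        - (n - 1) * (profile n t ^ 2
          - (profile n t + n) * (profile n t - deriv (profile n) t)) := by
    -- For `n = 1` the expression reduces to `x² (1 - x + P)`.
    rcases hn.eq_or_lt with rfl | h2
    · have h1 := profile_sub_deriv_one t
      have := mul_pos (mul_pos hx hx) (sub_pos.2 h1)
      refine this.trans_eq ?_
      push_cast
      ring
    · have := (sq_nonneg _).trans_lt (hD h2)
      have h3 := pos_of_mul_pos_left this hP.le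
      linarith
  refine ⟨hP, ?_, ?_, fun h2 => ?_⟩
  · rw [e2]; positivity
  · refine pos_of_mul_pos_right (e3 ▸ ?_) (sq_nonneg (profile n t))
    positivity
  · have h3 : 2 * profile n t ^ 2 * (profile n t - deriv (profile n) t)
        * (iteratedDeriv 2 (profile n) t ^ 2
          - deriv (profile n) t * iteratedDeriv 3 (profile n) t)
        = 2 * (profile n t - deriv (profile n) t) * (profile n t ^ 2 *
          (iteratedDeriv 2 (profile n) t ^ 2
          - deriv (profile n) t * iteratedDeriv 3 (profile n) t)) := by ring
    rw [h3, e3, e2, ← sub_pos]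
    refine (mul_pos (pow_pos hp 3) (sub_pos.2 (hD h2))).trans_eq ?_
    ring

end

noncomputable section

/-! ### Wirtinger calculus -/

variable {n : ℕ}

/-- `½ (∂F/∂xⁱ + c ∂F/∂yⁱ)`; the Wirtinger derivatives are the cases `c = ∓√-1`. -/
def wirtinger (c : ℂ) (i : Fin n) (F : Cn n → ℂ) (z : Cn n) : ℂ :=
  (1 / 2) * (fderiv ℝ F z (EuclideanSpace.single i 1)
    + c * fderiv ℝ F z (EuclideanSpace.single i Complex.I))

theorem dz_eq_wirtinger (i : Fin n) (F : Cn n → ℂ) (z : Cn n) :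
    dz i F z = wirtinger (-Complex.I) i F z := by
  rw [dz, wirtinger]; ring

/-- `F` is real differentiable at `z` with Wirtinger derivative `a`. -/
def HasWirtingerAt (c : ℂ) (i : Fin n) (F : Cn n → ℂ) (a : ℂ) (z : Cn n) : Prop :=
  DifferentiableAt ℝ F z ∧ wirtinger c i F z = a

variable {c : ℂ} {i : Fin n} {F G : Cn n → ℂ} {a b : ℂ} {z : Cn n}

theorem hasWirtingerAt_of_hasFDerivAt {F' : Cn n →L[ℝ] ℂ} (h : HasFDerivAt F F' z) :
    HasWirtingerAt c i F ((1 / 2) * (F' (EuclideanSpace.single i 1)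
      + c * F' (EuclideanSpace.single i Complex.I))) z :=
  ⟨h.differentiableAt, by rw [wirtinger, h.fderiv]⟩

theorem hasWirtingerAt_of_differentiableAt (h : DifferentiableAt ℝ F z) :
    HasWirtingerAt c i F (wirtinger c i F z) z := ⟨h, rfl⟩

theorem HasWirtingerAt.dz (h : HasWirtingerAt (-Complex.I) i F a z) : dz i F z = a :=
  (dz_eq_wirtinger i F z).trans h.2

theorem HasWirtingerAt.dzbar (h : HasWirtingerAt Complex.I i F a z) : dzbar i F z = a := h.2

theorem HasWirtingerAt.congr (h : HasWirtingerAt c i F a z) (hab : a = b) :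
    HasWirtingerAt c i F b z := hab ▸ h

theorem HasWirtingerAt.congr_of_eventuallyEq (h : HasWirtingerAt c i F a z) (hG : G =ᶠ[𝓝 z] F) :
    HasWirtingerAt c i G a z :=
  ⟨h.1.congr_of_eventuallyEq hG, by rw [← h.2, wirtinger, wirtinger, hG.fderiv_eq]⟩

theorem HasWirtingerAt.add (hF : HasWirtingerAt c i F a z) (hG : HasWirtingerAt c i G b z) :
    HasWirtingerAt c i (fun w => F w + G w) (a + b) z := by
  refine (hasWirtingerAt_of_hasFDerivAt (hF.1.hasFDerivAt.add hG.1.hasFDerivAt)).congr ?_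
  rw [← hF.2, ← hG.2, wirtinger, wirtinger]
  simp only [add_apply]
  ring

theorem HasWirtingerAt.neg (hF : HasWirtingerAt c i F a z) :
    HasWirtingerAt c i (fun w => -F w) (-a) z := by
  refine (hasWirtingerAt_of_hasFDerivAt hF.1.hasFDerivAt.neg).congr ?_
  rw [← hF.2, wirtinger]
  simp only [neg_apply]
  ring

theorem HasWirtingerAt.sub (hF : HasWirtingerAt c i F a z) (hG : HasWirtingerAt c i G b z) :
    HasWirtingerAt c i (fun w => F w - G w) (a - b) z := by
  simpa only [sub_eq_add_neg] using hF.add hG.neg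

theorem HasWirtingerAt.mul (hF : HasWirtingerAt c i F a z) (hG : HasWirtingerAt c i G b z) :
    HasWirtingerAt c i (fun w => F w * G w) (a * G z + F z * b) z := by
  refine (hasWirtingerAt_of_hasFDerivAt (hF.1.hasFDerivAt.mul hG.1.hasFDerivAt)).congr ?_
  rw [← hF.2, ← hG.2, wirtinger, wirtinger]
  simp only [add_apply, smul_apply, smul_eq_mul]
  ring

theorem hasWirtingerAt_const (c : ℂ) (i : Fin n) (k : ℂ) (z : Cn n) :
    HasWirtingerAt c i (fun _ => k) 0 z :=
  (hasWirtingerAt_of_hasFDerivAt (hasFDerivAt_const k z)).congr (by simp)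

theorem HasWirtingerAt.mul_const (hF : HasWirtingerAt c i F a z) (k : ℂ) :
    HasWirtingerAt c i (fun w => F w * k) (a * k) z :=
  (hF.mul (hasWirtingerAt_const c i k z)).congr (by ring)

/-- The coordinate function `zʲ`, as a real linear map. -/
def coordL (j : Fin n) : Cn n →L[ℝ] ℂ := (EuclideanSpace.proj (𝕜 := ℂ) j).restrictScalars ℝ

theorem coordL_apply (j : Fin n) (v : Cn n) : coordL j v = v j := rfl

theorem hasWirtingerAt_coord (c : ℂ) (i j : Fin n) (z : Cn n) :
    HasWirtingerAt c i (fun w => w j) (if i = j then (1 / 2) * (1 + c * Complex.I) else 0) z := by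
  refine (hasWirtingerAt_of_hasFDerivAt (coordL j).hasFDerivAt).congr ?_
  simp only [coordL_apply, PiLp.single_apply]
  by_cases h : i = j
  · simp [h]
  · simp [h, Ne.symm h]

theorem hasWirtingerAt_conj_coord (c : ℂ) (i j : Fin n) (z : Cn n) :
    HasWirtingerAt c i (fun w => (starRingEnd ℂ) (w j))
      (if i = j then (1 / 2) * (1 - c * Complex.I) else 0) z := by
  refine (hasWirtingerAt_of_hasFDerivAt
    (((Complex.conjCLE : ℂ →L[ℝ] ℂ).comp (coordL j)).hasFDerivAt)).congr ?_
  simp only [ContinuousLinearMap.comp_apply, coordL_apply, PiLp.single_apply]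
  by_cases h : i = j
  · simp [h]
    ring
  · simp [h, Ne.symm h]

theorem dz_coord (i j : Fin n) (z : Cn n) :
    HasWirtingerAt (-Complex.I) i (fun w => w j) (if i = j then 1 else 0) z :=
  (hasWirtingerAt_coord _ i j z).congr (by
    have : (1 / 2 : ℂ) * (1 + -Complex.I * Complex.I) = 1 := by
      rw [neg_mul, Complex.I_mul_I]; norm_num
    rw [this])

theorem dzbar_coord (i j : Fin n) (z : Cn n) :
    HasWirtingerAt Complex.I i (fun w => w j) 0 z :=
  (hasWirtingerAt_coord _ i j z).congr (by rw [Complex.I_mul_I]; norm_num)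

theorem dz_conj_coord (i j : Fin n) (z : Cn n) :
    HasWirtingerAt (-Complex.I) i (fun w => (starRingEnd ℂ) (w j)) 0 z :=
  (hasWirtingerAt_conj_coord _ i j z).congr (by rw [neg_mul, Complex.I_mul_I]; norm_num)

theorem dzbar_conj_coord (i j : Fin n) (z : Cn n) :
    HasWirtingerAt Complex.I i (fun w => (starRingEnd ℂ) (w j)) (if i = j then 1 else 0) z :=
  (hasWirtingerAt_conj_coord _ i j z).congr (by
    have : (1 / 2 : ℂ) * (1 - Complex.I * Complex.I) = 1 := by
      rw [Complex.I_mul_I]; norm_num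
    rw [this])

theorem norm_sq_eq_sum (z : Cn n) : ‖z‖ ^ 2 = ∑ j, ((z j).re ^ 2 + (z j).im ^ 2) := by
  rw [EuclideanSpace.norm_sq_eq]
  refine Finset.sum_congr rfl fun j _ => ?_
  rw [Complex.sq_norm, Complex.normSq_apply]
  ring

theorem norm_sq_eq_sum_mul_conj (z : Cn n) :
    ((‖z‖ ^ 2 : ℝ) : ℂ) = ∑ j, z j * (starRingEnd ℂ) (z j) := by
  rw [EuclideanSpace.norm_sq_eq, Complex.ofReal_sum]
  refine Finset.sum_congr rfl fun j _ => ?_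
  rw [Complex.mul_conj, Complex.sq_norm]

/-- The derivative of `|z|²`. -/
def normSqDeriv (z : Cn n) : Cn n →L[ℝ] ℝ :=
  ∑ j, ((2 * (z j).re) • Complex.reCLM.comp (coordL j)
    + (2 * (z j).im) • Complex.imCLM.comp (coordL j))

theorem normSqDeriv_apply (z v : Cn n) :
    normSqDeriv z v = ∑ j, (2 * (z j).re * (v j).re + 2 * (z j).im * (v j).im) := by
  simp [normSqDeriv, coordL_apply]

theorem hasFDerivAt_norm_sq (z : Cn n) :
    HasFDerivAt (fun w : Cn n => ‖w‖ ^ 2) (normSqDeriv z) z := by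
  simp only [norm_sq_eq_sum]
  refine HasFDerivAt.fun_sum fun j _ => ?_
  have h1 := (Complex.reCLM.comp (coordL j)).hasFDerivAt (x := z)
  have h2 := (Complex.imCLM.comp (coordL j)).hasFDerivAt (x := z)
  refine ((h1.pow 2).add (h2.pow 2)).congr_fderiv ?_
  ext v
  simp [coordL_apply]

theorem contDiff_norm_sq : ContDiff ℝ ∞ (fun w : Cn n => ‖w‖ ^ 2) := by
  simp only [norm_sq_eq_sum]
  refine ContDiff.sum fun j _ => ?_
  exact ((Complex.reCLM.comp (coordL j)).contDiff.pow 2).add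
    ((Complex.imCLM.comp (coordL j)).contDiff.pow 2)

theorem normSqDeriv_single (z : Cn n) (i : Fin n) (w : ℂ) :
    normSqDeriv z (EuclideanSpace.single i w) = 2 * (z i).re * w.re + 2 * (z i).im * w.im := by
  rw [normSqDeriv_apply, Finset.sum_eq_single i]
  · simp
  · intro j _ hj
    simp [hj]
  · simp

theorem hasWirtingerAt_radial {h : ℝ → ℝ} {h' : ℝ} (c : ℂ) (i : Fin n)
    (hh : HasDerivAt h h' (‖z‖ ^ 2)) :
    HasWirtingerAt c i (fun w => (h (‖w‖ ^ 2) : ℂ)) (h' * ((z i).re + c * (z i).im)) z := by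
  have h1 : HasFDerivAt (fun w : Cn n => h (‖w‖ ^ 2)) (h' • normSqDeriv z) z :=
    hh.comp_hasFDerivAt z (hasFDerivAt_norm_sq z)
  have h2 := Complex.ofRealCLM.hasFDerivAt.comp z h1
  refine (hasWirtingerAt_of_hasFDerivAt h2).congr ?_
  simp [normSqDeriv_single]
  ring

theorem dz_radial {h : ℝ → ℝ} {h' : ℝ} (i : Fin n)
    (hh : HasDerivAt h h' (‖z‖ ^ 2)) :
    HasWirtingerAt (-Complex.I) i (fun w => (h (‖w‖ ^ 2) : ℂ)) (h' * (starRingEnd ℂ) (z i)) z :=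
  (hasWirtingerAt_radial (-Complex.I) i hh).congr (by
    congr 1
    apply Complex.ext <;> simp)

theorem dzbar_radial {h : ℝ → ℝ} {h' : ℝ} (i : Fin n)
    (hh : HasDerivAt h h' (‖z‖ ^ 2)) :
    HasWirtingerAt Complex.I i (fun w => (h (‖w‖ ^ 2) : ℂ)) (h' * z i) z :=
  (hasWirtingerAt_radial Complex.I i hh).congr (by
    congr 1
    apply Complex.ext <;> simp)

end

noncomputable section

/-! ### Kähler metrics with a radial potential -/

variable {n : ℕ}

/-- The standard Hermitian product `∑ vⁱ w̄ⁱ`. -/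
def hdot (v w : Cn n) : ℂ := ∑ i, v i * (starRingEnd ℂ) (w i)

theorem hdot_eq_inner (v w : Cn n) : hdot v w = inner ℂ w v := by
  rw [hdot, PiLp.inner_apply]
  rfl

theorem hdot_self (v : Cn n) : hdot v v = ((‖v‖ ^ 2 : ℝ) : ℂ) :=
  (norm_sq_eq_sum_mul_conj v).symm

theorem conj_hdot (v w : Cn n) : (starRingEnd ℂ) (hdot v w) = hdot w v := by
  simp [hdot, mul_comm]

theorem norm_hdot_le (v w : Cn n) : ‖hdot v w‖ ≤ ‖v‖ * ‖w‖ := by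
  rw [hdot_eq_inner, mul_comm]; exact norm_inner_le_norm w v

theorem hdot_map (U : Cn n ≃ₗᵢ[ℂ] Cn n) (v w : Cn n) : hdot (U v) (U w) = hdot v w := by
  rw [hdot_eq_inner, hdot_eq_inner, U.inner_map_map]

/-- The metric `h(s) δ_{ij} + h'(s) z̄ⁱ zʲ`, `s = |z|²`, with Kähler potential `∫ h(|z|²)`. -/
def radialMetric (n : ℕ) (h : ℝ → ℝ) : MetricField n := fun z i j =>
  (h (‖z‖ ^ 2) : ℂ) * (if i = j then 1 else 0)
    + ((deriv h (‖z‖ ^ 2) : ℝ) : ℂ) * ((starRingEnd ℂ) (z i) * z j)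

/-- The function is smooth at every point of the closed half line `[0, ∞)`. -/
def SmoothOnHalfLine (h : ℝ → ℝ) : Prop := ∀ s, 0 ≤ s → ContDiffAt ℝ ∞ h s

theorem SmoothOnHalfLine.hasDerivAt {h : ℝ → ℝ} (hh : SmoothOnHalfLine h) {s : ℝ} (hs : 0 ≤ s) :
    HasDerivAt h (deriv h s) s :=
  ((hh s hs).differentiableAt (by simp)).hasDerivAt

theorem SmoothOnHalfLine.smooth_deriv {h : ℝ → ℝ} (hh : SmoothOnHalfLine h) :
    SmoothOnHalfLine (deriv h) := fun s hs =>
  ((hh s hs).fderiv_right (m := ∞) (by simp)).clm_apply contDiffAt_const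

theorem SmoothOnHalfLine.contDiff_radial {h : ℝ → ℝ} (hh : SmoothOnHalfLine h) :
    ContDiff ℝ ∞ (fun z : Cn n => h (‖z‖ ^ 2)) :=
  contDiff_iff_contDiffAt.2 fun z =>
    (hh _ (by positivity)).comp z contDiff_norm_sq.contDiffAt

theorem SmoothOnHalfLine.dz_radial {h : ℝ → ℝ} (hh : SmoothOnHalfLine h) (i : Fin n) (z : Cn n) :
    HasWirtingerAt (-Complex.I) i (fun w => (h (‖w‖ ^ 2) : ℂ))
      (((deriv h (‖z‖ ^ 2) : ℝ) : ℂ) * (starRingEnd ℂ) (z i)) z :=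
  KRSoliton.dz_radial i (hh.hasDerivAt (by positivity))

theorem SmoothOnHalfLine.dzbar_radial {h : ℝ → ℝ} (hh : SmoothOnHalfLine h) (i : Fin n)
    (z : Cn n) :
    HasWirtingerAt Complex.I i (fun w => (h (‖w‖ ^ 2) : ℂ)) (((deriv h (‖z‖ ^ 2) : ℝ) : ℂ) * z i) z :=
  KRSoliton.dzbar_radial i (hh.hasDerivAt (by positivity))

theorem ddbar_radial {U h : ℝ → ℝ} (hU : ∀ s, 0 ≤ s → HasDerivAt U (h s) s)
    (hh : SmoothOnHalfLine h) (z : Cn n) (i j : Fin n) :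
    ddbar (fun w => U (‖w‖ ^ 2)) z i j = radialMetric n h z i j := by
  have e : dzbar j (fun w : Cn n => ((U (‖w‖ ^ 2) : ℝ) : ℂ))
      = fun w => (h (‖w‖ ^ 2) : ℂ) * w j :=
    funext fun w => (dzbar_radial j (hU _ (by positivity))).dzbar
  rw [ddbar, e, ((hh.dz_radial i z).mul (dz_coord i j z)).dz, radialMetric]
  ring

theorem dz_radialMetric {h : ℝ → ℝ} (hh : SmoothOnHalfLine h) (k i j : Fin n) (z : Cn n) :
    HasWirtingerAt (-Complex.I) k (fun w => radialMetric n h w i j)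
      (((deriv h (‖z‖ ^ 2) : ℝ) : ℂ) * ((starRingEnd ℂ) (z k) * (if i = j then 1 else 0)
          + (starRingEnd ℂ) (z i) * (if k = j then 1 else 0))
        + ((deriv (deriv h) (‖z‖ ^ 2) : ℝ) : ℂ)
          * ((starRingEnd ℂ) (z k) * (starRingEnd ℂ) (z i) * z j)) z := by
  refine (((hh.dz_radial k z).mul_const (if i = j then 1 else 0)).add
    ((hh.smooth_deriv.dz_radial k z).mul ((dz_conj_coord k i z).mul (dz_coord k j z)))).congr ?_
  ring

theorem dzbar_radialMetric {h : ℝ → ℝ} (hh : SmoothOnHalfLine h) (l i j : Fin n) (z : Cn n) :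
    HasWirtingerAt Complex.I l (fun w => radialMetric n h w i j)
      (((deriv h (‖z‖ ^ 2) : ℝ) : ℂ) * (z l * (if i = j then 1 else 0)
          + z j * (if l = i then 1 else 0))
        + ((deriv (deriv h) (‖z‖ ^ 2) : ℝ) : ℂ) * ((starRingEnd ℂ) (z i) * z j * z l)) z := by
  refine (((hh.dzbar_radial l z).mul_const (if i = j then 1 else 0)).add
    ((hh.smooth_deriv.dzbar_radial l z).mul ((dzbar_conj_coord l i z).mul (dzbar_coord l j z)))).congr ?_
  ring

theorem dz_dzbar_radialMetric {h : ℝ → ℝ} (hh : SmoothOnHalfLine h) (k l i j : Fin n)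
    (z : Cn n) :
    dz k (dzbar l (fun w => radialMetric n h w i j)) z
      = ((deriv h (‖z‖ ^ 2) : ℝ) : ℂ) * ((if k = l then 1 else 0) * (if i = j then 1 else 0)
          + (if k = j then 1 else 0) * (if l = i then 1 else 0))
        + ((deriv (deriv h) (‖z‖ ^ 2) : ℝ) : ℂ) *
          ((starRingEnd ℂ) (z k) * z l * (if i = j then 1 else 0)
          + (starRingEnd ℂ) (z k) * z j * (if l = i then 1 else 0)
          + (starRingEnd ℂ) (z i) * z l * (if k = j then 1 else 0)
          + (starRingEnd ℂ) (z i) * z j * (if k = l then 1 else 0))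
        + ((deriv (deriv (deriv h)) (‖z‖ ^ 2) : ℝ) : ℂ)
          * ((starRingEnd ℂ) (z k) * (starRingEnd ℂ) (z i) * z j * z l) := by
  have e : dzbar l (fun w => radialMetric n h w i j) = fun z =>
      (((deriv h (‖z‖ ^ 2) : ℝ) : ℂ) * (z l * (if i = j then 1 else 0)
          + z j * (if l = i then 1 else 0))
        + ((deriv (deriv h) (‖z‖ ^ 2) : ℝ) : ℂ) * ((starRingEnd ℂ) (z i) * z j * z l)) :=
    funext fun w => (dzbar_radialMetric hh l i j w).dzbar
  rw [e, (((hh.smooth_deriv.dz_radial k z).mul (((dz_coord k l z).mul_const (if i = j then 1 else 0)).add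
    ((dz_coord k j z).mul_const (if l = i then 1 else 0)))).add
    ((hh.smooth_deriv.smooth_deriv.dz_radial k z).mul
      (((dz_conj_coord k i z).mul (dz_coord k j z)).mul (dz_coord k l z)))).dz]
  ring

theorem contDiff_coord (i : Fin n) : ContDiff ℝ ∞ (fun z : Cn n => z i) := (coordL i).contDiff

theorem contDiff_conj_coord (i : Fin n) :
    ContDiff ℝ ∞ (fun z : Cn n => (starRingEnd ℂ) (z i)) :=
  (Complex.conjCLE : ℂ →L[ℝ] ℂ).contDiff.comp (contDiff_coord i)

theorem contDiff_ofReal {f : Cn n → ℝ} (hf : ContDiff ℝ ∞ f) :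
    ContDiff ℝ ∞ (fun z => (f z : ℂ)) := Complex.ofRealCLM.contDiff.comp hf

theorem contDiff_radialMetric {h : ℝ → ℝ} (hh : SmoothOnHalfLine h) (i j : Fin n) :
    ContDiff ℝ ∞ (fun z => radialMetric n h z i j) :=
  ((contDiff_ofReal hh.contDiff_radial).mul contDiff_const).add
    ((contDiff_ofReal hh.smooth_deriv.contDiff_radial).mul
      ((contDiff_conj_coord i).mul (contDiff_coord j)))

theorem herm_radialMetric (h : ℝ → ℝ) (z v w : Cn n) :
    herm (radialMetric n h) z v w = (h (‖z‖ ^ 2) : ℂ) * hdot v w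
      + ((deriv h (‖z‖ ^ 2) : ℝ) : ℂ) * (hdot v z * hdot z w) := by
  simp only [herm, radialMetric, add_mul, Finset.sum_add_distrib]
  congr 1
  · simp only [hdot, Finset.mul_sum]
    refine Finset.sum_congr rfl fun i _ => ?_
    rw [Finset.sum_eq_single i]
    · simp; ring
    · intro j _ hj; simp [hj.symm]
    · simp
  · rw [hdot, hdot, Finset.sum_mul_sum, Finset.mul_sum]
    refine Finset.sum_congr rfl fun i _ => ?_
    rw [Finset.mul_sum]
    refine Finset.sum_congr rfl fun j _ => ?_
    ring

theorem isUnitaryInvariant_radialMetric (h : ℝ → ℝ) : IsUnitaryInvariant (radialMetric n h) := by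
  intro U z v w
  simp only [herm_radialMetric, hdot_map, U.norm_map]

theorem realInner_radialMetric (h : ℝ → ℝ) (z v : Cn n) :
    realInner (radialMetric n h) z v v = h (‖z‖ ^ 2) * ‖v‖ ^ 2
      + deriv h (‖z‖ ^ 2) * ‖hdot v z‖ ^ 2 := by
  rw [realInner, herm_radialMetric, ← conj_hdot v z, hdot_self, Complex.mul_conj,
    Complex.normSq_eq_norm_sq, ← Complex.ofReal_mul, ← Complex.ofReal_mul, ← Complex.ofReal_add,
    Complex.ofReal_re]

/-- A lower bound for a Hermitian form with eigenvalues `a` and `a + s b`. -/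
theorem radial_form_pos {a b s x y : ℝ} (ha : 0 < a) (hab : 0 < a + s * b)
    (hx : 0 < x) (hy : 0 ≤ y) (hxy : y ≤ x * s) : 0 < a * x + b * y := by
  rcases le_or_gt 0 b with hb | hb
  · positivity
  · nlinarith [mul_pos hab hx, mul_le_mul_of_nonpos_left hxy hb.le]

theorem norm_hdot_sq_le (v z : Cn n) : ‖hdot v z‖ ^ 2 ≤ ‖v‖ ^ 2 * ‖z‖ ^ 2 := by
  rw [← mul_pow]
  exact pow_le_pow_left₀ (norm_nonneg _) (norm_hdot_le v z) 2

theorem posDef_radialMetric {h : ℝ → ℝ} (h0 : ∀ s, 0 ≤ s → 0 < h s)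
    (h1 : ∀ s, 0 ≤ s → 0 < h s + s * deriv h s) (z : Cn n) : (radialMetric n h z).PosDef := by
  apply Matrix.PosDef.of_dotProduct_mulVec_pos
  · ext i j
    rw [Matrix.conjTranspose_apply]
    by_cases hij : i = j
    · subst hij; simp [radialMetric, mul_comm]
    · simp [radialMetric, hij, Ne.symm hij, mul_comm]
  · intro x hx
    set v : Cn n := WithLp.toLp 2 (star x) with hv
    have hv0 : v ≠ 0 := by
      intro h
      apply hx
      have : star x = 0 := by
        funext i
        exact congrArg (fun u : Cn n => u i) h
      simpa using this
    have e : star x ⬝ᵥ (radialMetric n h z).mulVec x = herm (radialMetric n h) z v v := by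
      simp only [dotProduct, Matrix.mulVec, herm, Finset.mul_sum]
      refine Finset.sum_congr rfl fun i _ => Finset.sum_congr rfl fun j _ => ?_
      simp [hv]
      ring
    have e2 : herm (radialMetric n h) z v v
        = ((realInner (radialMetric n h) z v v : ℝ) : ℂ) := by
      rw [realInner_radialMetric, herm_radialMetric, ← conj_hdot v z, hdot_self, Complex.mul_conj,
        Complex.normSq_eq_norm_sq]
      push_cast
      rfl
    rw [e, e2, realInner_radialMetric]
    have hs : 0 ≤ ‖z‖ ^ 2 := by positivity
    have hv1 : 0 < ‖v‖ := norm_pos_iff.2 hv0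
    exact_mod_cast radial_form_pos (h0 _ hs) (h1 _ hs) (by positivity) (by positivity)
      (norm_hdot_sq_le v z)

theorem isKahlerMetric_radialMetric {h : ℝ → ℝ} (hh : SmoothOnHalfLine h)
    (h0 : ∀ s, 0 ≤ s → 0 < h s) (h1 : ∀ s, 0 ≤ s → 0 < h s + s * deriv h s) :
    IsKahlerMetric (radialMetric n h) where
  smooth := contDiff_radialMetric hh
  posDef := posDef_radialMetric h0 h1
  closed z i j k := by
    rw [(dz_radialMetric hh k i j z).dz, (dz_radialMetric hh i k j z).dz]
    ring

/-- The metric is `h` times a rank-one perturbation of the identity, so the matrix determinant lemma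
applies. -/
theorem det_radialMetric (hn : 1 ≤ n) {h : ℝ → ℝ} (z : Cn n) (h0 : h (‖z‖ ^ 2) ≠ 0) :
    (radialMetric n h z).det = ((h (‖z‖ ^ 2) ^ (n - 1)
      * (h (‖z‖ ^ 2) + ‖z‖ ^ 2 * deriv h (‖z‖ ^ 2)) : ℝ) : ℂ) := by
  have h0' : (h (‖z‖ ^ 2) : ℂ) ≠ 0 := by exact_mod_cast h0
  have e : radialMetric n h z = (h (‖z‖ ^ 2) : ℂ) • (1 + Matrix.replicateCol Unit
      (fun i => (starRingEnd ℂ) (z i)) * Matrix.replicateRow Unit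
      (fun j => ((deriv h (‖z‖ ^ 2) : ℝ) : ℂ) / (h (‖z‖ ^ 2) : ℂ) * z j)) := by
    ext i j
    simp only [radialMetric, Matrix.smul_apply, Matrix.add_apply, Matrix.one_apply,
      Matrix.mul_apply, Matrix.replicateCol_apply, Matrix.replicateRow_apply, Finset.univ_unique,
      Finset.sum_const, Finset.card_singleton, one_smul, smul_eq_mul]
    field_simp
  have e2 : (fun j => ((deriv h (‖z‖ ^ 2) : ℝ) : ℂ) / (h (‖z‖ ^ 2) : ℂ) * z j) ⬝ᵥ
      (fun i => (starRingEnd ℂ) (z i))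
      = ((deriv h (‖z‖ ^ 2) : ℝ) : ℂ) / (h (‖z‖ ^ 2) : ℂ) * ((‖z‖ ^ 2 : ℝ) : ℂ) := by
    rw [norm_sq_eq_sum_mul_conj, Finset.mul_sum, dotProduct]
    exact Finset.sum_congr rfl fun i _ => mul_assoc _ _ _
  rw [e, Matrix.det_smul, Matrix.det_one_add_replicateCol_mul_replicateRow, e2, Fintype.card_fin]
  obtain ⟨k, rfl⟩ : ∃ k, n = k + 1 := ⟨n - 1, by omega⟩
  simp only [add_tsub_cancel_right]
  push_cast
  field_simp
  ring

/-- The inverse metric applied to the radial direction. -/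
theorem sum_gInv_radialMetric {h : ℝ → ℝ} (h0 : ∀ s, 0 ≤ s → 0 < h s)
    (h1 : ∀ s, 0 ≤ s → 0 < h s + s * deriv h s) (z : Cn n) (l : Fin n) :
    ∑ k, gInv (radialMetric n h) z k l * (starRingEnd ℂ) (z k)
      = ((h (‖z‖ ^ 2) + ‖z‖ ^ 2 * deriv h (‖z‖ ^ 2) : ℝ) : ℂ)⁻¹ * (starRingEnd ℂ) (z l) := by
  have hs : 0 ≤ ‖z‖ ^ 2 := by positivity
  have hl : ((h (‖z‖ ^ 2) + ‖z‖ ^ 2 * deriv h (‖z‖ ^ 2) : ℝ) : ℂ) ≠ 0 := by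
    exact_mod_cast (h1 _ hs).ne'
  have hu : IsUnit (radialMetric n h z).det :=
    (Matrix.isUnit_iff_isUnit_det _).1 (posDef_radialMetric h0 h1 z).isUnit
  have e : (radialMetric n h z).mulVec (fun k => (starRingEnd ℂ) (z k))
      = ((h (‖z‖ ^ 2) + ‖z‖ ^ 2 * deriv h (‖z‖ ^ 2) : ℝ) : ℂ)
        • fun k => (starRingEnd ℂ) (z k) := by
    funext i
    simp only [Matrix.mulVec, dotProduct, radialMetric, add_mul, Finset.sum_add_distrib,
      Pi.smul_apply, smul_eq_mul, Complex.ofReal_add, Complex.ofReal_mul _ (deriv _ _)]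
    rw [norm_sq_eq_sum_mul_conj z]
    congr 1
    · rw [Finset.sum_eq_single i]
      · simp
      · intro j _ hj; simp [hj.symm]
      · simp
    · simp only [Finset.sum_mul]
      exact Finset.sum_congr rfl fun j _ => by ring
  have e2 : (radialMetric n h z)⁻¹.mulVec (((h (‖z‖ ^ 2) + ‖z‖ ^ 2 * deriv h (‖z‖ ^ 2) : ℝ) : ℂ)
        • fun k => (starRingEnd ℂ) (z k)) = fun k => (starRingEnd ℂ) (z k) := by
    rw [← e, Matrix.mulVec_mulVec, Matrix.nonsing_inv_mul _ hu, Matrix.one_mulVec]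
  rw [Matrix.mulVec_smul] at e2
  have e3 := congrFun e2 l
  simp only [Pi.smul_apply, smul_eq_mul, Matrix.mulVec, dotProduct] at e3
  rw [eq_inv_mul_iff_mul_eq₀ hl]
  exact e3

/-- The gradient field of `P` is the Euler field, which is holomorphic: `∂ₖP = (sh)' z̄ᵏ`, and `z̄`
is an eigenvector of `g` with eigenvalue `(sh)'`. -/
theorem covHess_radialMetric {h : ℝ → ℝ} (hh : SmoothOnHalfLine h) (h0 : ∀ s, 0 ≤ s → 0 < h s)
    (h1 : ∀ s, 0 ≤ s → 0 < h s + s * deriv h s) {P : ℝ → ℝ}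
    (hP : ∀ s, 0 ≤ s → HasDerivAt P (h s + s * deriv h s) s) (z : Cn n) (i j : Fin n) :
    covHess (radialMetric n h) (fun w => P (‖w‖ ^ 2)) z i j = 0 := by
  have hs : 0 ≤ ‖z‖ ^ 2 := by positivity
  have hl : ((h (‖z‖ ^ 2) + ‖z‖ ^ 2 * deriv h (‖z‖ ^ 2) : ℝ) : ℂ) ≠ 0 := by
    exact_mod_cast (h1 _ hs).ne'
  have e : ∀ k, dz k (fun w : Cn n => ((P (‖w‖ ^ 2) : ℝ) : ℂ)) = fun w =>
      ((h (‖w‖ ^ 2) + ‖w‖ ^ 2 * deriv h (‖w‖ ^ 2) : ℝ) : ℂ) * (starRingEnd ℂ) (w k) :=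
    fun k => funext fun w => (dz_radial k (hP _ (by positivity))).dz
  have hd : HasDerivAt (fun s => h s + s * deriv h s)
      (2 * deriv h (‖z‖ ^ 2) + ‖z‖ ^ 2 * deriv (deriv h) (‖z‖ ^ 2)) (‖z‖ ^ 2) :=
    ((hh.hasDerivAt hs).add ((hasDerivAt_id _).mul (hh.smooth_deriv.hasDerivAt hs))).congr_deriv
      (by ring)
  change dz i (dz j (fun w : Cn n => ((P (‖w‖ ^ 2) : ℝ) : ℂ))) z
    - ∑ k, christoffel (radialMetric n h) z i j k
      * dz k (fun w : Cn n => ((P (‖w‖ ^ 2) : ℝ) : ℂ)) z = 0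
  rw [e j]
  rw [((dz_radial i hd).mul (dz_conj_coord i j z)).dz]
  -- Contracting the inverse metric with `∂ₖP` cancels the eigenvalue, so that only `∂ᵢ g_{j l̄}
  -- z̄ˡ` is left.
  have e2 : ∑ k, christoffel (radialMetric n h) z i j k *
      dz k (fun w : Cn n => ((P (‖w‖ ^ 2) : ℝ) : ℂ)) z
      = ∑ l, dz i (fun w => radialMetric n h w j l) z * (starRingEnd ℂ) (z l) := by
    rw [Finset.sum_congr rfl fun k _ => congrArg _ (congrFun (e k) z)]
    simp only [christoffel, Finset.sum_mul]
    rw [Finset.sum_comm]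
    refine Finset.sum_congr rfl fun l _ => ?_
    have := sum_gInv_radialMetric h0 h1 z l
    calc _ = ((h (‖z‖ ^ 2) + ‖z‖ ^ 2 * deriv h (‖z‖ ^ 2) : ℝ) : ℂ)
          * dz i (fun w => radialMetric n h w j l) z
          * ∑ k, gInv (radialMetric n h) z k l * (starRingEnd ℂ) (z k) := by
          rw [Finset.mul_sum]
          exact Finset.sum_congr rfl fun k _ => by ring
      _ = _ := by rw [this]; field_simp
  rw [e2, Finset.sum_congr rfl fun l _ => congrArg (· * _) (dz_radialMetric hh i j l z).dz]
  have e3 : ∑ l, (((deriv h (‖z‖ ^ 2) : ℝ) : ℂ) * ((starRingEnd ℂ) (z i) * (if j = l then 1 else 0)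
          + (starRingEnd ℂ) (z j) * (if i = l then 1 else 0))
        + ((deriv (deriv h) (‖z‖ ^ 2) : ℝ) : ℂ)
          * ((starRingEnd ℂ) (z i) * (starRingEnd ℂ) (z j) * z l)) * (starRingEnd ℂ) (z l)
      = ((deriv h (‖z‖ ^ 2) : ℝ) : ℂ) * ((starRingEnd ℂ) (z i) * (starRingEnd ℂ) (z j)
          + (starRingEnd ℂ) (z j) * (starRingEnd ℂ) (z i))
        + ((deriv (deriv h) (‖z‖ ^ 2) : ℝ) : ℂ)
          * ((starRingEnd ℂ) (z i) * (starRingEnd ℂ) (z j)) * ((‖z‖ ^ 2 : ℝ) : ℂ) := by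
    rw [norm_sq_eq_sum_mul_conj, Finset.mul_sum]
    simp only [add_mul, mul_add, Finset.sum_add_distrib]
    congr 1
    · simp [mul_assoc]
    · exact Finset.sum_congr rfl fun l _ => by ring
  rw [e3]
  push_cast
  ring

end

noncomputable section

/-! ### The soliton metric -/

variable {n : ℕ}

/-- The soliton metric. -/
def solitonMetric (n : ℕ) : MetricField n := radialMetric n (potentialDeriv n)

theorem smoothOnHalfLine_potentialDeriv (hn : 1 ≤ n) : SmoothOnHalfLine (potentialDeriv n) :=
  fun _ hs => potentialDeriv_contDiffAt hn hs

/-- Since `s h(s) = radiusInv n s`, the left side is the derivative of `radiusInv`; the computation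
is valid at `s = 0` too. -/
theorem radial_eigenvalue (hn : 1 ≤ n) {s : ℝ} (hs : 0 ≤ s) :
    potentialDeriv n s + s * deriv (potentialDeriv n) s
      = weight n (radiusInv n s) / (weightRoot n (radiusInv n s) * Real.exp (radiusInv n s)) := by
  have h1 := (weightRoot_hasDerivAt hn (radiusInv n s)).comp s (radiusInv_hasDerivAt hn hs)
  have h2 : HasDerivAt (potentialDeriv n) _ s := h1.inv (weightRoot_pos _ _).ne'
  have hr : radius n (radiusInv n s) = s := radius_radiusInv hn hs
  rw [h2.deriv, potentialDeriv]
  rw [radius] at hr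
  have hw := weight_pos hn (radiusInv n s)
  have hwr := weightRoot_pos n (radiusInv n s)
  have hn0 : (n : ℝ) ≠ 0 := by exact_mod_cast (by omega : n ≠ 0)
  have he : radiusInv n s * expMoment (n - 1 + 1) (radiusInv n s)
      = Real.exp (radiusInv n s) - weight n (radiusInv n s) :=
    mul_left_cancel₀ hn0 (by linear_combination mul_deriv_weight hn (radiusInv n s))
  simp only [Function.comp]
  generalize radiusInv n s = x at *
  rw [← hr]
  field_simp
  linear_combination -he

theorem radial_eigenvalue_pos (hn : 1 ≤ n) (s : ℝ) (hs : 0 ≤ s) :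
    0 < potentialDeriv n s + s * deriv (potentialDeriv n) s := by
  rw [radial_eigenvalue hn hs]
  have := weight_pos hn (radiusInv n s)
  have := weightRoot_pos n (radiusInv n s)
  positivity

theorem radiusInv_hasDerivAt' (hn : 1 ≤ n) (s : ℝ) (hs : 0 ≤ s) :
    HasDerivAt (radiusInv n) (potentialDeriv n s + s * deriv (potentialDeriv n) s) s := by
  rw [radial_eigenvalue hn hs]; exact radiusInv_hasDerivAt hn hs

theorem isKahlerMetric_solitonMetric (hn : 1 ≤ n) : IsKahlerMetric (solitonMetric n) :=
  isKahlerMetric_radialMetric (smoothOnHalfLine_potentialDeriv hn)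
    (fun s _ => potentialDeriv_pos n s) (radial_eigenvalue_pos hn)

/-- The product `hⁿ⁻¹ (sh)'` equals `H / (Hⁿ^{/n} e^x) = e^{-x}`. So `-log det g` is `sh` itself and
serves as the soliton potential. -/
theorem det_solitonMetric (hn : 1 ≤ n) (z : Cn n) :
    (solitonMetric n z).det = ((Real.exp (-radiusInv n (‖z‖ ^ 2)) : ℝ) : ℂ) := by
  rw [solitonMetric, det_radialMetric hn z (potentialDeriv_pos n _).ne',
    radial_eigenvalue hn (by positivity), potentialDeriv]
  congr 1
  have hw := weightRoot_pow hn (radiusInv n (‖z‖ ^ 2))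
  have hwr := weightRoot_pos n (radiusInv n (‖z‖ ^ 2))
  obtain ⟨k, rfl⟩ : ∃ k, n = k + 1 := ⟨n - 1, by omega⟩
  rw [← hw, Real.exp_neg]
  simp only [add_tsub_cancel_right]
  field_simp
  rw [one_div, inv_pow]
  field_simp
  exact pow_succ _ _

theorem isGradientSoliton_solitonMetric (hn : 1 ≤ n) : IsGradientSoliton (solitonMetric n) where
  kahler := isKahlerMetric_solitonMetric hn
  soliton := by
    refine ⟨fun z => radiusInv n (‖z‖ ^ 2),
      SmoothOnHalfLine.contDiff_radial fun s hs => radiusInv_contDiffAt hn hs, ?_, ?_⟩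
    · intro z i j
      have : (fun w : Cn n => -Real.log (solitonMetric n w).det.re)
          = fun w => radiusInv n (‖w‖ ^ 2) := by
        funext w
        rw [det_solitonMetric hn, Complex.ofReal_re, Real.log_exp, neg_neg]
      rw [ricci, this]
    · exact covHess_radialMetric (smoothOnHalfLine_potentialDeriv hn)
        (fun s _ => potentialDeriv_pos n s) (radial_eigenvalue_pos hn) (radiusInv_hasDerivAt' hn)

/-- In dimension one only the radial eigenvalue matters; it equals `e^{-x}` with `e^x - 1 = s`. -/
theorem solitonMetric_one (z : Cn 1) (i j : Fin 1) :
    solitonMetric 1 z i j = ((1 / (1 + ‖z‖ ^ 2) : ℝ) : ℂ) := by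
  have hs : 0 ≤ ‖z‖ ^ 2 := by positivity
  have hi : j = i := Subsingleton.elim _ _
  subst hi
  have hz : ‖z‖ ^ 2 = Complex.normSq (z j) := by
    rw [EuclideanSpace.norm_sq_eq, ← Complex.sq_norm]
    fin_cases j
    simp
  have e : solitonMetric 1 z j j = ((potentialDeriv 1 (‖z‖ ^ 2)
      + ‖z‖ ^ 2 * deriv (potentialDeriv 1) (‖z‖ ^ 2) : ℝ) : ℂ) := by
    simp only [solitonMetric, radialMetric, if_true, mul_comm ((starRingEnd ℂ) (z j)),
      Complex.mul_conj, ← hz]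
    push_cast
    ring
  rw [e, radial_eigenvalue le_rfl hs]
  congr 1
  have h1 := radius_pow (n := 1) le_rfl (radiusInv 1 (‖z‖ ^ 2))
  rw [radius_radiusInv le_rfl hs, tsub_self, powExpIntegral_zero] at h1
  have h2 := weightRoot_pow (n := 1) le_rfl (radiusInv 1 (‖z‖ ^ 2))
  have hw := weight_pos (n := 1) le_rfl (radiusInv 1 (‖z‖ ^ 2))
  rw [pow_one] at h2
  rw [h2, div_mul_eq_div_div, div_self hw.ne']
  congr 1
  simp only [pow_one, Nat.cast_one, one_mul] at h1
  linarith

theorem solitonMetric_eq_ddbar (hn : 1 ≤ n) (z : Cn n) (i j : Fin n) :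
    solitonMetric n z i j = ddbar (fun w => potential n (‖w‖ ^ 2)) z i j :=
  (ddbar_radial (fun _ hs => potential_hasDerivAt hn hs) (smoothOnHalfLine_potentialDeriv hn)
    z i j).symm

theorem contDiff_potential (hn : 1 ≤ n) :
    ContDiff ℝ ∞ (fun w : Cn n => potential n (‖w‖ ^ 2)) :=
  SmoothOnHalfLine.contDiff_radial fun _ hs => potential_contDiffAt hn hs

theorem potential_exp_hasDerivAt (hn : 1 ≤ n) (t : ℝ) :
    HasDerivAt (fun t => potential n (Real.exp t)) (profile n t) t := by
  refine ((potential_hasDerivAt hn (Real.exp_pos t).le).comp t (Real.hasDerivAt_exp t)).congr_deriv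
    ?_
  rw [profile, ← mul_potentialDeriv hn (Real.exp_pos t).le, mul_comm]

/-- The metric in terms of the profile, away from the origin. -/
theorem exp_mul_potentialDeriv (hn : 1 ≤ n) (t : ℝ) :
    Real.exp t * potentialDeriv n (Real.exp t) = profile n t :=
  mul_potentialDeriv hn (Real.exp_pos t).le

theorem deriv_profile_eq (hn : 1 ≤ n) (t : ℝ) :
    deriv (profile n) t = Real.exp t * (potentialDeriv n (Real.exp t)
      + Real.exp t * deriv (potentialDeriv n) (Real.exp t)) :=
  ((radiusInv_hasDerivAt' hn _ (Real.exp_pos t).le).comp t (Real.hasDerivAt_exp t)).deriv.trans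
    (mul_comm _ _)

theorem iteratedDeriv_two_profile_eq (hn : 1 ≤ n) (t : ℝ) :
    iteratedDeriv 2 (profile n) t = Real.exp t * potentialDeriv n (Real.exp t)
      + 3 * Real.exp t ^ 2 * deriv (potentialDeriv n) (Real.exp t)
      + Real.exp t ^ 3 * deriv (deriv (potentialDeriv n)) (Real.exp t) := by
  have hh := smoothOnHalfLine_potentialDeriv hn
  have ht := (Real.exp_pos t).le
  have he := Real.hasDerivAt_exp t
  have d0 := (hh.hasDerivAt ht).comp t he
  have d1 := (hh.smooth_deriv.hasDerivAt ht).comp t he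
  rw [iteratedDeriv_succ, iteratedDeriv_one, show deriv (profile n) = _ from
    funext (deriv_profile_eq hn)]
  refine (he.mul (d0.add (he.mul d1))).deriv.trans ?_
  simp only [Function.comp, Pi.add_apply, Pi.mul_apply]
  ring

theorem iteratedDeriv_three_profile_eq (hn : 1 ≤ n) (t : ℝ) :
    iteratedDeriv 3 (profile n) t = Real.exp t * potentialDeriv n (Real.exp t)
      + 7 * Real.exp t ^ 2 * deriv (potentialDeriv n) (Real.exp t)
      + 6 * Real.exp t ^ 3 * deriv (deriv (potentialDeriv n)) (Real.exp t)
      + Real.exp t ^ 4 * deriv (deriv (deriv (potentialDeriv n))) (Real.exp t) := by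
  have hh := smoothOnHalfLine_potentialDeriv hn
  have ht := (Real.exp_pos t).le
  have he := Real.hasDerivAt_exp t
  have d0 := (hh.hasDerivAt ht).comp t he
  have d1 := (hh.smooth_deriv.hasDerivAt ht).comp t he
  have d2 := (hh.smooth_deriv.smooth_deriv.hasDerivAt ht).comp t he
  rw [iteratedDeriv_succ, show iteratedDeriv 2 (profile n) = _ from
    funext (iteratedDeriv_two_profile_eq hn)]
  refine (((he.mul d0).add (((he.pow 2).const_mul 3).mul d1)).add
    ((he.pow 3).mul d2)).deriv.trans ?_
  simp only [Function.comp, Pi.pow_apply]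
  push_cast
  ring

end

noncomputable section

/-! ### The curvature tensor of a radial Kähler metric -/

variable {n : ℕ}

/-- The Sherman–Morrison formula, read off from `g⁻¹ g = 1` once the value of the inverse on the
radial eigenvector is known. -/
theorem gInv_radialMetric {h : ℝ → ℝ} (h0 : ∀ s, 0 ≤ s → 0 < h s)
    (h1 : ∀ s, 0 ≤ s → 0 < h s + s * deriv h s) (z : Cn n) (p q : Fin n) :
    gInv (radialMetric n h) z p q = (h (‖z‖ ^ 2) : ℂ)⁻¹ * ((if p = q then 1 else 0)
      - ((deriv h (‖z‖ ^ 2) : ℝ) : ℂ)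
        / ((h (‖z‖ ^ 2) + ‖z‖ ^ 2 * deriv h (‖z‖ ^ 2) : ℝ) : ℂ)
        * (z p * (starRingEnd ℂ) (z q))) := by
  have hs : 0 ≤ ‖z‖ ^ 2 := by positivity
  have hl : ((h (‖z‖ ^ 2) + ‖z‖ ^ 2 * deriv h (‖z‖ ^ 2) : ℝ) : ℂ) ≠ 0 := by
    exact_mod_cast (h1 _ hs).ne'
  have hl0 : (h (‖z‖ ^ 2) : ℂ) ≠ 0 := by exact_mod_cast (h0 _ hs).ne'
  have hu : IsUnit (radialMetric n h z).det :=
    (Matrix.isUnit_iff_isUnit_det _).1 (posDef_radialMetric h0 h1 z).isUnit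
  have hsum : gInv (radialMetric n h) z p q * (h (‖z‖ ^ 2) : ℂ)
      + (∑ k, gInv (radialMetric n h) z k q * (starRingEnd ℂ) (z k))
        * (((deriv h (‖z‖ ^ 2) : ℝ) : ℂ) * z p) = if p = q then 1 else 0 := by
    have e := congrFun (congrFun (Matrix.nonsing_inv_mul _ hu) q) p
    rw [Matrix.mul_apply, Matrix.one_apply] at e
    simp only [eq_comm (a := p)]
    rw [← e]
    simp only [radialMetric, mul_add, Finset.sum_add_distrib, gInv]
    congr 1
    · simp
    · rw [Finset.sum_mul]
      exact Finset.sum_congr rfl fun k _ => by ring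
  rw [sum_gInv_radialMetric h0 h1] at hsum
  rw [← hsum]
  field_simp
  ring

theorem sum_sum_rankOne (β : ℂ) (c : ℂ) (z : Cn n) (Y Z : Fin n → ℂ) :
    ∑ p, ∑ q, c * ((if p = q then 1 else 0) - β * (z p * (starRingEnd ℂ) (z q))) * Y q * Z p
      = c * (∑ p, Y p * Z p
        - β * ((∑ q, Y q * (starRingEnd ℂ) (z q)) * ∑ p, Z p * z p)) := by
  have e1 : ∑ p, ∑ q, c * ((if p = q then (1 : ℂ) else 0)) * Y q * Z p = c * ∑ p, Y p * Z p := by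
    rw [Finset.mul_sum]
    refine Finset.sum_congr rfl fun p _ => ?_
    simp [mul_assoc]
  have e2 : ∑ p, ∑ q, c * (β * (z p * (starRingEnd ℂ) (z q))) * Y q * Z p
      = c * (β * ((∑ q, Y q * (starRingEnd ℂ) (z q)) * ∑ p, Z p * z p)) := by
    rw [mul_comm (∑ q, Y q * (starRingEnd ℂ) (z q)), Finset.sum_mul_sum, Finset.mul_sum,
      Finset.mul_sum]
    refine Finset.sum_congr rfl fun p _ => ?_
    rw [Finset.mul_sum, Finset.mul_sum]
    exact Finset.sum_congr rfl fun q _ => by ring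
  rw [mul_sub, ← e1, ← e2, ← Finset.sum_sub_distrib]
  refine Finset.sum_congr rfl fun p _ => ?_
  rw [← Finset.sum_sub_distrib]
  exact Finset.sum_congr rfl fun q _ => by ring

/-- The coefficient of the mixed terms in the curvature of a radial metric. -/
def mixedCoeff (h : ℝ → ℝ) (s : ℝ) : ℝ := -deriv (deriv h) s + deriv h s ^ 2 / h s

/-- The coefficient of the purely radial term in the curvature of a radial metric. -/
def radialCoeff (h : ℝ → ℝ) (s : ℝ) : ℝ :=
  -deriv (deriv (deriv h)) s
    + (4 * deriv h s * deriv (deriv h) s + s * deriv (deriv h) s ^ 2) / h s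
    - deriv h s * (2 * deriv h s + s * deriv (deriv h) s) ^ 2 / (h s * (h s + s * deriv h s))

/-- By invariance the tensor is built from `δ` and `z̄ z` and has the Kähler symmetries in `i, k`
and in `j, l`. This leaves three coefficients. -/
theorem curv_radialMetric {h : ℝ → ℝ} (hh : SmoothOnHalfLine h) (h0 : ∀ s, 0 ≤ s → 0 < h s)
    (h1 : ∀ s, 0 ≤ s → 0 < h s + s * deriv h s) (z : Cn n) (i j k l : Fin n) :
    curv (radialMetric n h) z i j k l =
      -((deriv h (‖z‖ ^ 2) : ℝ) : ℂ) * ((if i = j then 1 else 0) * (if k = l then 1 else 0))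
      + -((deriv h (‖z‖ ^ 2) : ℝ) : ℂ) * ((if i = l then 1 else 0) * (if k = j then 1 else 0))
      + ((mixedCoeff h (‖z‖ ^ 2) : ℝ) : ℂ) *
        ((if i = j then 1 else 0) * ((starRingEnd ℂ) (z k) * z l))
      + ((mixedCoeff h (‖z‖ ^ 2) : ℝ) : ℂ) *
        ((if i = l then 1 else 0) * ((starRingEnd ℂ) (z k) * z j))
      + ((mixedCoeff h (‖z‖ ^ 2) : ℝ) : ℂ) *
        (((starRingEnd ℂ) (z i) * z l) * (if k = j then 1 else 0))
      + ((mixedCoeff h (‖z‖ ^ 2) : ℝ) : ℂ) *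
        (((starRingEnd ℂ) (z i) * z j) * (if k = l then 1 else 0))
      + ((radialCoeff h (‖z‖ ^ 2) : ℝ) : ℂ) *
        (((starRingEnd ℂ) (z i) * z j) * ((starRingEnd ℂ) (z k) * z l)) := by
  have hs : 0 ≤ ‖z‖ ^ 2 := by positivity
  have hl : ((h (‖z‖ ^ 2) + ‖z‖ ^ 2 * deriv h (‖z‖ ^ 2) : ℝ) : ℂ) ≠ 0 := by
    exact_mod_cast (h1 _ hs).ne'
  have hl0 : (h (‖z‖ ^ 2) : ℂ) ≠ 0 := by exact_mod_cast (h0 _ hs).ne'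
  have hn : ∑ p, z p * (starRingEnd ℂ) (z p) = ((‖z‖ ^ 2 : ℝ) : ℂ) :=
    (norm_sq_eq_sum_mul_conj z).symm
  have hn' : ∑ p, (starRingEnd ℂ) (z p) * z p = ((‖z‖ ^ 2 : ℝ) : ℂ) := by
    rw [← hn]; exact Finset.sum_congr rfl fun p _ => mul_comm _ _
  set Y : Fin n → ℂ := fun q => dz k (fun w => radialMetric n h w i q) z with hY
  set Z : Fin n → ℂ := fun p => dzbar l (fun w => radialMetric n h w p j) z with hZ
  have e1 : curv (radialMetric n h) z i j k l = -dz k (dzbar l (fun w => radialMetric n h w i j)) z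
      + ∑ p, ∑ q, (h (‖z‖ ^ 2) : ℂ)⁻¹ * ((if p = q then 1 else 0)
      - ((deriv h (‖z‖ ^ 2) : ℝ) : ℂ)
        / ((h (‖z‖ ^ 2) + ‖z‖ ^ 2 * deriv h (‖z‖ ^ 2) : ℝ) : ℂ)
        * (z p * (starRingEnd ℂ) (z q))) * Y q * Z p := by
    rw [curv]
    congr 1
    exact Finset.sum_congr rfl fun p _ => Finset.sum_congr rfl fun q _ => by
      rw [gInv_radialMetric h0 h1]
  have hYq : ∀ q, Y q = _ := fun q => (dz_radialMetric hh k i q z).dz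
  have hZp : ∀ p, Z p = _ := fun p => (dzbar_radialMetric hh l p j z).dzbar
  have eY : ∑ q, Y q * (starRingEnd ℂ) (z q)
      = (2 * ((deriv h (‖z‖ ^ 2) : ℝ) : ℂ) + ((deriv (deriv h) (‖z‖ ^ 2) : ℝ) : ℂ)
        * ((‖z‖ ^ 2 : ℝ) : ℂ)) * ((starRingEnd ℂ) (z i) * (starRingEnd ℂ) (z k)) := by
    rw [← hn]
    simp only [hYq, add_mul, mul_add, Finset.sum_add_distrib, mul_assoc, ← Finset.mul_sum,
      ite_mul, one_mul, zero_mul, Finset.sum_ite_eq, Finset.mem_univ, if_true]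
    ring
  have eZ : ∑ p, Z p * z p
      = (2 * ((deriv h (‖z‖ ^ 2) : ℝ) : ℂ) + ((deriv (deriv h) (‖z‖ ^ 2) : ℝ) : ℂ)
        * ((‖z‖ ^ 2 : ℝ) : ℂ)) * (z j * z l) := by
    rw [← hn']
    have : ∀ p, Z p * z p = ((deriv h (‖z‖ ^ 2) : ℝ) : ℂ) * z l * ((if p = j then 1 else 0) * z p)
        + ((deriv h (‖z‖ ^ 2) : ℝ) : ℂ) * z j * ((if l = p then 1 else 0) * z p)
        + ((deriv (deriv h) (‖z‖ ^ 2) : ℝ) : ℂ) * (z j * z l) * ((starRingEnd ℂ) (z p) * z p) :=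
      fun p => by rw [hZp]; ring
    simp only [this, Finset.sum_add_distrib, ← Finset.mul_sum,
      ite_mul, one_mul, zero_mul, Finset.sum_ite_eq, Finset.sum_ite_eq', Finset.mem_univ, if_true]
    ring
  have eYZ : ∑ p, Y p * Z p = ((deriv h (‖z‖ ^ 2) : ℝ) : ℂ) ^ 2 *
        ((if i = j then 1 else 0) * ((starRingEnd ℂ) (z k) * z l)
        + (if i = l then 1 else 0) * ((starRingEnd ℂ) (z k) * z j)
        + ((starRingEnd ℂ) (z i) * z l) * (if k = j then 1 else 0)
        + ((starRingEnd ℂ) (z i) * z j) * (if k = l then 1 else 0))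
      + (4 * ((deriv h (‖z‖ ^ 2) : ℝ) : ℂ) * ((deriv (deriv h) (‖z‖ ^ 2) : ℝ) : ℂ)
        + ((‖z‖ ^ 2 : ℝ) : ℂ) * ((deriv (deriv h) (‖z‖ ^ 2) : ℝ) : ℂ) ^ 2)
        * (((starRingEnd ℂ) (z i) * z j) * ((starRingEnd ℂ) (z k) * z l)) := by
    have : ∀ p, Y p * Z p = (if i = p then 1 else 0) *
          (((deriv h (‖z‖ ^ 2) : ℝ) : ℂ) * (starRingEnd ℂ) (z k) * Z p)
        + (if k = p then 1 else 0) *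
          (((deriv h (‖z‖ ^ 2) : ℝ) : ℂ) * (starRingEnd ℂ) (z i) * Z p)
        + ((deriv (deriv h) (‖z‖ ^ 2) : ℝ) : ℂ) *
          ((starRingEnd ℂ) (z k) * (starRingEnd ℂ) (z i)) * (Z p * z p) :=
      fun p => by rw [hYq]; ring
    have hδ : ∀ (a : Fin n) (f : Fin n → ℂ), ∑ p, (if a = p then 1 else 0) * f p = f a :=
      fun a f => by simp
    simp only [this, Finset.sum_add_distrib, hδ, ← Finset.mul_sum, eZ]
    rw [hZp, hZp]
    simp only [eq_comm (a := l)]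
    ring
  rw [e1, sum_sum_rankOne, eY, eZ, eYZ, dz_dzbar_radialMetric hh]
  simp only [eq_comm (a := l) (b := i)]
  rw [mixedCoeff, radialCoeff]
  push_cast at hl ⊢
  field_simp
  ring

theorem sum_four_mul (a c : Fin n → Fin n → ℂ) :
    ∑ i, ∑ j, ∑ k, ∑ l, a i j * c k l = (∑ i, ∑ j, a i j) * ∑ k, ∑ l, c k l := by
  rw [Finset.sum_mul]
  refine Finset.sum_congr rfl fun i _ => ?_
  rw [Finset.sum_mul]
  refine Finset.sum_congr rfl fun j _ => ?_
  rw [Finset.mul_sum]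
  exact Finset.sum_congr rfl fun k _ => (Finset.mul_sum _ _ _).symm

/-- Needed for the terms in which the Kähler symmetry pairs `i` with `l` and `k` with `j`. -/
theorem sum_four_mul_swap (a c : Fin n → Fin n → ℂ) :
    ∑ i, ∑ j, ∑ k, ∑ l, a i l * c k j = (∑ i, ∑ l, a i l) * ∑ k, ∑ j, c k j := by
  rw [← sum_four_mul]
  refine Finset.sum_congr rfl fun i _ => ?_
  calc ∑ j, ∑ k, ∑ l, a i l * c k j = ∑ j, ∑ l, ∑ k, a i l * c k j :=
        Finset.sum_congr rfl fun j _ => Finset.sum_comm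
    _ = ∑ l, ∑ j, ∑ k, a i l * c k j := Finset.sum_comm
    _ = ∑ l, ∑ k, ∑ j, a i l * c k j := Finset.sum_congr rfl fun l _ => Finset.sum_comm

/-- The curvature form `R(x, ȳ, u, t̄)`. -/
def curvForm (g : MetricField n) (z x y u t : Cn n) : ℂ :=
  ∑ i, ∑ j, ∑ k, ∑ l, curv g z i j k l
    * (x i * (starRingEnd ℂ) (y j) * (u k * (starRingEnd ℂ) (t l)))

/-- The summand of the contraction with the Kronecker delta. -/
def deltaTerm (x y : Cn n) (i j : Fin n) : ℂ :=
  (if i = j then 1 else 0) * (x i * (starRingEnd ℂ) (y j))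

/-- The summand of the contraction with the radial form. -/
def radialTerm (z x y : Cn n) (i j : Fin n) : ℂ :=
  ((starRingEnd ℂ) (z i) * z j) * (x i * (starRingEnd ℂ) (y j))

theorem sum_deltaTerm (x y : Cn n) : ∑ i, ∑ j, deltaTerm x y i j = hdot x y := by
  simp [hdot, deltaTerm]

theorem sum_radialTerm (z x y : Cn n) :
    ∑ i, ∑ j, radialTerm z x y i j = hdot x z * hdot z y := by
  rw [hdot, hdot, Finset.sum_mul_sum]
  refine Finset.sum_congr rfl fun i _ => Finset.sum_congr rfl fun j _ => ?_
  rw [radialTerm]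
  ring

theorem curvForm_radialMetric {h : ℝ → ℝ} (hh : SmoothOnHalfLine h) (h0 : ∀ s, 0 ≤ s → 0 < h s)
    (h1 : ∀ s, 0 ≤ s → 0 < h s + s * deriv h s) (z x y u t : Cn n) :
    curvForm (radialMetric n h) z x y u t =
      -((deriv h (‖z‖ ^ 2) : ℝ) : ℂ) * (hdot x y * hdot u t)
      + -((deriv h (‖z‖ ^ 2) : ℝ) : ℂ) * (hdot x t * hdot u y)
      + ((mixedCoeff h (‖z‖ ^ 2) : ℝ) : ℂ) * (hdot x y * (hdot u z * hdot z t))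
      + ((mixedCoeff h (‖z‖ ^ 2) : ℝ) : ℂ) * (hdot x t * (hdot u z * hdot z y))
      + ((mixedCoeff h (‖z‖ ^ 2) : ℝ) : ℂ) * ((hdot x z * hdot z t) * hdot u y)
      + ((mixedCoeff h (‖z‖ ^ 2) : ℝ) : ℂ) * ((hdot x z * hdot z y) * hdot u t)
      + ((radialCoeff h (‖z‖ ^ 2) : ℝ) : ℂ)
        * ((hdot x z * hdot z y) * (hdot u z * hdot z t)) := by
  rw [← sum_radialTerm z x y, ← sum_radialTerm z u t, ← sum_radialTerm z u y,
    ← sum_radialTerm z x t, ← sum_deltaTerm x y, ← sum_deltaTerm u t, ← sum_deltaTerm u y,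
    ← sum_deltaTerm x t,
    ← sum_four_mul (deltaTerm x y) (deltaTerm u t),
    ← sum_four_mul_swap (deltaTerm x t) (deltaTerm u y),
    ← sum_four_mul (deltaTerm x y) (radialTerm z u t),
    ← sum_four_mul_swap (deltaTerm x t) (radialTerm z u y),
    ← sum_four_mul_swap (radialTerm z x t) (deltaTerm u y),
    ← sum_four_mul (radialTerm z x y) (deltaTerm u t),
    ← sum_four_mul (radialTerm z x y) (radialTerm z u t)]
  simp only [Finset.mul_sum, ← Finset.sum_add_distrib, curvForm]
  refine Finset.sum_congr rfl fun i _ => Finset.sum_congr rfl fun j _ =>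
    Finset.sum_congr rfl fun k _ => Finset.sum_congr rfl fun l _ => ?_
  rw [curv_radialMetric hh h0 h1]
  simp only [deltaTerm, radialTerm]
  ring

theorem sum_curv_eq_curvForm (g : MetricField n) (z v w : Cn n) :
    ∑ i, ∑ j, ∑ k, ∑ l, curv g z i j k l
      * (v i * (starRingEnd ℂ) (w j) - w i * (starRingEnd ℂ) (v j))
      * (w k * (starRingEnd ℂ) (v l) - v k * (starRingEnd ℂ) (w l))
    = curvForm g z v w w v - curvForm g z v w v w - curvForm g z w v w v
      + curvForm g z w v v w := by
  simp only [curvForm, ← Finset.sum_sub_distrib, ← Finset.sum_add_distrib]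
  refine Finset.sum_congr rfl fun i _ => Finset.sum_congr rfl fun j _ =>
    Finset.sum_congr rfl fun k _ => Finset.sum_congr rfl fun l _ => ?_
  ring

end

noncomputable section

/-! ### Positivity of the sectional curvature -/

variable {n : ℕ}

theorem hdot_combination (x y : ℝ) (v w u : Cn n) :
    hdot (x • v + y • w) u = x * hdot v u + y * hdot w u := by
  simp only [hdot, Finset.mul_sum, ← Finset.sum_add_distrib]
  refine Finset.sum_congr rfl fun i _ => ?_
  simp
  ring

theorem hdot_combination_right (x y : ℝ) (u v w : Cn n) :
    hdot u (x • v + y • w) = x * hdot u v + y * hdot u w := by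
  rw [← conj_hdot, hdot_combination, map_add, map_mul, map_mul, conj_hdot, conj_hdot,
    Complex.conj_ofReal, Complex.conj_ofReal]

theorem hdot_sub_smul (v w z : Cn n) (c : ℂ) : hdot (v - c • z) w = hdot v w - c * hdot z w := by
  simp only [hdot, Finset.mul_sum, ← Finset.sum_sub_distrib]
  refine Finset.sum_congr rfl fun i _ => ?_
  simp
  ring

theorem normSq_combination (x y : ℝ) (a b : ℂ) :
    ‖(x : ℂ) * a + y * b‖ ^ 2 = x ^ 2 * ‖a‖ ^ 2 + 2 * x * y * (a * (starRingEnd ℂ) b).re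
      + y ^ 2 * ‖b‖ ^ 2 := by
  simp only [Complex.sq_norm, Complex.normSq_apply, Complex.add_re, Complex.add_im, Complex.mul_re,
    Complex.mul_im, Complex.ofReal_re, Complex.ofReal_im, Complex.conj_re, Complex.conj_im]
  ring

theorem norm_sq_combination (x y : ℝ) (v w : Cn n) :
    ‖x • v + y • w‖ ^ 2 = x ^ 2 * ‖v‖ ^ 2 + 2 * x * y * (hdot v w).re + y ^ 2 * ‖w‖ ^ 2 := by
  have h : hdot (x • v + y • w) (x • v + y • w)
      = ((x ^ 2 * ‖v‖ ^ 2 + y ^ 2 * ‖w‖ ^ 2 : ℝ) : ℂ)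
        + (x * y : ℝ) * (hdot v w + (starRingEnd ℂ) (hdot v w)) := by
    rw [hdot_combination, hdot_combination_right, hdot_combination_right, conj_hdot, hdot_self,
      hdot_self]
    push_cast
    ring
  have h2 := congrArg Complex.re h
  rw [hdot_self, Complex.ofReal_re, Complex.add_re, Complex.ofReal_re, Complex.add_conj,
    ← Complex.ofReal_mul, Complex.ofReal_re] at h2
  rw [h2]
  ring

/-- A positive definite binary quadratic form has positive determinant. -/
theorem det_pos_of_binary_form_pos {P Q R : ℝ}
    (h : ∀ x y : ℝ, (x ≠ 0 ∨ y ≠ 0) → 0 < x ^ 2 * P + 2 * x * y * Q + y ^ 2 * R) :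
    0 < P * R - Q ^ 2 := by
  have hR : 0 < R := by simpa using h 0 1 (by simp)
  -- At `(R, -Q)` the form takes the value `R (PR - Q²)`.
  have := h R (-Q) (Or.inl hR.ne')
  refine pos_of_mul_pos_right (b := P * R - Q ^ 2) (a := R) ?_ hR.le
  refine this.trans_eq ?_
  ring

theorem combination_ne_zero {v w : Cn n} (h : LinearIndependent ℝ ![v, w]) {x y : ℝ}
    (hxy : x ≠ 0 ∨ y ≠ 0) : x • v + y • w ≠ 0 := fun h0 => by
  have := LinearIndependent.pair_iff.1 h x y h0
  rcases hxy with hx | hy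
  · exact hx this.1
  · exact hy this.2

theorem re_hdot_sq_lt {v w : Cn n} (h : LinearIndependent ℝ ![v, w]) :
    (hdot v w).re ^ 2 < ‖v‖ ^ 2 * ‖w‖ ^ 2 := by
  rw [← sub_pos]
  refine det_pos_of_binary_form_pos fun x y hxy => ?_
  rw [← norm_sq_combination]
  have := norm_pos_iff.2 (combination_ne_zero h hxy)
  positivity

theorem realInner_radialMetric' (h : ℝ → ℝ) (z v w : Cn n) :
    realInner (radialMetric n h) z v w = h (‖z‖ ^ 2) * (hdot v w).re
      + deriv h (‖z‖ ^ 2) * (hdot v z * (starRingEnd ℂ) (hdot w z)).re := by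
  rw [realInner, herm_radialMetric, conj_hdot, Complex.add_re, Complex.re_ofReal_mul,
    Complex.re_ofReal_mul]

/-- The Gram determinant belongs to the binary form `(x, y) ↦ |xv + yw|²` of the metric, which is
positive definite for independent `v, w`. -/
theorem gram_det_pos {h : ℝ → ℝ} (h0 : ∀ s, 0 ≤ s → 0 < h s)
    (h1 : ∀ s, 0 ≤ s → 0 < h s + s * deriv h s) (z : Cn n) {v w : Cn n}
    (hvw : LinearIndependent ℝ ![v, w]) :
    0 < realInner (radialMetric n h) z v v * realInner (radialMetric n h) z w w
      - realInner (radialMetric n h) z v w ^ 2 := by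
  refine det_pos_of_binary_form_pos fun x y hxy => ?_
  have hs : 0 ≤ ‖z‖ ^ 2 := by positivity
  have hv := norm_pos_iff.2 (combination_ne_zero hvw hxy)
  have := radial_form_pos (h0 _ hs) (h1 _ hs) (x := ‖x • v + y • w‖ ^ 2) (by positivity)
    (by positivity) (norm_hdot_sq_le (x • v + y • w) z)
  refine this.trans_eq ?_
  rw [norm_sq_combination, hdot_combination, normSq_combination, realInner_radialMetric,
    realInner_radialMetric, realInner_radialMetric']
  ring

/-- The Cauchy-Schwarz inequality for the components orthogonal to `z`. -/
theorem orthogonal_cauchy_schwarz (v w : Cn n) {z : Cn n} (hz : z ≠ 0) :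
    0 ≤ ‖v‖ ^ 2 - ‖hdot v z‖ ^ 2 / ‖z‖ ^ 2 ∧
    ‖hdot v w - hdot v z * (starRingEnd ℂ) (hdot w z) / ((‖z‖ ^ 2 : ℝ) : ℂ)‖ ^ 2
      ≤ (‖v‖ ^ 2 - ‖hdot v z‖ ^ 2 / ‖z‖ ^ 2) * (‖w‖ ^ 2 - ‖hdot w z‖ ^ 2 / ‖z‖ ^ 2) := by
  have hs : (0 : ℝ) < ‖z‖ ^ 2 := by have := norm_pos_iff.2 hz; positivity
  have hs' : ((‖z‖ ^ 2 : ℝ) : ℂ) ≠ 0 := by exact_mod_cast hs.ne'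
  have key : ∀ v w : Cn n, hdot (v - (hdot v z / ((‖z‖ ^ 2 : ℝ) : ℂ)) • z)
      (w - (hdot w z / ((‖z‖ ^ 2 : ℝ) : ℂ)) • z)
      = hdot v w - hdot v z * (starRingEnd ℂ) (hdot w z) / ((‖z‖ ^ 2 : ℝ) : ℂ) := fun v w => by
    rw [hdot_sub_smul, ← conj_hdot _ v, ← conj_hdot _ z, hdot_sub_smul, hdot_sub_smul,
      hdot_self, map_sub, map_sub, map_mul, map_mul, map_div₀, Complex.conj_ofReal, conj_hdot w v,
      conj_hdot z v, conj_hdot w z]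
    field_simp
    ring
  have hn : ∀ v : Cn n, ‖v - (hdot v z / ((‖z‖ ^ 2 : ℝ) : ℂ)) • z‖ ^ 2
      = ‖v‖ ^ 2 - ‖hdot v z‖ ^ 2 / ‖z‖ ^ 2 := fun v => by
    have h := key v v
    rw [hdot_self, hdot_self, Complex.mul_conj, Complex.normSq_eq_norm_sq] at h
    exact_mod_cast h
  rw [← key v w, ← hn v, ← hn w]
  exact ⟨by positivity, norm_hdot_sq_le _ _⟩

/-- The real number to which the curvature form contracts, in terms of the components of `v, w`
along and orthogonal to `z`. -/
theorem curvature_positivity {A B C α β V W x₁ y₁ x₂ y₂ : ℝ} (hA : 0 < A) (hB : 0 < B)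
    (hC : 0 < C) (hα : 0 ≤ α) (hβ : 0 ≤ β) (hV : 0 ≤ V) (hW : 0 ≤ W)
    (h1 : α * β = x₁ ^ 2 + y₁ ^ 2) (h2 : x₂ ^ 2 + y₂ ^ 2 ≤ V * W)
    (h3 : (x₁ + x₂) ^ 2 < (α + V) * (β + W))
    (h4 : B ^ 2 < 2 * A * C ∨ V = 0 ∧ W = 0) :
    0 < 4 * A * y₁ ^ 2 + 8 * B * y₁ * y₂ + 2 * B * (α * W + β * V - 2 * (x₁ * x₂ - y₁ * y₂))
      + C * (4 * y₂ ^ 2 + 2 * V * W - 2 * (x₂ ^ 2 - y₂ ^ 2)) := by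
  -- By the arithmetic-geometric mean, `αW + βV ≥ 2 √(αβVW)`. This dominates twice the real part of
  -- the product of `x₁ + iy₁` and `x₂ + iy₂`.
  have hT1 : 0 ≤ α * W + β * V - 2 * (x₁ * x₂ - y₁ * y₂) := by
    rw [sub_nonneg]
    refine le_of_abs_le (abs_le_of_sq_le_sq ?_ (by positivity))
    have e1 : 4 * ((x₁ ^ 2 + y₁ ^ 2) * (x₂ ^ 2 + y₂ ^ 2)) ≤ 4 * (α * β * (V * W)) := by
      rw [h1]
      have : 0 ≤ x₁ ^ 2 + y₁ ^ 2 := by positivity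
      nlinarith
    nlinarith [sq_nonneg (α * W - β * V), sq_nonneg (x₁ * y₂ + x₂ * y₁)]
  have hT2 : 0 ≤ V * W - x₂ ^ 2 - y₂ ^ 2 := by linarith
  have e : 4 * A * y₁ ^ 2 + 8 * B * y₁ * y₂ + 2 * B * (α * W + β * V - 2 * (x₁ * x₂ - y₁ * y₂))
      + C * (4 * y₂ ^ 2 + 2 * V * W - 2 * (x₂ ^ 2 - y₂ ^ 2))
      = 4 * (A * y₁ ^ 2 + 2 * B * y₁ * y₂ + 2 * C * y₂ ^ 2)
        + 2 * B * (α * W + β * V - 2 * (x₁ * x₂ - y₁ * y₂))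
        + 2 * C * (V * W - x₂ ^ 2 - y₂ ^ 2) := by ring
  rw [e]
  have hb1 := mul_nonneg hB.le hT1
  have hb2 := mul_nonneg hC.le hT2
  by_cases hy : y₁ = 0 ∧ y₂ = 0
  · obtain ⟨rfl, rfl⟩ := hy
    -- With vanishing imaginary parts the sum of both Cauchy–Schwarz defects is the strict real one
    -- of `h3`, so at least one of them is positive.
    have hsum : 0 < (α * W + β * V - 2 * (x₁ * x₂ - 0 * 0)) + (V * W - x₂ ^ 2 - 0 ^ 2) := by
      nlinarith
    rcases hT1.lt_or_eq with h | h
    · have := mul_pos hB h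
      nlinarith
    · rw [← h, zero_add] at hsum
      have := mul_pos hC hsum
      nlinarith
  -- The form in `(y₁, y₂)` is positive definite exactly when `B² < 2AC`. In the alternative `V = W
  -- = 0` the variable `y₂` vanishes and `A > 0` suffices.
  · have hq : 0 < A * y₁ ^ 2 + 2 * B * y₁ * y₂ + 2 * C * y₂ ^ 2 := by
      have hz : V = 0 ∧ W = 0 → y₂ = 0 := fun h => by
        rw [h.1, zero_mul] at h2
        have : y₂ ^ 2 = 0 := le_antisymm (by nlinarith [sq_nonneg x₂]) (sq_nonneg _)
        exact pow_eq_zero_iff (two_ne_zero) |>.1 this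
      rcases h4 with h4 | h4
      · rcases eq_or_ne y₂ 0 with h0 | h0
        · have : y₁ ≠ 0 := fun h => hy ⟨h, h0⟩
          subst h0
          have : 0 < A * y₁ ^ 2 := by positivity
          nlinarith
        · have : 0 < y₂ ^ 2 * (2 * A * C - B ^ 2) := mul_pos (by positivity) (sub_pos.2 h4)
          refine pos_of_mul_pos_right (a := A) ?_ hA.le
          nlinarith [sq_nonneg (A * y₁ + B * y₂)]
      · have h0 := hz h4
        have : y₁ ≠ 0 := fun h => hy ⟨h, h0⟩
        subst h0
        have : 0 < A * y₁ ^ 2 := by positivity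
        nlinarith
    linarith

/-- Here `p = ⟨v, w⟩`, `a = ⟨v, z⟩`, `b = ⟨w, z⟩`, `V = |v|²`, `W = |w|²`. The right side regroups
the contraction by the radial part `a b̄ / s` and the orthogonal part `p - a b̄ / s` of `p`, with `A
= 2C + 4sm + s²e` and `B = C + sm`, as `curvature_positivity` requires. -/
theorem curvature_contraction {p a b : ℂ} {C m e V W s : ℝ} (hs : s ≠ 0) :
    ((C * (p * (starRingEnd ℂ) p) + C * ((V : ℂ) * W)
        + m * (p * (b * (starRingEnd ℂ) a)) + m * (V * (b * (starRingEnd ℂ) b))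
        + m * ((a * (starRingEnd ℂ) a) * W) + m * ((a * (starRingEnd ℂ) b) * (starRingEnd ℂ) p)
        + e * ((a * (starRingEnd ℂ) b) * (b * (starRingEnd ℂ) a)))
      - (C * (p * p) + C * (p * p)
        + m * (p * (a * (starRingEnd ℂ) b)) + m * (p * (a * (starRingEnd ℂ) b))
        + m * ((a * (starRingEnd ℂ) b) * p) + m * ((a * (starRingEnd ℂ) b) * p)
        + e * ((a * (starRingEnd ℂ) b) * (a * (starRingEnd ℂ) b)))
      - (C * ((starRingEnd ℂ) p * (starRingEnd ℂ) p) + C * ((starRingEnd ℂ) p * (starRingEnd ℂ) p)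
        + m * ((starRingEnd ℂ) p * (b * (starRingEnd ℂ) a))
        + m * ((starRingEnd ℂ) p * (b * (starRingEnd ℂ) a))
        + m * ((b * (starRingEnd ℂ) a) * (starRingEnd ℂ) p)
        + m * ((b * (starRingEnd ℂ) a) * (starRingEnd ℂ) p)
        + e * ((b * (starRingEnd ℂ) a) * (b * (starRingEnd ℂ) a)))
      + (C * ((starRingEnd ℂ) p * p) + C * ((W : ℂ) * V)
        + m * ((starRingEnd ℂ) p * (a * (starRingEnd ℂ) b)) + m * (W * (a * (starRingEnd ℂ) a))
        + m * ((b * (starRingEnd ℂ) b) * V) + m * ((b * (starRingEnd ℂ) a) * p)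
        + e * ((b * (starRingEnd ℂ) a) * (a * (starRingEnd ℂ) b)))).re
    = 4 * (2 * C + 4 * s * m + s ^ 2 * e) * ((a * (starRingEnd ℂ) b).im / s) ^ 2
      + 8 * (C + s * m) * ((a * (starRingEnd ℂ) b).im / s)
        * (p - a * (starRingEnd ℂ) b / s).im
      + 2 * (C + s * m) * (‖a‖ ^ 2 / s * (W - ‖b‖ ^ 2 / s) + ‖b‖ ^ 2 / s * (V - ‖a‖ ^ 2 / s)
        - 2 * ((a * (starRingEnd ℂ) b).re / s * (p - a * (starRingEnd ℂ) b / s).re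
          - (a * (starRingEnd ℂ) b).im / s * (p - a * (starRingEnd ℂ) b / s).im))
      + C * (4 * (p - a * (starRingEnd ℂ) b / s).im ^ 2
        + 2 * (V - ‖a‖ ^ 2 / s) * (W - ‖b‖ ^ 2 / s)
        - 2 * ((p - a * (starRingEnd ℂ) b / s).re ^ 2
          - (p - a * (starRingEnd ℂ) b / s).im ^ 2)) := by
  obtain ⟨p₁, p₂⟩ := p
  obtain ⟨a₁, a₂⟩ := a
  obtain ⟨b₁, b₂⟩ := b
  simp only [Complex.sq_norm, Complex.normSq_apply, Complex.add_re, Complex.sub_re, Complex.mul_re,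
    Complex.mul_im, Complex.ofReal_re, Complex.ofReal_im, Complex.conj_re, Complex.conj_im,
    Complex.sub_im, Complex.div_ofReal_re, Complex.div_ofReal_im]
  field_simp
  ring

/-- With `s = e^t` the three coefficients satisfy `s² C = φ - φ'`, `s² φ B = (φ')² - φφ''` and `s²
φ' A = (φ'')² - φ'φ'''`. -/
theorem solitonMetric_curvature_coeffs (hn : 1 ≤ n) {s : ℝ} (hs : 0 < s) :
    0 < -deriv (potentialDeriv n) s ∧
    0 < -deriv (potentialDeriv n) s + s * mixedCoeff (potentialDeriv n) s ∧
    0 < 2 * -deriv (potentialDeriv n) s + 4 * s * mixedCoeff (potentialDeriv n) s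
      + s ^ 2 * radialCoeff (potentialDeriv n) s ∧
    (2 ≤ n → (-deriv (potentialDeriv n) s + s * mixedCoeff (potentialDeriv n) s) ^ 2
      < 2 * (2 * -deriv (potentialDeriv n) s + 4 * s * mixedCoeff (potentialDeriv n) s
      + s ^ 2 * radialCoeff (potentialDeriv n) s) * -deriv (potentialDeriv n) s) := by
  obtain ⟨t, rfl⟩ : ∃ t, Real.exp t = s := ⟨Real.log s, Real.exp_log hs⟩
  obtain ⟨hC, hB, hA, hD⟩ := profile_curvature_inequalities hn t
  have hφ := profile_pos hn t
  have hφ' := (isProfile_profile hn).deriv_pos t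
  have h0 := potentialDeriv_pos n (Real.exp t)
  have hl := radial_eigenvalue_pos hn _ hs.le
  have eC : Real.exp t ^ 2 * -deriv (potentialDeriv n) (Real.exp t)
      = profile n t - deriv (profile n) t := by
    rw [deriv_profile_eq hn, ← exp_mul_potentialDeriv hn]
    ring
  have eB : Real.exp t ^ 2 * profile n t * (-deriv (potentialDeriv n) (Real.exp t)
      + Real.exp t * mixedCoeff (potentialDeriv n) (Real.exp t))
      = deriv (profile n) t ^ 2 - profile n t * iteratedDeriv 2 (profile n) t := by
    rw [deriv_profile_eq hn, ← exp_mul_potentialDeriv hn, iteratedDeriv_two_profile_eq hn,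
      mixedCoeff]
    field_simp
    ring
  have eA : Real.exp t ^ 2 * deriv (profile n) t * (2 * -deriv (potentialDeriv n) (Real.exp t)
      + 4 * Real.exp t * mixedCoeff (potentialDeriv n) (Real.exp t)
      + Real.exp t ^ 2 * radialCoeff (potentialDeriv n) (Real.exp t))
      = iteratedDeriv 2 (profile n) t ^ 2 - deriv (profile n) t * iteratedDeriv 3 (profile n) t := by
    rw [deriv_profile_eq hn, iteratedDeriv_two_profile_eq hn, iteratedDeriv_three_profile_eq hn,
      mixedCoeff, radialCoeff]
    field_simp
    ring
  rw [← eC] at hC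
  rw [← eB] at hB
  rw [← eA] at hA
  refine ⟨pos_of_mul_pos_right hC (by positivity), pos_of_mul_pos_right hB (by positivity),
    pos_of_mul_pos_right hA (by positivity), fun h2 => ?_⟩
  have := hD h2
  rw [← eA, ← eB, ← eC] at this
  have hp : 0 < Real.exp t ^ 4 * profile n t ^ 2 * deriv (profile n) t := by positivity
  refine lt_of_mul_lt_mul_left ?_ hp.le
  refine lt_of_eq_of_lt ?_ (this.trans_eq ?_) <;> ring

theorem hdot_one_dim (v w z : Cn 1) :
    hdot v z * (starRingEnd ℂ) (hdot w z) = hdot v w * ((‖z‖ ^ 2 : ℝ) : ℂ) := by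
  rw [← hdot_self]
  simp [hdot]
  ring

theorem curvature_numerator_pos (hn : 1 ≤ n) (z : Cn n) {v w : Cn n}
    (hvw : LinearIndependent ℝ ![v, w]) :
    0 < (∑ i, ∑ j, ∑ k, ∑ l, curv (solitonMetric n) z i j k l
      * (v i * (starRingEnd ℂ) (w j) - w i * (starRingEnd ℂ) (v j))
      * (w k * (starRingEnd ℂ) (v l) - v k * (starRingEnd ℂ) (w l))).re := by
  have hcs := re_hdot_sq_lt hvw
  have hcf := curvForm_radialMetric (n := n) (smoothOnHalfLine_potentialDeriv hn)
    (fun s _ => potentialDeriv_pos n s) (radial_eigenvalue_pos hn)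
  rw [sum_curv_eq_curvForm, solitonMetric, hcf, hcf, hcf, hcf, ← conj_hdot v w, ← conj_hdot v z,
    ← conj_hdot w z, hdot_self, hdot_self, ← Complex.ofReal_neg]
  rcases eq_or_ne z 0 with rfl | hz
  · have hC : 0 < -deriv (potentialDeriv n) (‖(0 : Cn n)‖ ^ 2) :=
      neg_pos.2 (deriv_potentialDeriv_neg hn (by positivity))
    have e0 : ∀ u : Cn n, hdot u 0 = 0 := fun u => by simp [hdot]
    simp only [e0, map_zero, mul_zero, zero_mul, add_zero]
    have h2 := norm_hdot_sq_le v w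
    rw [Complex.sq_norm, Complex.normSq_apply] at h2
    -- At the origin there is no radial part, and only the coefficient `C` occurs. Taking it for `A`
    -- and `B` too satisfies `B² < 2AC` trivially.
    have := curvature_positivity (α := 0) (β := 0) (x₁ := 0) (y₁ := 0) (V := ‖v‖ ^ 2)
      (W := ‖w‖ ^ 2) (x₂ := (hdot v w).re) (y₂ := (hdot v w).im) hC hC hC le_rfl le_rfl
      (by positivity) (by positivity) (by norm_num) (by nlinarith) (by simpa using hcs)
      (Or.inl (by nlinarith [mul_pos hC hC]))
    refine this.trans_eq ?_
    simp only [Complex.add_re, Complex.sub_re, Complex.mul_re, Complex.mul_im, Complex.conj_re,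
      Complex.conj_im, Complex.ofReal_re, Complex.ofReal_im]
    ring
  · have hs : (0 : ℝ) < ‖z‖ ^ 2 := by have := norm_pos_iff.2 hz; positivity
    obtain ⟨hC, hB, hA, hD⟩ := solitonMetric_curvature_coeffs hn hs
    rw [curvature_contraction hs.ne']
    obtain ⟨hV, hVW⟩ := orthogonal_cauchy_schwarz v w hz
    obtain ⟨hW, -⟩ := orthogonal_cauchy_schwarz w v hz
    apply curvature_positivity hA hB hC (by positivity) (by positivity) hV hW
    · have h := congrArg (fun x : ℝ => x / (‖z‖ ^ 2) ^ 2)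
        (show ‖hdot v z * (starRingEnd ℂ) (hdot w z)‖ ^ 2 = ‖hdot v z‖ ^ 2 * ‖hdot w z‖ ^ 2 by
          rw [norm_mul, mul_pow, RCLike.norm_conj])
      rw [Complex.sq_norm, Complex.normSq_apply] at h
      field_simp at h ⊢
      linarith
    · rw [Complex.sq_norm, Complex.normSq_apply] at hVW
      refine le_trans (le_of_eq ?_) hVW
      ring
    · refine lt_of_eq_of_lt ?_ (hcs.trans_eq ?_)
      · rw [Complex.sub_re, Complex.div_ofReal_re]
        ring
      · ring
    -- For `n = 1` nothing is orthogonal to `z`, so the second alternative of the last hypothesis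
    -- holds.
    · rcases hn.eq_or_lt with rfl | h2
      · right
        have e : ∀ v : Cn 1, ‖v‖ ^ 2 - ‖hdot v z‖ ^ 2 / ‖z‖ ^ 2 = 0 := fun v => by
          have h := hdot_one_dim v v z
          rw [Complex.mul_conj, Complex.normSq_eq_norm_sq, hdot_self] at h
          have h : ‖hdot v z‖ ^ 2 = ‖v‖ ^ 2 * ‖z‖ ^ 2 := by exact_mod_cast h
          rw [h, mul_div_assoc, div_self hs.ne', mul_one, sub_self]
        exact ⟨e v, e w⟩
      · exact Or.inl (hD h2)

theorem hasPositiveSectionalCurvature_solitonMetric (hn : 1 ≤ n) :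
    HasPositiveSectionalCurvature (solitonMetric n) := by
  intro z v w hvw
  refine div_pos (mul_pos (by norm_num) (curvature_numerator_pos hn z hvw)) ?_
  exact gram_det_pos (fun s _ => potentialDeriv_pos n s) (radial_eigenvalue_pos hn) z hvw

end

noncomputable section

/-! ### The Riemannian distance -/

variable {n : ℕ}

theorem realInner_smul_smul (g : MetricField n) (z v : Cn n) (c : ℝ) :
    realInner g z (c • v) (c • v) = c ^ 2 * realInner g z v v := by
  have : herm g z (c • v) (c • v) = ((c ^ 2 : ℝ) : ℂ) * herm g z v v := by
    simp only [herm, Finset.mul_sum]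
    refine Finset.sum_congr rfl fun i _ => Finset.sum_congr rfl fun j _ => ?_
    simp
    ring
  rw [realInner, this, Complex.re_ofReal_mul, realInner]

theorem tangentLength_smul (g : MetricField n) (z v : Cn n) (c : ℝ) :
    tangentLength g z (c • v) = ‖c‖ₑ * tangentLength g z v := by
  rw [tangentLength, realInner_smul_smul, Real.sqrt_mul (sq_nonneg c), Real.sqrt_sq_eq_abs,
    ENNReal.ofReal_mul (abs_nonneg c), tangentLength, ← Real.norm_eq_abs, ofReal_norm]

theorem eNormSMulClass_tangentENorm (g : MetricField n) (z : Cn n) :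
    @ENormSMulClass ℝ (TangentSpace 𝓘(ℝ, Cn n) z) _ (tangentENorm g z) _ :=
  @ENormSMulClass.mk ℝ (TangentSpace 𝓘(ℝ, Cn n) z) _ (tangentENorm g z) _
    fun c v => tangentLength_smul g z v c

theorem gDist_triangle (g : MetricField n) (x y z : Cn n) :
    gDist g x z ≤ gDist g x y + gDist g y z := by
  let := tangentENorm g
  have := eNormSMulClass_tangentENorm g
  exact Manifold.riemannianEDist_triangle (I := 𝓘(ℝ, Cn n))

theorem pathELength_tangentENorm (g : MetricField n) (γ : ℝ → Cn n) (a b : ℝ) :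
    @Manifold.pathELength (Cn n) _ _ (Cn n) _ 𝓘(ℝ, Cn n) (Cn n) _ _ (tangentENorm g) γ a b
      = ∫⁻ t in Set.Icc a b, tangentLength g (γ t) (deriv γ t) := by
  let := tangentENorm g
  rw [Manifold.pathELength_eq_lintegral_mfderiv_Icc]
  refine MeasureTheory.lintegral_congr fun t => ?_
  rw [mfderiv_eq_fderiv]
  rfl

theorem gDist_le_lintegral (g : MetricField n) {γ : ℝ → Cn n} (hγ : ContDiff ℝ 1 γ) :
    gDist g (γ 0) (γ 1) ≤ ∫⁻ t in Set.Icc (0 : ℝ) 1, tangentLength g (γ t) (deriv γ t) := by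
  let := tangentENorm g
  have := eNormSMulClass_tangentENorm g
  rw [← pathELength_tangentENorm]
  exact Manifold.riemannianEDist_le_pathELength (I := 𝓘(ℝ, Cn n))
    (contMDiff_iff_contDiff.2 hγ).contMDiffOn rfl rfl zero_le_one

theorem exists_path_of_gDist_lt (g : MetricField n) {x y : Cn n} {r : ℝ≥0∞}
    (h : gDist g x y < r) : ∃ γ : ℝ → Cn n, γ 0 = x ∧ γ 1 = y ∧
      ContDiffOn ℝ 1 γ (Set.Icc 0 1) ∧
      ∫⁻ t in Set.Icc (0 : ℝ) 1, tangentLength g (γ t) (deriv γ t) < r := by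
  let := tangentENorm g
  obtain ⟨γ, h0, h1, hγ, hr⟩ := Manifold.exists_lt_of_riemannianEDist_lt (I := 𝓘(ℝ, Cn n)) h
  refine ⟨γ, h0, h1, contMDiffOn_iff_contDiffOn.1 hγ, ?_⟩
  rw [← pathELength_tangentENorm]
  exact hr

/-- A metric bounded above by the Euclidean one has a smaller distance. -/
theorem gDist_le_of_tangentLength_le {g : MetricField n}
    (hg : ∀ z v, tangentLength g z v ≤ ENNReal.ofReal ‖v‖) (x y : Cn n) :
    gDist g x y ≤ ENNReal.ofReal ‖y - x‖ := by
  have hγ : ContDiff ℝ 1 (fun t : ℝ => x + t • (y - x)) := by fun_prop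
  have hd : ∀ t, deriv (fun t : ℝ => x + t • (y - x)) t = y - x := fun t => by
    have := ((hasDerivAt_id t).smul_const (y - x)).const_add x
    simpa using this.deriv
  have := gDist_le_lintegral g hγ
  simp only [hd, zero_smul, add_zero, one_smul, add_sub_cancel] at this
  refine this.trans ((MeasureTheory.lintegral_mono fun t => hg _ _).trans ?_)
  simp

/-- A function whose derivative is bounded by the length of tangent vectors is Lipschitz for the
Riemannian distance. -/
theorem enorm_sub_le_of_gDist_lt {g : MetricField n} {ρ : Cn n → ℝ} (hρ : ContDiff ℝ 1 ρ)
    {K : ℝ≥0∞} (hg : ∀ z v, ‖fderiv ℝ ρ z v‖ₑ ≤ K * tangentLength g z v) (hK : K ≠ ⊤)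
    {x y : Cn n} {r : ℝ≥0∞} (h : gDist g x y < r) : ‖ρ y - ρ x‖ₑ ≤ K * r := by
  obtain ⟨γ, rfl, rfl, hγ, hr⟩ := exists_path_of_gDist_lt g h
  have h1 := enorm_sub_le_lintegral_deriv_of_contDiffOn_Icc
    (hρ.comp_contDiffOn hγ) zero_le_one
  refine h1.trans (le_trans ?_ (mul_le_mul_right hr.le K))
  -- The path is only known to be `C¹` on the closed interval, so the chain rule is used on the open
  -- one, which differs by a null set.
  rw [← MeasureTheory.lintegral_const_mul' _ _ hK, ← MeasureTheory.restrict_Ioo_eq_restrict_Icc]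
  refine MeasureTheory.setLIntegral_mono_ae' measurableSet_Ioo
    (Filter.Eventually.of_forall fun t ht => ?_)
  have hγt : DifferentiableAt ℝ γ t :=
    ((hγ.contDiffAt (Icc_mem_nhds ht.1 ht.2)).differentiableAt one_ne_zero)
  have hd := ((hρ.differentiable one_ne_zero (γ t)).hasFDerivAt.comp_hasDerivAt t
    hγt.hasDerivAt).deriv
  rw [hd]
  exact hg _ _

/-- Completeness from a proper Lipschitz function. -/
theorem isCompleteMetric_of_proper {g : MetricField n} {ρ : Cn n → ℝ} (hρ : ContDiff ℝ 1 ρ)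
    {K : ℝ≥0∞} (hK : K ≠ ⊤) (hg : ∀ z v, ‖fderiv ℝ ρ z v‖ₑ ≤ K * tangentLength g z v)
    (hg' : ∀ z v, tangentLength g z v ≤ ENNReal.ofReal ‖v‖)
    (hproper : ∀ C, ∃ R, ∀ z, ρ z ≤ C → ‖z‖ ≤ R) : IsCompleteMetric g := by
  intro x hx
  obtain ⟨N, hN⟩ := hx 1 one_pos
  have hb : ∀ k, ρ (x (k + N)) ≤ ρ (x N) + K.toReal := fun k => by
    have h := enorm_sub_le_of_gDist_lt hρ hg hK (hN N le_rfl (k + N) (by omega))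
    rw [mul_one, ← ofReal_norm, ENNReal.ofReal_le_iff_le_toReal hK] at h
    have := (le_abs_self _).trans h
    linarith
  obtain ⟨R, hR⟩ := hproper (ρ (x N) + K.toReal)
  -- Properness confines the tail to a ball. The Euclidean limit of a subsequence is also a limit
  -- for `g`, since `g` is bounded above by the Euclidean metric.
  obtain ⟨p, -, φ, hφ, hp⟩ := (isCompact_closedBall (0 : Cn n) R).tendsto_subseq
    (x := fun k => x (k + N)) fun k => by simpa using hR _ (hb k)
  refine ⟨p, ENNReal.tendsto_atTop_zero.2 fun ε hε => ?_⟩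
  obtain ⟨M, hM⟩ := hx (ε / 2) (ENNReal.half_pos hε.ne')
  have hlim : Filter.Tendsto (fun m => ENNReal.ofReal ‖p - x (φ m + N)‖) Filter.atTop (𝓝 0) := by
    have : Filter.Tendsto (fun m => ‖p - x (φ m + N)‖) Filter.atTop (𝓝 0) := by
      have h := (tendsto_const_nhds (x := p)).sub hp
      simpa using h.norm
    simpa using ENNReal.tendsto_ofReal this
  have hev := (hlim.eventually_lt_const (ENNReal.half_pos hε.ne')).and
    (Filter.eventually_ge_atTop M)
  obtain ⟨m, hm, hmM⟩ := hev.exists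
  refine ⟨M, fun k hk => ?_⟩
  have h1 := hM k hk (φ m + N) (by have := hφ.id_le m; simp only [id] at this; omega)
  have h2 := (gDist_le_of_tangentLength_le hg' (x (φ m + N)) p).trans_lt hm
  calc gDist g (x k) p ≤ _ := gDist_triangle g _ (x (φ m + N)) _
    _ ≤ ε / 2 + ε / 2 := add_le_add h1.le h2.le
    _ = ε := ENNReal.add_halves ε

/-! ### Completeness of the soliton -/

theorem potentialDeriv_le_one (hn : 1 ≤ n) {s : ℝ} (hs : 0 ≤ s) : potentialDeriv n s ≤ 1 := by
  have h1 : 1 ≤ weight n (radiusInv n s) := by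
    rw [← weight_zero hn]
    exact mul_le_mul_of_nonneg_left (expMoment_mono _ (radiusInv_nonneg hn hs)) (Nat.cast_nonneg _)
  have h2 : 1 ≤ weightRoot n (radiusInv n s) :=
    Real.one_le_exp (div_nonneg (Real.log_nonneg h1) (by positivity))
  exact inv_le_one_of_one_le₀ h2

theorem tangentLength_solitonMetric_le (hn : 1 ≤ n) (z v : Cn n) :
    tangentLength (solitonMetric n) z v ≤ ENNReal.ofReal ‖v‖ := by
  apply ENNReal.ofReal_le_ofReal
  apply Real.sqrt_le_iff.2 ⟨norm_nonneg _, ?_⟩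
  have hs : 0 ≤ ‖z‖ ^ 2 := by positivity
  rw [solitonMetric, realInner_radialMetric]
  have h1 := potentialDeriv_le_one hn hs
  have h2 := (deriv_potentialDeriv_neg hn hs).le
  nlinarith [mul_nonneg (sub_nonneg.2 h1) (sq_nonneg ‖v‖),
    mul_nonneg (neg_nonneg.2 h2) (sq_nonneg ‖hdot v z‖)]

theorem expMoment_le_exp_div (m : ℕ) {x : ℝ} (hx : 0 ≤ x) :
    (m + 1) * expMoment m x ≤ Real.exp x := by
  have := mul_expMoment_succ m x
  have := mul_nonneg hx (expMoment_pos (m + 1) x).le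
  linarith

theorem radius_le (hn : 1 ≤ n) {x : ℝ} (hx : 0 ≤ x) : radius n x ≤ x * Real.exp x := by
  have h1 : weight n x ≤ Real.exp x := by
    have := expMoment_le_exp_div (n - 1) hx
    rw [Nat.cast_sub hn] at this
    simpa [weight] using this
  have hn' : (1 : ℝ) ≤ n := by exact_mod_cast hn
  refine mul_le_mul_of_nonneg_left (Real.exp_le_exp.2 ?_) hx
  have : Real.log (weight n x) ≤ x := (Real.log_le_iff_le_exp (weight_pos hn x)).2 h1
  rw [div_le_iff₀ (by linarith)]
  nlinarith

/-- The radial eigenvalue of the metric decays at most like `1/s`. -/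
theorem radial_eigenvalue_lower (hn : 1 ≤ n) {s : ℝ} (hs : 0 < s) :
    1 ≤ 6 * (1 + s) * (potentialDeriv n s + s * deriv (potentialDeriv n) s) := by
  obtain ⟨t, rfl⟩ : ∃ t, Real.exp t = s := ⟨Real.log s, Real.exp_log hs⟩
  have h1 := (profile_sub_deriv_bounds hn t).2
  have hd := deriv_profile_eq hn t
  have hx := profile_pos hn t
  have hK : Real.exp t ≤ profile n t * Real.exp (profile n t) :=
    (radius_profile hn t).symm.le.trans (radius_le hn hx.le)
  have hn' : (1 : ℝ) ≤ n := by exact_mod_cast hn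
  generalize potentialDeriv n (Real.exp t) + Real.exp t * deriv (potentialDeriv n) (Real.exp t)
    = l at *
  generalize deriv (profile n) t = p at *
  generalize Real.exp t = s at *
  generalize profile n t = x at *
  have h2 : n * x < (x + n) * p := by nlinarith
  have key : s ≤ 6 * (1 + s) * p := by
    -- For `x ≤ 1` one has `s ≤ x e^x ≤ 3x` and `x ≤ 2φ'`; for `x > 1` already `φ' ≥ 1/2`. Both rest
    -- on `nx < (x + n) φ'`.
    rcases le_or_gt x 1 with h | h
    · have h3 : s ≤ 3 * x := by
        have h4 : Real.exp x ≤ 3 := (Real.exp_le_exp.2 h).trans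
          (by have := Real.exp_one_lt_d9; linarith)
        nlinarith
      have h4 : x ≤ 2 * p := by nlinarith
      nlinarith
    · have h3 : 1 ≤ 2 * p := by nlinarith
      nlinarith
  have h5 : s * 1 ≤ s * (6 * (1 + s) * l) := by rw [hd] at key; linarith
  exact le_of_mul_le_mul_left h5 hs

/-- The exhaustion function `log (1 + |z|²)`. -/
def exhaustion (z : Cn n) : ℝ := Real.log (1 + ‖z‖ ^ 2)

theorem exhaustion_hasFDerivAt (z : Cn n) :
    HasFDerivAt exhaustion ((1 + ‖z‖ ^ 2)⁻¹ • normSqDeriv z) z :=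
  ((hasFDerivAt_norm_sq z).const_add 1).log (by positivity)

theorem exhaustion_contDiff : ContDiff ℝ 1 (exhaustion (n := n)) :=
  ((contDiff_const.add (contDiff_norm_sq.of_le (by exact_mod_cast le_top))).log
    fun z => by positivity)

theorem normSqDeriv_eq (z v : Cn n) : normSqDeriv z v = 2 * (hdot v z).re := by
  rw [normSqDeriv_apply, hdot, Complex.re_sum, Finset.mul_sum]
  refine Finset.sum_congr rfl fun i _ => ?_
  simp
  ring

theorem exhaustion_deriv_sq_le (hn : 1 ≤ n) (z v : Cn n) :
    (fderiv ℝ exhaustion z v) ^ 2 ≤ 25 * realInner (solitonMetric n) z v v := by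
  have hs : 0 ≤ ‖z‖ ^ 2 := by positivity
  rw [(exhaustion_hasFDerivAt z).fderiv, smul_apply, normSqDeriv_eq, solitonMetric,
    realInner_radialMetric, smul_eq_mul]
  have h0 := potentialDeriv_pos n (‖z‖ ^ 2)
  have hre : (hdot v z).re ^ 2 ≤ ‖hdot v z‖ ^ 2 :=
    sq_le_sq.2 (by rw [abs_of_nonneg (norm_nonneg (hdot v z))]; exact Complex.abs_re_le_norm _)
  rcases eq_or_ne z 0 with rfl | hz
  · have : hdot v 0 = 0 := by simp [hdot]
    simp [this]
    have := potentialDeriv_pos n 0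
    positivity
  · have hs : (0 : ℝ) < ‖z‖ ^ 2 := by have := norm_pos_iff.2 hz; positivity
    have hl := radial_eigenvalue_lower hn hs
    have hcs := norm_hdot_sq_le v z
    generalize potentialDeriv n (‖z‖ ^ 2) = h at *
    generalize deriv (potentialDeriv n) (‖z‖ ^ 2) = h' at *
    generalize ‖z‖ ^ 2 = s at *
    generalize ‖v‖ ^ 2 = V at *
    generalize ‖hdot v z‖ ^ 2 = a at *
    generalize (hdot v z).re = r at *
    have e1 : ((1 + s)⁻¹ * (2 * r)) ^ 2 = 4 * r ^ 2 / (1 + s) ^ 2 := by field_simp; ring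
    rw [e1, div_le_iff₀ (by positivity)]
    have ha : 0 ≤ a := (sq_nonneg r).trans hre
    -- Cauchy–Schwarz `a ≤ V s`: the radial component of `v` alone contributes at most the full
    -- length.
    have e2 : (h + s * h') * a ≤ s * (h * V + h' * a) := by nlinarith
    have e3 : a ≤ 6 * (1 + s) * (s * (h * V + h' * a)) := by nlinarith
    have e4 : 0 ≤ h * V + h' * a := by
      by_contra hneg
      have : s * (h * V + h' * a) < 0 := mul_neg_of_pos_of_neg hs (not_le.1 hneg)
      nlinarith [mul_pos (show (0 : ℝ) < 6 * (1 + s) by positivity) (neg_pos.2 this)]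
    -- The constant is rounded up from `24` to a square, so that the Lipschitz constant is `5`.
    have e5 : 24 * (1 + s) * s ≤ 25 * (1 + s) ^ 2 := by nlinarith
    calc 4 * r ^ 2 ≤ 4 * (6 * (1 + s) * (s * (h * V + h' * a))) := by linarith
      _ = 24 * (1 + s) * s * (h * V + h' * a) := by ring
      _ ≤ 25 * (1 + s) ^ 2 * (h * V + h' * a) := mul_le_mul_of_nonneg_right e5 e4
      _ = _ := by ring

theorem isCompleteMetric_solitonMetric (hn : 1 ≤ n) : IsCompleteMetric (solitonMetric n) := by
  refine isCompleteMetric_of_proper exhaustion_contDiff (K := ENNReal.ofReal 5)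
    ENNReal.ofReal_ne_top (fun z v => ?_) (tangentLength_solitonMetric_le hn) fun C => ?_
  · rw [tangentLength, ← ENNReal.ofReal_mul (by norm_num), ← ofReal_norm]
    apply ENNReal.ofReal_le_ofReal
    rw [Real.norm_eq_abs]
    apply Real.abs_le_sqrt _ |>.trans_eq
    · rw [show (5 : ℝ) = Real.sqrt 25 by
        rw [show (25 : ℝ) = 5 ^ 2 by norm_num, Real.sqrt_sq (by norm_num)],
        ← Real.sqrt_mul (by norm_num)]
    · exact exhaustion_deriv_sq_le hn z v
  · refine ⟨Real.exp C + 1, fun z hz => ?_⟩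
    have h1 : 1 + ‖z‖ ^ 2 ≤ Real.exp C := by
      rwa [exhaustion, Real.log_le_iff_le_exp (by positivity)] at hz
    nlinarith [sq_nonneg (‖z‖ - 1), norm_nonneg z]

end

noncomputable section

/-! ### Unitarily invariant Kähler metrics -/

variable {n : ℕ} {g : MetricField n}

theorem herm_single (g : MetricField n) (z : Cn n) (i j : Fin n) (a b : ℂ) :
    herm g z (EuclideanSpace.single i a) (EuclideanSpace.single j b)
      = g z i j * a * (starRingEnd ℂ) b := by
  rw [herm, Finset.sum_eq_single i, Finset.sum_eq_single j]
  · simp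
  · intro k _ hk; simp [hk]
  · simp
  · intro k _ hk; simp [hk]
  · simp

/-- The unitary reflection in the `j`-th coordinate. -/
def coordReflection (j : Fin n) : Cn n ≃ₗᵢ[ℂ] Cn n :=
  LinearIsometryEquiv.piLpCongrRight 2 (fun k =>
    if k = j then LinearIsometryEquiv.neg ℂ else LinearIsometryEquiv.refl ℂ ℂ)

theorem coordReflection_apply (j : Fin n) (z : Cn n) (k : Fin n) :
    coordReflection j z k = if k = j then -z k else z k := by
  change (if k = j then LinearIsometryEquiv.neg ℂ else LinearIsometryEquiv.refl ℂ ℂ) (z k) = _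
  split_ifs <;> rfl

/-- The reflection in the `j`-th coordinate fixes `z` and `eᵢ` but reverses `eⱼ`, so the entry
equals its negative. -/
theorem IsUnitaryInvariant.entry_eq_zero (hU : IsUnitaryInvariant g) {z : Cn n} {i j : Fin n}
    (hz : z j = 0) (hij : i ≠ j) : g z i j = 0 ∧ g z j i = 0 := by
  have e1 : coordReflection j z = z := by
    ext k
    rw [coordReflection_apply]
    split_ifs with h
    · rw [h, hz, neg_zero]
    · rfl
  have e2 : coordReflection j (EuclideanSpace.single i (1 : ℂ)) = EuclideanSpace.single i 1 := by
    ext k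
    rw [coordReflection_apply]
    split_ifs with h
    · subst h; simp [hij.symm]
    · rfl
  have e3 : coordReflection j (EuclideanSpace.single j (1 : ℂ)) = EuclideanSpace.single j (-1) := by
    ext k
    rw [coordReflection_apply]
    split_ifs with h
    · subst h; simp
    · simp [h]
  constructor
  · have := hU (coordReflection j) z (EuclideanSpace.single i 1) (EuclideanSpace.single j 1)
    rw [e1, e2, e3, herm_single, herm_single] at this
    simp only [map_neg, map_one, mul_one, mul_neg] at this
    exact self_eq_neg.1 this.symm
  · have := hU (coordReflection j) z (EuclideanSpace.single j 1) (EuclideanSpace.single i 1)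
    rw [e1, e2, e3, herm_single, herm_single] at this
    simp only [map_one, mul_one, mul_neg] at this
    exact self_eq_neg.1 this.symm

theorem IsUnitaryInvariant.diag_eq (hU : IsUnitaryInvariant g) {o j k : Fin n} (hj : j ≠ o)
    (hk : k ≠ o) (r : ℂ) :
    g (EuclideanSpace.single o r) j j = g (EuclideanSpace.single o r) k k := by
  have := hU (LinearIsometryEquiv.piLpCongrLeft 2 ℂ ℂ (Equiv.swap j k))
    (EuclideanSpace.single o r) (EuclideanSpace.single k 1) (EuclideanSpace.single k 1)
  rw [EuclideanSpace.piLpCongrLeft_single, EuclideanSpace.piLpCongrLeft_single,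
    Equiv.swap_apply_right, Equiv.swap_apply_of_ne_of_ne hj.symm hk.symm, herm_single,
    herm_single] at this
  simpa using this

/-- For `z ≠ 0`, extend `z/|z|` to an orthonormal basis with this vector in position `o`. -/
theorem exists_unitary_map_single (o : Fin n) (z : Cn n) :
    ∃ U : Cn n ≃ₗᵢ[ℂ] Cn n, U (EuclideanSpace.single o (‖z‖ : ℂ)) = z := by
  rcases eq_or_ne z 0 with rfl | hz
  · exact ⟨LinearIsometryEquiv.refl ℂ _, by ext k; simp⟩
  have hz' : (‖z‖ : ℂ) ≠ 0 := by exact_mod_cast norm_ne_zero_iff.2 hz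
  have ho : Orthonormal ℂ (({o} : Set (Fin n)).domRestrict (fun _ => (‖z‖ : ℂ)⁻¹ • z)) := by
    constructor
    · intro i
      simp [Set.domRestrict, norm_smul, norm_ne_zero_iff.2 hz]
    · intro i j hij
      exact absurd (Subsingleton.elim i j) hij
  obtain ⟨b, hb⟩ := ho.exists_orthonormalBasis_extension_of_card_eq (by simp)
  refine ⟨(EuclideanSpace.basisFun (Fin n) ℂ).equiv b (Equiv.refl _), ?_⟩
  have e : EuclideanSpace.single o (‖z‖ : ℂ)
      = (‖z‖ : ℂ) • EuclideanSpace.basisFun (Fin n) ℂ o := by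
    ext k
    simp [EuclideanSpace.basisFun_apply, PiLp.single_apply]
  rw [e, map_smul, OrthonormalBasis.equiv_apply_basis, Equiv.refl_apply, hb o rfl, smul_smul,
    mul_inv_cancel₀ hz', one_smul]

/-- A unitarily invariant Hermitian form is determined by its radial and tangential eigenvalues. -/
theorem IsUnitaryInvariant.herm_eq (hU : IsUnitaryInvariant g) (o : Fin n) {z : Cn n} (hz : z ≠ 0)
    {b : ℂ} (hb : ∀ k, k ≠ o → g (EuclideanSpace.single o (‖z‖ : ℂ)) k k = b) (v w : Cn n) :
    herm g z v w = b * hdot v w + (g (EuclideanSpace.single o (‖z‖ : ℂ)) o o - b)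
      / ((‖z‖ ^ 2 : ℝ) : ℂ) * (hdot v z * hdot z w) := by
  have hz' : (‖z‖ : ℂ) ≠ 0 := by exact_mod_cast norm_ne_zero_iff.2 hz
  have hdiag : ∀ v w : Cn n, herm g (EuclideanSpace.single o (‖z‖ : ℂ)) v w
      = b * hdot v w + (g (EuclideanSpace.single o (‖z‖ : ℂ)) o o - b)
        * (v o * (starRingEnd ℂ) (w o)) := by
    intro v w
    have e : ∀ i, ∑ j, g (EuclideanSpace.single o (‖z‖ : ℂ)) i j * v i * (starRingEnd ℂ) (w j)
        = b * (v i * (starRingEnd ℂ) (w i)) + (if i = o then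
          (g (EuclideanSpace.single o (‖z‖ : ℂ)) o o - b) * (v o * (starRingEnd ℂ) (w o))
          else 0) := by
      intro i
      rw [Finset.sum_eq_single i]
      · split_ifs with h
        · subst h; ring
        · rw [hb i h]; ring
      · intro j _ hj
        have : g (EuclideanSpace.single o (‖z‖ : ℂ)) i j = 0 := by
          by_cases h : j = o
          · exact (hU.entry_eq_zero (j := i) (i := j) (by
              have : i ≠ o := fun h' => hj (h.trans h'.symm)
              simp [this]) hj).2
          · exact (hU.entry_eq_zero (by simp [h]) hj.symm).1
        rw [this]; ring
      · simp
    rw [herm, Finset.sum_congr rfl fun i _ => e i, Finset.sum_add_distrib, hdot, Finset.mul_sum]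
    simp
  obtain ⟨U, hUz⟩ := exists_unitary_map_single o z
  have hco : ∀ v : Cn n, (U.symm v) o = hdot v z / (‖z‖ : ℂ) := by
    intro v
    have h1 : hdot (U.symm v) (EuclideanSpace.single o (‖z‖ : ℂ)) = hdot v z := by
      rw [← hdot_map U, hUz, U.apply_symm_apply]
    rw [← h1, hdot, Finset.sum_eq_single o]
    · simp [hz']
    · intro k _ hk; simp [hk]
    · simp
  have h2 := hU U (EuclideanSpace.single o (‖z‖ : ℂ)) (U.symm v) (U.symm w)
  rw [hUz, U.apply_symm_apply, U.apply_symm_apply] at h2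
  rw [h2, hdiag, hco, hco, hdot_map, map_div₀, conj_hdot, Complex.conj_ofReal]
  push_cast
  field_simp

theorem IsUnitaryInvariant.entry_eq (hU : IsUnitaryInvariant g) (o : Fin n) {z : Cn n}
    (hz : z ≠ 0) {b : ℂ} (hb : ∀ k, k ≠ o → g (EuclideanSpace.single o (‖z‖ : ℂ)) k k = b)
    (i j : Fin n) :
    g z i j = b * (if i = j then 1 else 0) + (g (EuclideanSpace.single o (‖z‖ : ℂ)) o o - b)
      / ((‖z‖ ^ 2 : ℝ) : ℂ) * ((starRingEnd ℂ) (z i) * z j) := by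
  have h := hU.herm_eq o hz hb (EuclideanSpace.single i 1) (EuclideanSpace.single j 1)
  rw [herm_single, map_one, mul_one, mul_one] at h
  rw [h]
  have h1 : hdot (EuclideanSpace.single i 1) z = (starRingEnd ℂ) (z i) := by
    rw [hdot, Finset.sum_eq_single i]
    · simp
    · intro k _ hk; simp [hk]
    · simp
  have h2 : hdot z (EuclideanSpace.single j 1) = z j := by
    rw [hdot, Finset.sum_eq_single j]
    · simp
    · intro k _ hk; simp [hk]
    · simp
  have h3 : hdot (EuclideanSpace.single i (1 : ℂ)) (EuclideanSpace.single j 1)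
      = if i = j then 1 else 0 := by
    rw [hdot, Finset.sum_eq_single i]
    · simp [PiLp.single_apply]
    · intro k _ hk; simp [hk]
    · simp
  rw [h1, h2, h3]

/-- The real diagonal entry `g_{k k̄}` at the point of the `o`-axis with `|z|² = s`. -/
def axisEntry (g : MetricField n) (o k : Fin n) (s : ℝ) : ℝ :=
  (g (EuclideanSpace.single o ((Real.sqrt s : ℝ) : ℂ)) k k).re

theorem IsKahlerMetric.axisEntry_pos (hK : IsKahlerMetric g) (o k : Fin n) (s : ℝ) :
    0 < axisEntry g o k s :=
  (Complex.pos_iff.1 ((hK.posDef _).diag_pos (i := k))).1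

theorem IsKahlerMetric.ofReal_axisEntry (hK : IsKahlerMetric g) (o k : Fin n) (s : ℝ) :
    (axisEntry g o k s : ℂ) = g (EuclideanSpace.single o ((Real.sqrt s : ℝ) : ℂ)) k k :=
  Complex.ext rfl (Complex.pos_iff.1 ((hK.posDef _).diag_pos (i := k))).2

/-- The real line in the `o`-axis. -/
def realAxis (o : Fin n) : ℝ →L[ℝ] Cn n :=
  (ContinuousLinearMap.id ℝ ℝ).smulRight (EuclideanSpace.single o (1 : ℂ))

theorem realAxis_apply (o : Fin n) (r : ℝ) : realAxis o r = EuclideanSpace.single o (r : ℂ) := by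
  ext k
  by_cases h : k = o
  · subst h; simp [realAxis]
  · simp [realAxis, h]

theorem IsKahlerMetric.continuous_axisEntry (hK : IsKahlerMetric g) (o k : Fin n) :
    Continuous (axisEntry g o k) := by
  have : axisEntry g o k = fun s => (g (realAxis o (Real.sqrt s)) k k).re :=
    funext fun s => by rw [realAxis_apply]; rfl
  rw [this]
  exact Complex.continuous_re.comp ((hK.smooth k k).continuous.comp
    ((realAxis o).continuous.comp Real.continuous_sqrt))

theorem IsKahlerMetric.contDiffAt_axisEntry (hK : IsKahlerMetric g) (o k : Fin n) {s : ℝ}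
    (hs : 0 < s) : ContDiffAt ℝ ∞ (axisEntry g o k) s := by
  have : axisEntry g o k = fun s => (g (realAxis o (Real.sqrt s)) k k).re :=
    funext fun s => by rw [realAxis_apply]; rfl
  rw [this]
  exact Complex.reCLM.contDiff.contDiffAt.comp s (((hK.smooth k k).comp
    (realAxis o).contDiff).contDiffAt.comp s (Real.contDiffAt_sqrt hs.ne'))

theorem IsKahlerMetric.entry_eq (hK : IsKahlerMetric g) (hU : IsUnitaryInvariant g) (o : Fin n)
    {h : ℝ → ℝ} (hh : ∀ s, 0 < s → ∀ k, k ≠ o → axisEntry g o k s = h s) {z : Cn n} (hz : z ≠ 0)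
    (i j : Fin n) :
    g z i j = (h (‖z‖ ^ 2) : ℂ) * (if i = j then 1 else 0)
      + (((axisEntry g o o (‖z‖ ^ 2) - h (‖z‖ ^ 2)) / ‖z‖ ^ 2 : ℝ) : ℂ)
        * ((starRingEnd ℂ) (z i) * z j) := by
  have hs : 0 < ‖z‖ ^ 2 := by positivity
  have hq : Real.sqrt (‖z‖ ^ 2) = ‖z‖ := Real.sqrt_sq (norm_nonneg z)
  have ha : ∀ k, g (EuclideanSpace.single o (‖z‖ : ℂ)) k k
      = (axisEntry g o k (‖z‖ ^ 2) : ℂ) := by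
    intro k; rw [hK.ofReal_axisEntry, hq]
  rw [hU.entry_eq o hz (b := (h (‖z‖ ^ 2) : ℂ)) (fun k hk => by rw [ha, hh _ hs k hk]) i j, ha]
  push_cast
  rfl

theorem norm_sq_single (o : Fin n) (r : ℂ) : ‖EuclideanSpace.single o r‖ ^ 2 = ‖r‖ ^ 2 := by
  rw [PiLp.norm_single]

/-- The Kähler condition relates the two eigenvalues. -/
theorem IsKahlerMetric.deriv_axisEntry (hK : IsKahlerMetric g) (hU : IsUnitaryInvariant g)
    {o p : Fin n} (hop : p ≠ o) {s : ℝ} (hs : 0 < s) :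
    deriv (axisEntry g o p) s = (axisEntry g o o s - axisEntry g o p s) / s := by
  set h := axisEntry g o p with hh
  set k : ℝ → ℝ := fun s => (axisEntry g o o s - h s) / s with hk
  have hdiag : ∀ s, 0 < s → ∀ k, k ≠ o → axisEntry g o k s = h s := by
    intro s _ k hk
    rw [hh, axisEntry, axisEntry, hU.diag_eq hk hop]
  set z : Cn n := EuclideanSpace.single o ((Real.sqrt s : ℝ) : ℂ) with hz
  have hq : 0 < Real.sqrt s := Real.sqrt_pos.2 hs
  have hzs : ‖z‖ ^ 2 = s := by
    rw [hz, norm_sq_single, Complex.norm_real, Real.norm_of_nonneg hq.le, Real.sq_sqrt hs.le]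
  have hz0 : z ≠ 0 := by
    intro h0
    rw [h0, norm_zero] at hzs
    exact hs.ne (by simpa using hzs)
  have hev : ∀ i j, (fun w => g w i j) =ᶠ[𝓝 z] fun w =>
      (h (‖w‖ ^ 2) : ℂ) * (if i = j then 1 else 0)
        + (k (‖w‖ ^ 2) : ℂ) * ((starRingEnd ℂ) (w i) * w j) := by
    intro i j
    filter_upwards [isOpen_ne.mem_nhds hz0] with w hw
    exact hK.entry_eq hU o hdiag hw i j
  have dh : HasDerivAt h (deriv h s) (‖z‖ ^ 2) := by
    rw [hzs]
    exact ((hK.contDiffAt_axisEntry o p hs).differentiableAt (by simp)).hasDerivAt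
  have dk : HasDerivAt k (deriv k s) (‖z‖ ^ 2) := by
    rw [hzs]
    exact ((((hK.contDiffAt_axisEntry o o hs).differentiableAt (by simp)).sub
      ((hK.contDiffAt_axisEntry o p hs).differentiableAt (by simp))).div differentiableAt_id
      hs.ne').hasDerivAt
  have hd : ∀ l i j, dz l (fun w => g w i j) z = _ := fun l i j =>
    ((((dz_radial l dh).mul_const (if i = j then 1 else 0)).add
      ((dz_radial l dk).mul ((dz_conj_coord l i z).mul (dz_coord l j z)))).congr_of_eventuallyEq
        (hev i j)).dz
  -- At a point of the `o`-axis, `∂ₒ g_{p p̄} = ∂ₚ g_{o p̄}` reduces to `h' z̄ᵒ = k z̄ᵒ`.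
  have hc := hK.closed z p p o
  rw [hd, hd, hzs] at hc
  have zo : z o = ((Real.sqrt s : ℝ) : ℂ) := by simp [hz]
  have zp : z p = 0 := by simp [hz, hop]
  simp only [zo, zp, if_true, Complex.conj_ofReal, map_zero, mul_one, mul_zero, add_zero,
    zero_add, if_neg hop.symm] at hc
  have hq' : ((Real.sqrt s : ℝ) : ℂ) ≠ 0 := by exact_mod_cast hq.ne'
  have := mul_right_cancel₀ hq' hc
  exact_mod_cast this

/-- An invariant Kähler metric is, away from the origin, of the form `h δ_{ij} + h' z̄ⁱ zʲ`. -/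
theorem IsKahlerMetric.exists_radial (hn : 1 ≤ n) (hK : IsKahlerMetric g)
    (hU : IsUnitaryInvariant g) :
    ∃ h : ℝ → ℝ, (∀ s, 0 < s → ContDiffAt ℝ ∞ h s) ∧ (∀ z, z ≠ 0 → g z = radialMetric n h z) ∧
      (∀ s, 0 < s → 0 < h s) ∧ (∀ s, 0 < s → 0 < h s + s * deriv h s) ∧
      Filter.Tendsto (fun s => s * h s) (𝓝[>] 0) (𝓝 0) := by
  let o : Fin n := ⟨0, hn⟩
  have key : ∀ h : ℝ → ℝ, (∀ s, 0 < s → ∀ k, k ≠ o → axisEntry g o k s = h s) →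
      (∀ s, 0 < s → deriv h s = (axisEntry g o o s - h s) / s) →
      (∀ z, z ≠ 0 → g z = radialMetric n h z) ∧ (∀ s, 0 < s → 0 < h s + s * deriv h s) := by
    intro h h1 h2
    constructor
    · intro z hz
      ext i j
      rw [hK.entry_eq hU o h1 hz, radialMetric, h2 _ (by positivity)]
    · intro s hs
      rw [h2 s hs, mul_div_cancel₀ _ hs.ne', add_sub_cancel]
      exact hK.axisEntry_pos o o s
  by_cases hp : ∃ p : Fin n, p ≠ o
  · obtain ⟨p, hp⟩ := hp
    obtain ⟨k1, k2⟩ := key (axisEntry g o p)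
      (fun s _ k hk => by rw [axisEntry, axisEntry, hU.diag_eq hk hp])
      (fun s hs => hK.deriv_axisEntry hU hp hs)
    refine ⟨_, fun s hs => hK.contDiffAt_axisEntry o p hs, k1,
      fun s _ => hK.axisEntry_pos o p s, k2, ?_⟩
    have : Continuous fun s => s * axisEntry g o p s :=
      continuous_id.mul (hK.continuous_axisEntry o p)
    exact (this.tendsto' 0 0 (by simp)).mono_left nhdsWithin_le_nhds
  -- For `n = 1` there is no tangential entry to serve as `h`. The function is recovered from the
  -- radial eigenvalue by integrating `(sh)'`, and `X = sh` tends to `0` by construction.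
  · push Not at hp
    have hc := hK.continuous_axisEntry o o
    set X : ℝ → ℝ := fun s => ∫ y in (0 : ℝ)..s, axisEntry g o o y with hX
    have dX : ∀ s, HasDerivAt X (axisEntry g o o s) s := fun s =>
      intervalIntegral.integral_hasDerivAt_right (hc.intervalIntegrable _ _)
        (hc.stronglyMeasurableAtFilter _ _) hc.continuousAt
    have hXpos : ∀ s, 0 < s → 0 < X s := fun s hs =>
      intervalIntegral.intervalIntegral_pos_of_pos (hc.intervalIntegrable _ _)
        (fun y => hK.axisEntry_pos o o y) hs
    have sX : ∀ s, 0 < s → ContDiffAt ℝ ∞ X s := by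
      have hon : ContDiffOn ℝ ∞ X (Set.Ioi 0) := by
        rw [contDiffOn_infty_iff_deriv_of_isOpen isOpen_Ioi]
        refine ⟨fun s _ => (dX s).differentiableAt.differentiableWithinAt, ?_⟩
        rw [show deriv X = axisEntry g o o from funext fun s => (dX s).deriv]
        exact fun s hs => (hK.contDiffAt_axisEntry o o hs).contDiffWithinAt
      exact fun s hs => hon.contDiffAt (Ioi_mem_nhds hs)
    have dh : ∀ s, 0 < s → deriv (fun s => X s / s) s = (axisEntry g o o s - X s / s) / s := by
      intro s hs
      refine ((dX s).div (hasDerivAt_id s) hs.ne').deriv.trans ?_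
      simp only [id]
      field_simp
    obtain ⟨k1, k2⟩ := key (fun s => X s / s) (fun s _ k hk => absurd (hp k) hk) dh
    refine ⟨_, fun s hs => (sX s hs).div contDiffAt_id hs.ne', k1,
      fun s hs => div_pos (hXpos s hs) hs, k2, ?_⟩
    have h0 : Filter.Tendsto X (𝓝[>] 0) (𝓝 0) := by
      have := (dX 0).continuousAt.tendsto
      rw [show X 0 = 0 from intervalIntegral.integral_same] at this
      exact this.mono_left nhdsWithin_le_nhds
    refine h0.congr' ?_
    filter_upwards [self_mem_nhdsWithin] with s hs
    exact (mul_div_cancel₀ _ (ne_of_gt hs)).symm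

end

noncomputable section

/-! ### The soliton equation along a complex line -/

variable {n : ℕ} {g : MetricField n}

/-- The complex `o`-axis. -/
def axis (o : Fin n) : ℂ →L[ℝ] Cn n :=
  ((ContinuousLinearMap.id ℂ ℂ).smulRight (EuclideanSpace.single o (1 : ℂ))).restrictScalars ℝ

theorem axis_apply (o : Fin n) (ζ : ℂ) : axis o ζ = EuclideanSpace.single o ζ := by
  ext k
  by_cases h : k = o
  · subst h; simp [axis]
  · simp [axis, h]

theorem fderiv_comp_axis {F : Cn n → ℂ} {o : Fin n} {ζ : ℂ} (hF : DifferentiableAt ℝ F (axis o ζ))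
    (v : ℂ) : fderiv ℝ (fun ξ => F (axis o ξ)) ζ v
      = fderiv ℝ F (axis o ζ) (EuclideanSpace.single o v) := by
  have := (hF.hasFDerivAt.comp ζ (axis o).hasFDerivAt).fderiv
  rw [← axis_apply]
  exact congrArg (fun A : ℂ →L[ℝ] ℂ => A v) this

theorem wirtinger_eq_zero_of_axis {F : Cn n → ℂ} {o : Fin n} (hF : Differentiable ℝ F)
    (h0 : ∀ ζ, F (axis o ζ) = 0) (c ζ : ℂ) : wirtinger c o F (axis o ζ) = 0 := by
  rw [wirtinger, ← fderiv_comp_axis (hF _), ← fderiv_comp_axis (hF _), funext h0]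
  simp

/-- A function annihilated by `∂` along the axis is the conjugate of a holomorphic function. -/
theorem differentiable_conj_of_axis {F : Cn n → ℂ} {o : Fin n}
    (h : ∀ ζ, HasWirtingerAt (-Complex.I) o F 0 (axis o ζ)) :
    Differentiable ℂ (fun ζ => (starRingEnd ℂ) (F (axis o ζ))) := by
  intro ζ
  obtain ⟨hd, hw⟩ := h ζ
  have hd' : DifferentiableAt ℝ (fun ξ => F (axis o ξ)) ζ :=
    hd.comp ζ (axis o).differentiableAt
  have hc := (Complex.conjCLE : ℂ →L[ℝ] ℂ).hasFDerivAt.comp ζ hd'.hasFDerivAt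
  rw [wirtinger, ← fderiv_comp_axis hd, ← fderiv_comp_axis hd] at hw
  refine differentiableAt_complex_iff_differentiableAt_real.2 ⟨hc.differentiableAt, ?_⟩
  have e : fderiv ℝ (fun ζ => (starRingEnd ℂ) (F (axis o ζ))) ζ = _ := hc.fderiv
  rw [e]
  change (starRingEnd ℂ) (fderiv ℝ (fun ξ => F (axis o ξ)) ζ Complex.I)
    = Complex.I * (starRingEnd ℂ) (fderiv ℝ (fun ξ => F (axis o ξ)) ζ 1)
  have e2 : fderiv ℝ (fun ξ => F (axis o ξ)) ζ Complex.I
      = -Complex.I * fderiv ℝ (fun ξ => F (axis o ξ)) ζ 1 := by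
    linear_combination (2 * Complex.I) * hw
      + fderiv ℝ (fun ξ => F (axis o ξ)) ζ Complex.I * Complex.I_mul_I
  rw [e2, map_mul, map_neg, Complex.conj_I, neg_neg]

theorem contDiff_wirtinger {F : Cn n → ℂ} (hF : ContDiff ℝ ∞ F) (c : ℂ) (i : Fin n) :
    ContDiff ℝ ∞ (wirtinger c i F) := by
  have h : ∀ v : Cn n, ContDiff ℝ ∞ (fun z => fderiv ℝ F z v) := fun v =>
    (hF.fderiv_right (m := ∞) (by simp)).clm_apply contDiff_const
  exact contDiff_const.mul ((h _).add (contDiff_const.mul (h _)))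

theorem contDiff_dz {F : Cn n → ℂ} (hF : ContDiff ℝ ∞ F) (i : Fin n) : ContDiff ℝ ∞ (dz i F) := by
  rw [funext (dz_eq_wirtinger i F)]
  exact contDiff_wirtinger hF _ i

theorem hasWirtingerAt_dz {F : Cn n → ℂ} (hF : ContDiff ℝ ∞ F) (i : Fin n) (z : Cn n) :
    HasWirtingerAt (-Complex.I) i F (dz i F z) z :=
  ⟨hF.differentiable (by simp) z, (dz_eq_wirtinger i F z).symm⟩

theorem conj_dz_ofReal {f : Cn n → ℝ} (hf : ContDiff ℝ ∞ f) (i : Fin n) (z : Cn n) :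
    (starRingEnd ℂ) (dz i (fun w => (f w : ℂ)) z) = dzbar i (fun w => (f w : ℂ)) z := by
  have h : ∀ v, fderiv ℝ (fun w => (f w : ℂ)) z v = ((fderiv ℝ f z v : ℝ) : ℂ) := by
    intro v
    have := (Complex.ofRealCLM.hasFDerivAt.comp z
      (hf.differentiable (by simp) z).hasFDerivAt).fderiv
    exact congrArg (fun A : Cn n →L[ℝ] ℂ => A v) this
  rw [dz, dzbar, h, h]
  simp [Complex.conj_ofNat]

theorem IsKahlerMetric.det_pos (hK : IsKahlerMetric g) (z : Cn n) : 0 < (g z).det.re :=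
  (Complex.pos_iff.1 (hK.posDef z).det_pos).1

theorem IsKahlerMetric.contDiff_log_det (hK : IsKahlerMetric g) :
    ContDiff ℝ ∞ (fun z => -Real.log (g z).det.re) := by
  have h : ContDiff ℝ ∞ (fun z => (g z).det) := by
    simp only [Matrix.det_apply']
    exact ContDiff.sum fun σ _ => contDiff_const.mul (contDiff_prod fun i _ => hK.smooth _ _)
  exact ((Complex.reCLM.contDiff.comp h).log fun z => (hK.det_pos z).ne').neg

theorem IsKahlerMetric.entry_ne_zero (hK : IsKahlerMetric g) (z : Cn n) (i : Fin n) :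
    g z i i ≠ 0 := ((hK.posDef z).diag_pos (i := i)).ne'

/-- Along the axis the metric is diagonal, hence so is its inverse. -/
theorem gInv_axis (hK : IsKahlerMetric g) (hU : IsUnitaryInvariant g) (o k : Fin n) (ζ : ℂ) :
    gInv g (axis o ζ) k o = if k = o then (g (axis o ζ) o o)⁻¹ else 0 := by
  have hu : IsUnit (g (axis o ζ)).det :=
    (Matrix.isUnit_iff_isUnit_det _).1 (hK.posDef _).isUnit
  have h0 := hK.entry_ne_zero (axis o ζ) o
  have h := congrFun (congrFun (Matrix.mul_nonsing_inv (g (axis o ζ)) hu) o) k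
  rw [Matrix.mul_apply, Finset.sum_eq_single o] at h
  · rw [gInv]
    rw [Matrix.one_apply] at h
    split_ifs with hk
    · rw [if_pos hk.symm] at h
      exact eq_inv_of_mul_eq_one_right h
    · rw [if_neg (Ne.symm hk)] at h
      exact (mul_eq_zero.1 h).resolve_left h0
  · intro j _ hj
    rw [(hU.entry_eq_zero (i := o) (j := j) (by simp [axis_apply, hj]) hj.symm).1, zero_mul]
  · simp

theorem christoffel_axis (hK : IsKahlerMetric g) (hU : IsUnitaryInvariant g) (o k : Fin n)
    (ζ : ℂ) : christoffel g (axis o ζ) o o k = if k = o then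
      (g (axis o ζ) o o)⁻¹ * dz o (fun w => g w o o) (axis o ζ) else 0 := by
  rw [christoffel, Finset.sum_eq_single o]
  · rw [gInv_axis hK hU]
    split_ifs <;> simp
  · intro l _ hl
    have : dz o (fun w => g w o l) (axis o ζ) = 0 := by
      rw [dz_eq_wirtinger]
      refine wirtinger_eq_zero_of_axis ((hK.smooth o l).differentiable (by simp)) (fun ξ => ?_) _ ζ
      exact (hU.entry_eq_zero (by simp [axis_apply, hl]) hl.symm).1
    rw [this, mul_zero]
  · simp

/-- The soliton equation on the axis, integrated once: the gradient field and the difference of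
potentials are holomorphic. -/
theorem exists_holomorphic_of_isGradientSoliton (hg : IsGradientSoliton g)
    (hU : IsUnitaryInvariant g) (o : Fin n) :
    ∃ W H : ℂ → ℂ, Differentiable ℂ W ∧ Differentiable ℂ H ∧
      ∀ ζ, g (axis o ζ) o o * (starRingEnd ℂ) (W ζ)
        = H ζ + dz o (fun w => ((-Real.log (g w).det.re : ℝ) : ℂ)) (axis o ζ) := by
  have hK := hg.kahler
  obtain ⟨f, hf, hric, hhess⟩ := hg.soliton
  have hfc := contDiff_ofReal hf
  have hlc := contDiff_ofReal hK.contDiff_log_det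
  have h1 : ∀ ζ, HasWirtingerAt (-Complex.I) o
      (fun w => dz o (fun w => (f w : ℂ)) w * (g w o o)⁻¹) 0 (axis o ζ) := by
    intro ζ
    have hd : Differentiable ℝ (fun w => dz o (fun w => (f w : ℂ)) w * (g w o o)⁻¹) := fun w =>
      ((contDiff_dz hfc o).differentiable (by simp) w).mul
        (((hK.smooth o o).differentiable (by simp) w).inv (hK.entry_ne_zero w o))
    refine ⟨hd _, ?_⟩
    -- By the product rule applied to `(f_o / g_{oō}) g_{oō} = f_o`, the derivative of the quotient
    -- times `g_{oō}` is the covariant Hessian `f_{,oo}`, which vanishes.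
    have hm := ((hasWirtingerAt_of_differentiableAt (c := -Complex.I) (i := o)
      (hd (axis o ζ))).mul (hasWirtingerAt_dz (hK.smooth o o) o (axis o ζ))).dz
    have e : (fun w => dz o (fun w => (f w : ℂ)) w * (g w o o)⁻¹ * g w o o)
        = dz o (fun w => (f w : ℂ)) :=
      funext fun w => inv_mul_cancel_right₀ (hK.entry_ne_zero w o) _
    have hc := hhess (axis o ζ) o o
    rw [covHess, Finset.sum_congr rfl fun k _ => congrArg (· * _) (christoffel_axis hK hU o k ζ)]
      at hc
    simp only [ite_mul, zero_mul, Finset.sum_ite_eq', Finset.mem_univ, if_true] at hc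
    rw [e] at hm
    refine (mul_eq_zero.1 ?_).resolve_right (hK.entry_ne_zero (axis o ζ) o)
    linear_combination hc - hm
  have h2 : ∀ z, HasWirtingerAt (-Complex.I) o (fun w => dzbar o (fun w => (f w : ℂ)) w
      - dzbar o (fun w => ((-Real.log (g w).det.re : ℝ) : ℂ)) w) 0 z := by
    intro z
    refine ((hasWirtingerAt_dz (contDiff_wirtinger hfc Complex.I o) o z).sub
      (hasWirtingerAt_dz (contDiff_wirtinger hlc Complex.I o) o z)).congr ?_
    exact sub_eq_zero.2 (hric z o o).symm
  refine ⟨_, _, differentiable_conj_of_axis h1, differentiable_conj_of_axis fun ζ => h2 _,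
    fun ζ => ?_⟩
  rw [Complex.conj_conj, ← conj_dz_ofReal hf, ← conj_dz_ofReal hK.contDiff_log_det, ← map_sub,
    Complex.conj_conj]
  have := hK.entry_ne_zero (axis o ζ) o
  field_simp
  ring

/-- The real part of an entire function that vanishes on a circle vanishes at the centre. -/
theorem re_eq_zero_of_circle {F : ℂ → ℂ} (hF : Differentiable ℂ F) {r : ℝ}
    (h : ∀ ζ ∈ Metric.sphere (0 : ℂ) |r|, (F ζ).re = 0) : (F 0).re = 0 := by
  have h1 := hF.diffContOnCl.circleAverage (c := 0) (R := r)
  have h2 := Complex.reCLM.circleAverage_comp_comm (f := F) (c := 0) (R := r)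
    hF.continuous.continuousOn.circleIntegrable'
  rw [h1] at h2
  exact h2.symm.trans (Real.circleAverage_const_on_circle h)

/-- The reduced soliton equation: `log det g` has derivative proportional to the radial
eigenvalue. -/
theorem exists_deriv_log_det (hn : 1 ≤ n) (hg : IsGradientSoliton g) (hU : IsUnitaryInvariant g)
    {h : ℝ → ℝ} (hh : ∀ s, 0 < s → ContDiffAt ℝ ∞ h s)
    (hgh : ∀ z, z ≠ 0 → g z = radialMetric n h z) (h0 : ∀ s, 0 < s → 0 < h s)
    (h1 : ∀ s, 0 < s → 0 < h s + s * deriv h s) :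
    ∃ c : ℝ, ∀ s, 0 < s → HasDerivAt (fun s => Real.log (h s ^ (n - 1) * (h s + s * deriv h s)))
      (-c * (h s + s * deriv h s)) s := by
  let o : Fin n := ⟨0, hn⟩
  obtain ⟨W, H, hW, hH, hWH⟩ := exists_holomorphic_of_isGradientSoliton hg hU o
  -- The constant is the real part of `W'(0)`, the linear part of the gradient field at the origin.
  refine ⟨(dslope W 0 0).re, fun s hs => ?_⟩
  set lam : ℝ → ℝ := fun s => Real.log (h s ^ (n - 1) * (h s + s * deriv h s)) with hlam
  have hdd : DifferentiableAt ℝ (deriv h) s :=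
    (((hh s hs).fderiv_right (m := ∞) (by simp)).clm_apply contDiffAt_const).differentiableAt
      (by simp)
  have hd : DifferentiableAt ℝ h s := (hh s hs).differentiableAt (by simp)
  have hl : DifferentiableAt ℝ lam s :=
    ((hd.pow _).mul (hd.add (differentiableAt_id.mul hdd))).log
      (mul_pos (pow_pos (h0 s hs) _) (h1 s hs)).ne'
  suffices deriv lam s = -(dslope W 0 0).re * (h s + s * deriv h s) from this ▸ hl.hasDerivAt
  set E := h s + s * deriv h s with hE
  set r := Real.sqrt s with hr
  have hr0 : 0 < r := Real.sqrt_pos.2 hs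
  have hD : Differentiable ℂ (dslope W 0) := by
    rw [← differentiableOn_univ, Complex.differentiableOn_dslope Filter.univ_mem]
    exact hW.differentiableOn
  -- On the circle `|ζ|² = s` the radial quantities are constants, and the soliton identity
  -- multiplied by `ζ` says that the real part of this entire function vanishes. Its value at `0` is
  -- the desired equation times `s`.
  have hF : Differentiable ℂ (fun ζ => (E : ℂ) * (ζ * (starRingEnd ℂ) (W 0) + s * dslope W 0 ζ)
      + s * ((deriv lam s : ℝ) : ℂ) - ζ * H ζ) := by fun_prop
  have hz := re_eq_zero_of_circle hF (r := r) ?_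
  · simp only [zero_mul, zero_add, sub_zero] at hz
    rw [← mul_assoc, ← Complex.ofReal_mul, ← Complex.ofReal_mul, Complex.add_re,
      Complex.re_ofReal_mul, Complex.ofReal_re] at hz
    have : s * (deriv lam s + (dslope W 0 0).re * E) = 0 := by linarith
    linarith [(mul_eq_zero.1 this).resolve_left hs.ne']
  intro ζ hζ
  rw [abs_of_pos hr0, mem_sphere_zero_iff_norm] at hζ
  have hζs : ‖axis o ζ‖ ^ 2 = s := by
    rw [axis_apply, norm_sq_single, hζ, hr, Real.sq_sqrt hs.le]
  have hζ0 : axis o ζ ≠ 0 := by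
    intro h
    rw [h, norm_zero] at hζs
    exact hs.ne (by simpa using hζs)
  have hcz : (starRingEnd ℂ) ζ * ζ = s := by
    rw [mul_comm, Complex.mul_conj, Complex.normSq_eq_norm_sq, hζ, hr, Real.sq_sqrt hs.le]
  have hgo : g (axis o ζ) o o = E := by
    rw [hgh _ hζ0, radialMetric, hζs, hE]
    simp only [axis_apply, if_true, mul_one, PiLp.single_apply, hcz]
    push_cast
    ring
  have hdz : dz o (fun w => ((-Real.log (g w).det.re : ℝ) : ℂ)) (axis o ζ)
      = -((deriv lam s : ℝ) : ℂ) * (starRingEnd ℂ) ζ := by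
    have hl' : HasDerivAt lam (deriv lam s) (‖axis o ζ‖ ^ 2) := by
      rw [hζs]; exact hl.hasDerivAt
    have := ((dz_radial o hl').neg.congr_of_eventuallyEq
      (G := fun w => ((-Real.log (g w).det.re : ℝ) : ℂ)) ?_).dz
    · rw [this, neg_mul, axis_apply]
      simp
    · filter_upwards [isOpen_ne.mem_nhds hζ0] with w hw
      rw [hgh w hw, det_radialMetric hn w (h0 _ (by positivity)).ne', Complex.ofReal_re,
        Complex.ofReal_neg]
  have hmain := hWH ζ
  rw [hgo, hdz] at hmain
  have hW1 : W ζ = W 0 + ζ * dslope W 0 ζ := by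
    have := sub_smul_dslope W 0 ζ
    rw [sub_zero, smul_eq_mul] at this
    rw [this]; ring
  -- Conjugation replaces the antiholomorphic contribution of `W(0)` by a holomorphic one that
  -- vanishes at the centre.
  have e1 : ((starRingEnd ℂ) ζ * W 0).re = (ζ * (starRingEnd ℂ) (W 0)).re := by
    rw [← Complex.conj_re]; simp
  have e2 : ((E : ℂ) * ((starRingEnd ℂ) ζ * W ζ)).re = (ζ * H ζ - s * ((deriv lam s : ℝ) : ℂ)).re := by
    rw [← Complex.conj_re]
    congr 1
    rw [map_mul, map_mul, Complex.conj_conj, Complex.conj_ofReal]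
    linear_combination ζ * hmain - ((deriv lam s : ℝ) : ℂ) * hcz
  have e3 : (starRingEnd ℂ) ζ * W ζ = (starRingEnd ℂ) ζ * W 0 + s * dslope W 0 ζ := by
    rw [hW1]
    linear_combination dslope W 0 ζ * hcz
  rw [e3, Complex.re_ofReal_mul, Complex.add_re, e1, ← Complex.add_re, ← Complex.re_ofReal_mul,
    Complex.sub_re] at e2
  rw [Complex.sub_re, Complex.add_re, e2]
  ring

end

noncomputable section

/-! ### Classification of invariant solitons -/

theorem eq_of_hasDerivAt_zero {F : ℝ → ℝ} (hF : ∀ s, 0 < s → HasDerivAt F 0 s) {s t : ℝ}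
    (hs : 0 < s) (ht : 0 < t) : F s = F t :=
  isOpen_Ioi.is_const_of_deriv_eq_zero isPreconnected_Ioi
    (fun s hs => (hF s hs).differentiableAt.differentiableWithinAt) (fun s hs => (hF s hs).deriv)
    hs ht

theorem eq_zero_of_hasDerivAt_zero {F : ℝ → ℝ} (hF : ∀ s, 0 < s → HasDerivAt F 0 s)
    (h0 : Filter.Tendsto F (𝓝[>] 0) (𝓝 0)) {s : ℝ} (hs : 0 < s) : F s = 0 := by
  have : Filter.Tendsto F (𝓝[>] 0) (𝓝 (F s)) := by
    refine tendsto_const_nhds.congr' ?_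
    filter_upwards [self_mem_nhdsWithin] with t ht
    exact eq_of_hasDerivAt_zero hF hs ht
  exact tendsto_nhds_unique this h0

/-! ### The radial equation on the half line for each sign of the constant `c`. -/

section ODE

variable {m : ℕ} {x x' : ℝ → ℝ} {c K : ℝ}

theorem tendsto_mul_pow_zero (K : ℝ) (m : ℕ) :
    Filter.Tendsto (fun s : ℝ => K * s ^ (m + 1)) (𝓝[>] 0) (𝓝 0) :=
  ((continuous_const.mul (continuous_pow (m + 1))).tendsto' 0 0 (by simp)).mono_left
    nhdsWithin_le_nhds

theorem exists_pow_eq {K : ℝ} (hK : 0 < K) (m : ℕ) : ∃ k : ℝ, 0 < k ∧ k ^ (m + 1) = K :=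
  ⟨K ^ (((m + 1 : ℕ) : ℝ)⁻¹), Real.rpow_pos_of_pos hK _,
    Real.rpow_inv_natCast_pow hK.le (Nat.succ_ne_zero m)⟩

/-- The linear solutions of the profile equation. -/
theorem profile_ode_linear (hK : 0 < K) (hx : ∀ s, 0 < s → HasDerivAt x (x' s) s)
    (hpos : ∀ s, 0 < s → 0 < x s) (h0 : Filter.Tendsto x (𝓝[>] 0) (𝓝 0))
    (hode : ∀ s, 0 < s → x s ^ m * x' s = K * s ^ m) :
    ∃ k, 0 < k ∧ ∀ s, 0 < s → x s = k * s := by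
  obtain ⟨k, hk, hkK⟩ := exists_pow_eq hK m
  refine ⟨k, hk, fun s hs => ?_⟩
  have hF : ∀ s, 0 < s → HasDerivAt (fun s => x s ^ (m + 1) - K * s ^ (m + 1)) 0 s := by
    intro s hs
    refine (((hx s hs).pow (m + 1)).sub ((hasDerivAt_pow (m + 1) s).const_mul K)).congr_deriv ?_
    simp only [add_tsub_cancel_right]
    linear_combination ((m + 1 : ℕ) : ℝ) * hode s hs
  have ht := (h0.pow (m + 1)).sub (tendsto_mul_pow_zero K m)
  rw [zero_pow (Nat.succ_ne_zero m), sub_zero] at ht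
  have := eq_zero_of_hasDerivAt_zero hF ht hs
  refine (pow_left_inj₀ (hpos s hs).le (by positivity) (n := m + 1) (by omega)).1 ?_
  rw [mul_pow, hkK]
  linarith

/-- The solutions of the profile equation with the soliton as model. -/
theorem profile_ode_soliton (hc : 0 < c) (hK : 0 < K) (hx : ∀ s, 0 < s → HasDerivAt x (x' s) s)
    (hpos : ∀ s, 0 < s → 0 < x s) (h0 : Filter.Tendsto x (𝓝[>] 0) (𝓝 0))
    (hode : ∀ s, 0 < s → x s ^ m * x' s * Real.exp (c * x s) = K * s ^ m) :
    ∃ a, 0 < a ∧ ∀ s, 0 < s → x s = c⁻¹ * radiusInv (m + 1) (a * s) := by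
  have hm : 1 ≤ m + 1 := Nat.le_add_left 1 m
  obtain ⟨k, hk, hkK⟩ := exists_pow_eq hK m
  refine ⟨c * k, by positivity, fun s hs => ?_⟩
  -- The equation integrated in the rescaled unknown `cx`. The constant of integration is zero
  -- because `x → 0` as `s → 0`.
  have hF : ∀ s, 0 < s → HasDerivAt (fun s => ((m + 1 : ℕ) : ℝ) * powExpIntegral m (c * x s)
      - c ^ (m + 1) * K * s ^ (m + 1)) 0 s := by
    intro s hs
    have h1 := (powExpIntegral_hasDerivAt m (c * x s)).comp s ((hx s hs).const_mul c)
    refine ((h1.const_mul ((m + 1 : ℕ) : ℝ)).sub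
      ((hasDerivAt_pow (m + 1) s).const_mul _)).congr_deriv ?_
    simp only [add_tsub_cancel_right]
    rw [mul_pow]
    linear_combination ((m + 1 : ℕ) : ℝ) * c ^ (m + 1) * hode s hs
  have hp : Filter.Tendsto (fun s => ((m + 1 : ℕ) : ℝ) * powExpIntegral m (c * x s)) (𝓝[>] 0)
      (𝓝 0) := by
    have h1 : ContinuousAt (fun y => ((m + 1 : ℕ) : ℝ) * powExpIntegral m (c * y)) 0 :=
      continuousAt_const.mul (ContinuousAt.comp (g := powExpIntegral m)
        (powExpIntegral_hasDerivAt m (c * 0)).continuousAt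
        (continuousAt_const.mul continuousAt_id))
    have h2 := h1.tendsto.comp h0
    simpa [Function.comp_def] using h2
  have ht := hp.sub (tendsto_mul_pow_zero (c ^ (m + 1) * K) m)
  rw [sub_zero] at ht
  have := eq_zero_of_hasDerivAt_zero hF ht hs
  have hr := radius_pow hm (c * x s)
  rw [Nat.add_sub_cancel] at hr
  have hcx : 0 < c * x s := mul_pos hc (hpos s hs)
  have : radius (m + 1) (c * x s) = c * k * s := by
    have h0 : 0 ≤ radius (m + 1) (c * x s) := (mul_pos hcx (weightRoot_pos _ _)).le
    refine (pow_left_inj₀ h0 (by positivity) (n := m + 1) (by omega)).1 ?_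
    rw [hr, mul_pow, mul_pow, hkK]
    linarith
  rw [← this, radiusInv_radius hm, inv_mul_cancel_left₀ hc.ne']

/-- The profile equation has no global solution with the opposite sign. -/
theorem profile_ode_false (hc : c < 0) (hK : 0 < K) (hx : ∀ s, 0 < s → HasDerivAt x (x' s) s)
    (hpos : ∀ s, 0 < s → 0 < x s) (hpos' : ∀ s, 0 < s → 0 < x' s)
    (hode : ∀ s, 0 < s → x s ^ m * x' s * Real.exp (c * x s) = K * s ^ m) : False := by
  set b := -c / 2 with hb
  have hb0 : 0 < b := by linarith
  set D : ℝ := m.factorial / b ^ m with hD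
  have hD0 : 0 < D := by positivity
  -- Half of the decay of `e^{cy} = e^{-2by}` absorbs the power `y^m`, leaving `e^{-by}`, which has
  -- an explicit primitive.
  have hle : ∀ y, 0 < y → y ^ m ≤ D * Real.exp (b * y) := by
    intro y hy
    have := Real.pow_div_factorial_le_exp _ (mul_pos hb0 hy).le m
    rw [mul_pow, div_le_iff₀ (by positivity)] at this
    rw [hD, div_mul_eq_mul_div, le_div_iff₀ (by positivity)]
    linarith
  set F : ℝ → ℝ := fun s => K / (m + 1) * s ^ (m + 1) + D / b * Real.exp (-(b * x s)) with hF
  have dF : ∀ s, 0 < s → HasDerivAt F (K * s ^ m - D * Real.exp (-(b * x s)) * x' s) s := by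
    intro s hs
    refine (((hasDerivAt_pow (m + 1) s).const_mul (K / (m + 1))).add
      ((((hx s hs).const_mul b).neg.exp).const_mul (D / b))).congr_deriv ?_
    simp only [add_tsub_cancel_right]
    rw [Pi.neg_apply]
    push_cast
    field_simp
    ring
  have hneg : ∀ s, 0 < s → K * s ^ m - D * Real.exp (-(b * x s)) * x' s ≤ 0 := by
    intro s hs
    have e : Real.exp (c * x s) = Real.exp (-(b * x s)) * Real.exp (-(b * x s)) := by
      rw [← Real.exp_add]; congr 1; rw [hb]; ring
    have e2 : Real.exp (b * x s) * Real.exp (-(b * x s)) = 1 := by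
      rw [← Real.exp_add]; simp
    rw [← hode s hs, e]
    have h1 := mul_le_mul_of_nonneg_right (hle _ (hpos s hs)) (Real.exp_pos (-(b * x s))).le
    rw [mul_assoc, e2, mul_one] at h1
    have h2 := mul_le_mul_of_nonneg_right h1
      (mul_pos (Real.exp_pos (-(b * x s))) (hpos' s hs)).le
    linarith
  have hanti : AntitoneOn F (Set.Ici 1) := by
    have hp : ∀ s ∈ Set.Ici (1 : ℝ), 0 < s := fun s hs => lt_of_lt_of_le one_pos hs
    refine antitoneOn_of_deriv_nonpos (convex_Ici 1)
      (fun s hs => (dF s (hp s hs)).continuousAt.continuousWithinAt) (fun s hs => ?_)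
      (fun s hs => ?_)
    · exact (dF s (hp s (interior_subset hs))).differentiableAt.differentiableWithinAt
    · rw [(dF s (hp s (interior_subset hs))).deriv]
      exact hneg s (hp s (interior_subset hs))
  -- The antitone `F` dominates a positive multiple of `s^{m+1}`, so a linearly growing function
  -- would be bounded.
  have hbound : ∀ s, 1 ≤ s → K / (m + 1) * s ≤ F 1 := by
    intro s hs
    have h1 : F s ≤ F 1 := hanti Set.self_mem_Ici hs hs
    have h2 : s ≤ s ^ (m + 1) := le_self_pow₀ hs (Nat.succ_ne_zero m)
    have h3 : K / (m + 1) * s ≤ K / (m + 1) * s ^ (m + 1) :=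
      mul_le_mul_of_nonneg_left h2 (by positivity)
    have h4 : 0 ≤ D / b * Real.exp (-(b * x s)) := by positivity
    simp only [hF] at h1 ⊢
    linarith
  have hk : 0 < K / (m + 1) := by positivity
  have h1 := hbound (1 + |F 1| / (K / (m + 1))) (by
    have : 0 ≤ |F 1| / (K / (m + 1)) := by positivity
    linarith)
  rw [mul_add, mul_one, mul_div_cancel₀ _ hk.ne'] at h1
  linarith [le_abs_self (F 1)]

end ODE

variable {n : ℕ} {g : MetricField n}

/-- The radial form is known only for `z ≠ 0`; continuity carries identities over to the origin. -/
theorem eq_of_eq_compl_zero (hn : 1 ≤ n) {F G : Cn n → ℂ} (hF : Continuous F) (hG : Continuous G)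
    (h : ∀ z, z ≠ 0 → F z = G z) (z : Cn n) : F z = G z := by
  have : Nonempty (Fin n) := ⟨⟨0, hn⟩⟩
  exact congrFun (hF.ext_on (dense_compl_singleton (0 : Cn n)) hG fun w hw => h w hw) z

theorem radialMetric_congr {h k : ℝ → ℝ} (hk : ∀ s, 0 < s → h s = k s) {z : Cn n} (hz : z ≠ 0) :
    radialMetric n h z = radialMetric n k z := by
  have hs : 0 < ‖z‖ ^ 2 := by positivity
  have hev : h =ᶠ[𝓝 (‖z‖ ^ 2)] k := by
    filter_upwards [Ioi_mem_nhds hs] with s hs using hk s hs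
  ext i j
  rw [radialMetric, radialMetric, hk _ hs, hev.deriv_eq]

/-- Classification of the unitarily invariant steady gradient Kähler-Ricci solitons. -/
theorem isEuclidean_or_isScalingDilationOf (hn : 1 ≤ n) (hg : IsGradientSoliton g)
    (hU : IsUnitaryInvariant g) :
    IsEuclidean g ∨ IsScalingDilationOf g (solitonMetric n) := by
  obtain ⟨h, hh, hgh, h0, h1, hlim⟩ := hg.kahler.exists_radial hn hU
  obtain ⟨c, hc⟩ := exists_deriv_log_det hn hg hU hh hgh h0 h1
  obtain ⟨m, rfl⟩ : ∃ m, n = m + 1 := ⟨n - 1, by omega⟩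
  have hx : ∀ s, 0 < s → HasDerivAt (fun s => s * h s) (h s + s * deriv h s) s := fun s hs =>
    ((hasDerivAt_id s).mul ((hh s hs).differentiableAt (by simp)).hasDerivAt).congr_deriv
      (by simp)
  have hpos : ∀ s, 0 < s → 0 < s * h s := fun s hs => mul_pos hs (h0 s hs)
  -- Since `log det g + c·sh` is constant, `K` is the exponential of its value at `s = 1`; the
  -- factor `s^m` turns `h^m` into `(sh)^m`.
  obtain ⟨K, hK, hode⟩ : ∃ K : ℝ, 0 < K ∧ ∀ s, 0 < s →
      (s * h s) ^ m * (h s + s * deriv h s) * Real.exp (c * (s * h s)) = K * s ^ m := by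
    have hF : ∀ s, 0 < s → HasDerivAt (fun s => Real.log (h s ^ (m + 1 - 1) * (h s + s * deriv h s))
        + c * (s * h s)) 0 s := fun s hs =>
      ((hc s hs).add ((hx s hs).const_mul c)).congr_deriv (by ring)
    refine ⟨Real.exp (Real.log (h 1 ^ (m + 1 - 1) * (h 1 + 1 * deriv h 1)) + c * (1 * h 1)),
      Real.exp_pos _, fun s hs => ?_⟩
    rw [← eq_of_hasDerivAt_zero hF hs one_pos, Real.exp_add,
      Real.exp_log (mul_pos (pow_pos (h0 s hs) _) (h1 s hs)), mul_pow, Nat.add_sub_cancel]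
    ring
  rcases lt_trichotomy c 0 with hc0 | rfl | hc0
  · exact (profile_ode_false hc0 hK hx hpos h1 hode).elim
  · left
    obtain ⟨k, hk, hkx⟩ := profile_ode_linear hK hx hpos hlim
      (fun s hs => by simpa using hode s hs)
    refine ⟨k, hk, fun z i j => ?_⟩
    refine eq_of_eq_compl_zero hn (hg.kahler.smooth i j).continuous continuous_const
      (fun z hz => ?_) z
    rw [hgh z hz, radialMetric_congr (k := fun _ => k) (fun s hs => ?_) hz]
    · simp [radialMetric]
    · exact mul_left_cancel₀ hs.ne' ((hkx s hs).trans (mul_comm _ _))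
  · right
    obtain ⟨a, ha, hax⟩ := profile_ode_soliton hc0 hK hx hpos hlim hode
    have hsq : Real.sqrt a ^ 2 = a := Real.sq_sqrt ha.le
    have hsqC : ((Real.sqrt a : ℝ) : ℂ) ^ 2 = (a : ℂ) := by exact_mod_cast hsq
    -- Replacing `s = |z|²` by `a s` is the dilation of `z` by `√a`.
    refine ⟨c⁻¹, Real.sqrt a, inv_pos.2 hc0, Real.sqrt_pos.2 ha, fun z i j => ?_⟩
    have hcont : Continuous fun z : Cn (m + 1) => solitonMetric (m + 1) (Real.sqrt a • z) i j :=
      (contDiff_radialMetric (smoothOnHalfLine_potentialDeriv hn) i j).continuous.comp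
        (continuous_const_smul _)
    refine eq_of_eq_compl_zero hn
      (G := fun z => ((c⁻¹ * Real.sqrt a ^ 2 : ℝ) : ℂ) * solitonMetric (m + 1) (Real.sqrt a • z) i j)
      (hg.kahler.smooth i j).continuous (continuous_const.mul hcont) (fun z hz => ?_) z
    beta_reduce
    have hs : 0 < ‖z‖ ^ 2 := by positivity
    have hnorm : ‖Real.sqrt a • z‖ ^ 2 = a * ‖z‖ ^ 2 := by
      rw [norm_smul, mul_pow, Real.norm_of_nonneg (Real.sqrt_nonneg a), hsq]
    have hd : deriv (fun s => c⁻¹ * a * potentialDeriv (m + 1) (a * s)) (‖z‖ ^ 2)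
        = c⁻¹ * a * (a * deriv (potentialDeriv (m + 1)) (a * ‖z‖ ^ 2)) := by
      have h2 := ((smoothOnHalfLine_potentialDeriv hn).hasDerivAt
        (mul_pos ha hs).le).comp (‖z‖ ^ 2) ((hasDerivAt_id _).const_mul a)
      refine (h2.const_mul (c⁻¹ * a)).deriv.trans ?_
      ring
    rw [hgh z hz, radialMetric_congr (k := fun s => c⁻¹ * a * potentialDeriv (m + 1) (a * s))
      (fun s hs => ?_) hz]
    · simp only [solitonMetric, radialMetric, hnorm, hd, hsq, PiLp.smul_apply, Complex.real_smul,
        map_mul, Complex.conj_ofReal]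
      push_cast
      linear_combination -((c : ℂ)⁻¹ * a * ((deriv (potentialDeriv (m + 1)) (a * ‖z‖ ^ 2) : ℝ) : ℂ)
        * (starRingEnd ℂ) (z i) * z j) * hsqC
    · have := mul_potentialDeriv hn (mul_pos ha hs).le
      refine mul_left_cancel₀ hs.ne' ((hax s hs).trans ?_)
      rw [← this]
      ring

/-- The Euclidean metric is not positively curved. -/
theorem IsEuclidean.not_hasPositiveSectionalCurvature (hn : 1 ≤ n) (hg : IsEuclidean g) :
    ¬HasPositiveSectionalCurvature g := by
  intro hpos
  obtain ⟨c, -, hc⟩ := hg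
  let o : Fin n := ⟨0, hn⟩
  have hcurv : ∀ z i j k l, curv g z i j k l = 0 := by
    intro z i j k l
    have h1 : ∀ i j, (fun w => g w i j) = fun _ => if i = j then (c : ℂ) else 0 := fun i j =>
      funext fun w => hc w i j
    have h2 : ∀ i j l, dzbar l (fun w => g w i j) = fun _ => 0 := fun i j l => by
      rw [h1]; exact funext fun w => (hasWirtingerAt_const _ l _ w).dzbar
    simp only [curv, h2, (hasWirtingerAt_const _ k _ z).dz, mul_zero, Finset.sum_const_zero,
      neg_zero, add_zero]
  -- A complex line is a real plane, so a test plane exists even for `n = 1`.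
  have hli : LinearIndependent ℝ ![(EuclideanSpace.single o 1 : Cn n),
      EuclideanSpace.single o Complex.I] := by
    rw [LinearIndependent.pair_iff]
    intro a b hab
    have h := congrArg (fun v : Cn n => v o) hab
    simp at h
    have hre := congrArg Complex.re h
    have him := congrArg Complex.im h
    simp at hre him
    exact ⟨hre, him⟩
  have := hpos 0 _ _ hli
  simp [sectionalCurvature, hcurv] at this

end

end KRSoliton


/-! ### Assembly of existence, curvature, completeness and uniqueness. -/

theorem theorem1 (n : ℕ) (hn : 1 ≤ n) :
    ∃ (φ u : ℝ → ℝ) (Φ : Cn n → ℝ) (g : MetricField n),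
      -- the profile: the differential equation, its implicit solution, the curvature inequalities
      IsProfile n φ ∧
      (∀ t : ℝ, ∑ k ∈ Finset.range n,
          (-1 : ℝ) ^ (n - 1 - k) * ((n.factorial : ℝ) / (k.factorial : ℝ))
            * φ t ^ k * Real.exp (φ t)
        = Real.exp (n * t) + (-1 : ℝ) ^ (n - 1) * (n.factorial : ℝ)) ∧
      (∀ t : ℝ, 0 < φ t - deriv φ t ∧
        0 < deriv φ t ^ 2 - φ t * iteratedDeriv 2 φ t ∧
        0 < iteratedDeriv 2 φ t ^ 2 - deriv φ t * iteratedDeriv 3 φ t) ∧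
      -- the metric has the Kähler potential `u (log |z|²)`, where `u' = φ`
      (∀ t : ℝ, HasDerivAt u (φ t) t) ∧
      ContDiff ℝ ∞ Φ ∧
      (∀ z : Cn n, z ≠ 0 → Φ z = u (Real.log (‖z‖ ^ 2))) ∧
      (∀ (z : Cn n) (i j : Fin n), g z i j = ddbar Φ z i j) ∧
      -- the metric is the required soliton
      IsGradientSoliton g ∧ IsUnitaryInvariant g ∧ IsCompleteMetric g ∧
      HasPositiveSectionalCurvature g ∧
      -- for `n = 1` it is the cigar
      (n = 1 → ∀ (z : Cn n) (i j : Fin n), g z i j = ((1 / (1 + ‖z‖ ^ 2) : ℝ) : ℂ)) ∧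
      -- uniqueness
      (∀ g' : MetricField n, IsGradientSoliton g' → IsUnitaryInvariant g' →
        IsCompleteMetric g' → HasPositiveSectionalCurvature g' → IsScalingDilationOf g' g) ∧
      (∀ g' : MetricField n, IsGradientSoliton g' → IsUnitaryInvariant g' →
        IsCompleteMetric g' → IsEuclidean g' ∨ IsScalingDilationOf g' g) := by
  refine ⟨profile n, fun t => potential n (Real.exp t), fun w => potential n (‖w‖ ^ 2),
    solitonMetric n, isProfile_profile hn, fun t => ?_, fun t => ?_, potential_exp_hasDerivAt hn,
    contDiff_potential hn, fun z hz => ?_, solitonMetric_eq_ddbar hn,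
    isGradientSoliton_solitonMetric hn, isUnitaryInvariant_radialMetric _,
    isCompleteMetric_solitonMetric hn, hasPositiveSectionalCurvature_solitonMetric hn, ?_,
    fun g' hg hU _ hpos => ?_, fun g' hg hU _ => isEuclidean_or_isScalingDilationOf hn hg hU⟩
  · have h := powExpIntegral_profile hn t
    obtain ⟨m, rfl⟩ : ∃ m, n = m + 1 := ⟨n - 1, by omega⟩
    rw [sum_eq_powExpIntegral, Nat.add_sub_cancel, ← h]
    push_cast
    rfl
  · obtain ⟨h1, h2, h3, _⟩ := profile_curvature_inequalities hn t
    exact ⟨h1, h2, h3⟩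
  · simp only
    rw [Real.exp_log (by positivity)]
  · rintro rfl z i j
    exact solitonMetric_one z i j
  · exact (isEuclidean_or_isScalingDilationOf hn hg hU).resolve_left fun h =>
      h.not_hasPositiveSectionalCurvature hn hpos
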